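/- **Types, values, contexts.** Types are generated by $T ::= \mathrm{Void}\mid()\mid T\oplus T\mid T\otimes T$, and $\mathrm{Bit}=()\oplus()$. The set $V(T)$ of values is given by $V(\mathrm{Void})=\emptyset$, $V(())=\{()\}$, $V(T_0\oplus T_1)=\{\mathrm{left}\,v\}\sqcup\{\mathrm{right}\,w\}$, $V(T_0\otimes T_1)=V(T_0)\times V(T_1)$; $\mathcal H(T)=\mathbb C^{V(T)}$. A context is a finite list of bindings $x:T$ of variables (from a countably infinite set) to types. $V(\Delta)$ is the set of valuations of $\Delta$ and $\mathcal H(\Delta)=\mathbb C^{V(\Delta)}$. Juxtaposition $\Gamma,\Gamma'$ of contexts is concatenation. In a judgment $\Gamma\Vert\Delta\vdash\cdots$, $\Gamma$ is the classical and $\Delta$ the quantum part; whenever $\Gamma\Vert\Delta$ appears as the context in the conclusion of a rule it is required that all variables of $\Gamma,\Delta$ are distinct. Real constants $r$ range over an arbitrary countable set $R$ of representations with an evaluation map $R\to\mathbb R$. **Syntax.** Expressions $e ::= ()\mid x\mid (e,e)\mid \mathrm{ctrl}\;e\,\{e_1\mapsto e_1';\dots;e_n\mapsto e_n'\}_{T,T'}\mid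 \mathrm{try}\;e\;\mathrm{catch}\;e\mid f\,e$ ($n\ge0$), programs $f ::= u_3(r_\theta,r_\phi,r_\lambda)\mid \mathrm{left}_{T_0\oplus T_1}\mid\mathrm{right}_{T_0\oplus T_1}\mid \lambda e^{T}.e'\mid \mathrm{rphase}_T(e;r,r')$. In $\mathrm{ctrl}$, the patterns $e_j$ bind their variables in $e_j'$; programs have no free variables. **Auxiliary judgments.** $\mathrm{spanning}_T$ holds of lists of expressions by the rules: $\mathrm{spanning}_{\mathrm{Void}}()$ (empty list); $\mathrm{spanning}_{()}(())$; $\mathrm{spanning}_T(x)$; if $\mathrm{spanning}_T(e_1..e_n)$ and $\mathrm{spanning}_{T'}(e_1'..e'_{n'})$, then $\mathrm{spanning}_{T\oplus T'}(\mathrm{left}\,e_1..\mathrm{left}\,e_n,\mathrm{right}\,e'_1..\mathrm{right}\,e'_{n'})$; if $\mathrm{spanning}_T(e_1..e_m)$ and $\mathrm{spanning}_{T'}(e'_{j,1}..e'_{j,n_j})$ for all $j$, with $FV(e_j)\cap FV(e'_{j,k})=\emptyset$, then $\mathrm{spanning}_{T\otimes T'}$ of the list of all $(e_j,e'_{j,k})$;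 and closure under permutation. $\mathrm{ortho}_T(e_1..e_n)$ holds if the list is a subsequence of a spanning one. $\mathrm{erases}_T(x;\,\cdot\,)$ holds of lists of expressions by the rules: $\mathrm{erases}_T(x;x,\dots,x)$; an entry $e$ may be replaced by $\mathrm{rphase}_T(y;r,r)\,e$; consecutive entries $e_1',\dots,e_n'$ may be replaced by one entry $\mathrm{ctrl}\;e\{e_1\mapsto e'_1;\dots;e_n\mapsto e'_n\}_{T',T}$, provided that $x$ occurs in no pattern $e_k$; $\mathrm{erases}_{T_0\otimes T_1}(x;(e_1,e_1'),\dots,(e_n,e_n'))$ follows from $\mathrm{erases}_{T_0}(x;e_1..e_n)$, and likewise from $\mathrm{erases}_{T_1}(x;e_1'..e_n')$. **Typing and semantics.** Four judgments are derived simultaneously. A derivation of $\Gamma\Vert\Delta\vdash e:T$ (pure expression) denotes operators $\llbracket\sigma:\cdot\rrbracket:\mathcal H(\Delta)\to\mathcal H(T)$, $\sigma\in V(\Gamma)$; one of $\Delta\Vdash e:T$ (mixed expression) denotes a superoperator $\mathcal L(\mathcal H(\Delta))\to\mathcal L(\mathcal H(T))$; one of $\vdash f:T\rightsquigarrow T'$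 (pure program) an operator $\mathcal H(T)\to\mathcal H(T')$; one of $\vdash f:T\Rrightarrow T'$ (mixed program) a superoperator $\mathcal L(\mathcal H(T))\to\mathcal L(\mathcal H(T'))$. Superoperators are given on $|a\rangle\langle a'|$ and extended linearly. *Pure expressions.* - $\Gamma\Vert\emptyset\vdash():()$, with $|\emptyset\rangle\mapsto|()\rangle$. $\Gamma,x{:}T,\Gamma'\Vert\emptyset\vdash x:T$, with $|\emptyset\rangle\mapsto|\sigma(x)\rangle$. $\Gamma\Vert x{:}T\vdash x:T$, with $|x\mapsto v\rangle\mapsto|v\rangle$. - From $\Gamma\Vert\Delta,\Delta_0\vdash e_0:T_0$ and $\Gamma\Vert\Delta,\Delta_1\vdash e_1:T_1$: $\Gamma\Vert\Delta,\Delta_0,\Delta_1\vdash(e_0,e_1):T_0\otimes T_1$, with $|\tau,\tau_0,\tau_1\rangle\mapsto\llbracket\sigma:e_0\rrbracket|\tau,\tau_0\rangle\otimes\llbracket\sigma:e_1\rrbracket|\tau,\tau_1\rangle$. - From $\Gamma,\Delta\Vdash e:T$; $\mathrm{ortho}_T(e_1..e_n)$; $\emptyset\Vert\Gamma_j\vdash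 e_j:T$ for all $j$; $\mathrm{erases}_{T'}(x;e'_1..e'_n)$ for all $x\in\mathrm{dom}\,\Delta$; and $\Gamma,\Gamma',\Gamma_j\Vert\Delta,\Delta'\vdash e'_j:T'$ for all $j$: $\Gamma,\Gamma'\Vert\Delta,\Delta'\vdash\mathrm{ctrl}\;e\{e_1\mapsto e_1';\dots\}_{T,T'}:T'$, where for $\sigma\in V(\Gamma),\sigma'\in V(\Gamma')$ $$|\tau,\tau'\rangle\mapsto\sum_{v\in V(T)}\langle v|\llbracket e\rrbracket(|\sigma,\tau\rangle\langle\sigma,\tau|)|v\rangle\sum_{j=1}^n\sum_{\sigma_j\in V(\Gamma_j)}\langle\sigma_j|\llbracket\emptyset:e_j\rrbracket^\dagger|v\rangle\,\llbracket\sigma,\sigma',\sigma_j:e'_j\rrbracket|\tau,\tau'\rangle.$$ - From $\vdash f:T\rightsquigarrow T'$ and $\Gamma\Vert\Delta\vdash e:T$: $\Gamma\Vert\Delta\vdash f\,e:T'$, with $\llbracket f\rrbracket\llbracket\sigma:e\rrbracket$. Both parts of the context may be permuted, valuations being permuted accordingly. *Mixed expressions.* - From $\emptyset\Vert\Delta\vdash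 e:T$: $\Delta\Vdash e:T$, with $\rho\mapsto\llbracket\emptyset:e\rrbracket\rho\llbracket\emptyset:e\rrbracket^\dagger$. The context may be permuted, with $|\tau\rangle\langle\tau'|$ permuted accordingly. - From $\Delta,\Delta_0\Vdash e_0:T_0$ and $\Delta,\Delta_1\Vdash e_1:T_1$: $\Delta,\Delta_0,\Delta_1\Vdash(e_0,e_1):T_0\otimes T_1$, with $|\tau,\tau_0,\tau_1\rangle\langle\tau',\tau_0',\tau_1'|\mapsto\llbracket e_0\rrbracket(|\tau,\tau_0\rangle\langle\tau',\tau_0'|)\otimes\llbracket e_1\rrbracket(|\tau,\tau_1\rangle\langle\tau',\tau_1'|)$. - From $\Delta_0\Vdash e_0:T$ and $\Delta_1\Vdash e_1:T$: $\Delta_0,\Delta_1\Vdash\mathrm{try}\;e_0\;\mathrm{catch}\;e_1:T$, with $\rho_0\otimes\rho_1\mapsto\mathrm{tr}(\rho_1)\,\llbracket e_0\rrbracket(\rho_0)+\big(\mathrm{tr}(\rho_0)-\mathrm{tr}\,\llbracket e_0\rrbracket(\rho_0)\big)\llbracket e_1\rrbracket(\rho_1)$. - From $\vdash f:T\Rrightarrow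 T'$ and $\Delta\Vdash e:T$: $\Delta\Vdash f\,e:T'$, with $\llbracket f\rrbracket\circ\llbracket e\rrbracket$. *Pure programs.* - $\vdash u_3(r_\theta,r_\phi,r_\lambda):\mathrm{Bit}\rightsquigarrow\mathrm{Bit}$, with matrix $\begin{pmatrix}\cos(\theta/2)&-e^{i\lambda}\sin(\theta/2)\\e^{i\phi}\sin(\theta/2)&e^{i(\phi+\lambda)}\cos(\theta/2)\end{pmatrix}$ in the basis $\mathrm{left}(),\mathrm{right}()$, for the values $\theta,\phi,\lambda$ of the constants. - $\vdash\mathrm{left}_{T_0\oplus T_1}:T_0\rightsquigarrow T_0\oplus T_1$ and $\vdash\mathrm{right}_{T_0\oplus T_1}:T_1\rightsquigarrow T_0\oplus T_1$, the injections. - From $\emptyset\Vert\Delta\vdash e:T$ and $\emptyset\Vert\Delta\vdash e':T'$: $\vdash\lambda e^T.e':T\rightsquigarrow T'$, with $\llbracket\emptyset:e'\rrbracket\llbracket\emptyset:e\rrbracket^\dagger$. - From $\emptyset\Vert\Delta\vdash e:T$: $\vdash\mathrm{rphase}_T(e;r,r'):T\rightsquigarrow T$, with $e^{ir}P+e^{ir'}(I-P)$,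 $P=\llbracket\emptyset:e\rrbracket\llbracket\emptyset:e\rrbracket^\dagger$. *Mixed programs.* - From $\vdash f:T\rightsquigarrow T'$: $\vdash f:T\Rrightarrow T'$, with $\rho\mapsto\llbracket f\rrbracket\rho\llbracket f\rrbracket^\dagger$. - From $\emptyset\Vert\Delta,\Delta_0\vdash e:T$ and $\Delta\Vdash e':T'$: $\vdash\lambda e^T.e':T\Rrightarrow T'$, with $\rho\mapsto\llbracket e'\rrbracket\big(\mathrm{tr}_{\Delta_0}(\llbracket\emptyset:e\rrbracket^\dagger\rho\llbracket\emptyset:e\rrbracket)\big)$. **Encoding.** $\mathrm{size}(\mathrm{Void})=\mathrm{size}(())=0$, $\mathrm{size}(T_0\oplus T_1)=1+\max(\mathrm{size}\,T_0,\mathrm{size}\,T_1)$, $\mathrm{size}(T_0\otimes T_1)=\mathrm{size}\,T_0+\mathrm{size}\,T_1$. A value $v\in V(T)$ is encoded as a bit string $\mathrm{enc}(v)$ of length $\mathrm{size}(T)$: the empty string for $()$; $0$ (resp. $1$) followed by $\mathrm{enc}(v)$ and padded with zeros at the end, for $\mathrm{left}\,v$ (resp. $\mathrm{right}\,v$); concatenation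 for pairs. Sizes and encodings for contexts and valuations are obtained by summation and concatenation. **Circuits.** A low-level circuit consists of numbers $n_p,n_f,n_g$ of prep, flag and garbage qubits and a finite sequence of gates. A gate is a single-qubit gate $e^{i\alpha}u_3(\theta,\phi,\lambda)$ on a target wire, controlled on a (possibly empty) finite set of other wires; its parameters are written symbolically by $0$, $\pi$, constants in $R$, and negation. Let $X,Y$ be finite sets with injective encodings $\mathrm{enc}$ into $\{0,1\}^{a}$ and $\{0,1\}^{b}$. - The circuit *implements an operator* $E:\mathbb C^X\to\mathbb C^Y$ if $n_g=0$, $a+n_p=b+n_f$, all its gates fit on $a+n_p$ wires, the resulting operator $U$ on $(\mathbb C^2)^{\otimes(a+n_p)}$ is unitary, and $\langle\mathrm{enc}(y),0^{n_f}|U|\mathrm{enc}(x),0^{n_p}\rangle=\langle y|E|x\rangle$ for all $x\in X$, $y\in Y$. - It *implements a superoperator* $\mathcal E:\mathcal L(\mathbb C^X)\to\mathcal L(\mathbb C^Y)$ if $a+n_p=b+n_f+n_g$, all its gates fit on $a+n_p$ wires, the resulting operator $U$ is unitary, and for all $\rho\in\mathcal L(\mathbb C^X)$ and $y_1,y_2\in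 Y$ $$\langle y_1|\mathcal E(\rho)|y_2\rangle=\sum_{g\in\{0,1\}^{n_g}}\langle\mathrm{enc}(y_1),0^{n_f},g|\,U\hat\rho\,U^\dagger\,|\mathrm{enc}(y_2),0^{n_f},g\rangle,\qquad\hat\rho=\sum_{x,x'}\langle x|\rho|x'\rangle\,|\mathrm{enc}(x),0^{n_p}\rangle\langle\mathrm{enc}(x'),0^{n_p}|.$$ **Theorem.** For every countable set $R$ of real constants with a fixed Gödel numbering and every evaluation $R\to\mathbb R$ there is a recursive procedure (a function that is computable on Gödel numbers of derivations and circuits) that assigns to every typing derivation $D$ a low-level circuit, such that: 1. if $D$ derives $\vdash f:T\rightsquigarrow T'$, the circuit implements the operator $\llbracket D\rrbracket:\mathcal H(T)\to\mathcal H(T')$; 2. if $D$ derives $\Gamma\Vert\Delta\vdash e:T$, the circuit implements the operator $\mathcal H(\Gamma)\otimes\mathcal H(\Delta)\to\mathcal H(\Gamma)\otimes\mathcal H(T)$, $|\sigma\rangle\otimes|\tau\rangle\mapsto|\sigma\rangle\otimes\llbracket\sigma:D\rrbracket|\tau\rangle$; 3. if $D$ derives $\vdash f:T\Rrightarrow T'$,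 the circuit implements the superoperator $\llbracket D\rrbracket:\mathcal L(\mathcal H(T))\to\mathcal L(\mathcal H(T'))$; 4. if $D$ derives $\Delta\Vdash e:T$, the circuit implements the superoperator $\llbracket D\rrbracket:\mathcal L(\mathcal H(\Delta))\to\mathcal L(\mathcal H(T))$. -/

import Mathlib

/-! ### Types, values and the Hilbert spaces of types

The Hilbert space of a type (or of a context) is the space of complex functions on its canonical
orthonormal basis of values (valuations).  Operators are therefore matrices indexed by values, and
superoperators are linear maps between spaces of such matrices. -/

/-- Data types. -/
inductive Ty : Type
  | void : Ty
  | unit : Ty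
  | sum : Ty → Ty → Ty
  | prod : Ty → Ty → Ty

/-- The type of qubits. -/
abbrev Ty.bit : Ty := .sum .unit .unit

/-- The values of a type. -/
def Val : Ty → Type
  | .void => Empty
  | .unit => Unit
  | .sum a b => Val a ⊕ Val b
  | .prod a b => Val a × Val b

instance Val.instDecidableEq : (T : Ty) → DecidableEq (Val T)
  | .void => inferInstanceAs (DecidableEq Empty)
  | .unit => inferInstanceAs (DecidableEq Unit)
  | .sum a b =>
    haveI := Val.instDecidableEq a
    haveI := Val.instDecidableEq b
    inferInstanceAs (DecidableEq (Val a ⊕ Val b))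
  | .prod a b =>
    haveI := Val.instDecidableEq a
    haveI := Val.instDecidableEq b
    inferInstanceAs (DecidableEq (Val a × Val b))

instance Val.instFintype : (T : Ty) → Fintype (Val T)
  | .void => inferInstanceAs (Fintype Empty)
  | .unit => inferInstanceAs (Fintype Unit)
  | .sum a b =>
    haveI := Val.instFintype a
    haveI := Val.instFintype b
    inferInstanceAs (Fintype (Val a ⊕ Val b))
  | .prod a b =>
    haveI := Val.instFintype a
    haveI := Val.instFintype b
    inferInstanceAs (Fintype (Val a × Val b))

/-- The value `left v`. -/
def Val.mkLeft (a b : Ty) (v : Val a) : Val (.sum a b) := Sum.inl v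

/-- The value `right v`. -/
def Val.mkRight (a b : Ty) (v : Val b) : Val (.sum a b) := Sum.inr v

/-- Variable names: a fixed countably infinite set. -/
abbrev Var : Type := ℕ

/-- Typing contexts: ordered lists of bindings. -/
abbrev Ctx : Type := List (Var × Ty)

/-- The partitioned context (classical part, quantum part) is well-formed: no variable is bound
twice. -/
def WFCtx (Γ Δ : Ctx) : Prop := ((Γ ++ Δ).map Prod.fst).Nodup

/-- The valuations of a context. -/
def Env : Ctx → Type
  | [] => Unit
  | b :: Γ => Val b.2 × Env Γ

instance Env.instDecidableEq : (Γ : Ctx) → DecidableEq (Env Γ)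
  | [] => inferInstanceAs (DecidableEq Unit)
  | b :: Γ =>
    haveI := Env.instDecidableEq Γ
    inferInstanceAs (DecidableEq (Val b.2 × Env Γ))

instance Env.instFintype : (Γ : Ctx) → Fintype (Env Γ)
  | [] => inferInstanceAs (Fintype Unit)
  | b :: Γ =>
    haveI := Env.instFintype Γ
    inferInstanceAs (Fintype (Val b.2 × Env Γ))

/-- The empty valuation. -/
def Env.empty : Env [] := ()

/-- Concatenation of valuations. -/
def Env.append : {Γ Δ : Ctx} → Env Γ → Env Δ → Env (Γ ++ Δ)
  | [], _, _, τ => τ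
  | _ :: _, _, (v, σ), τ => (v, Env.append σ τ)

/-- The part of a concatenated valuation that belongs to the first context. -/
def Env.fst : {Γ Δ : Ctx} → Env (Γ ++ Δ) → Env Γ
  | [], _, _ => ()
  | _ :: Γ, Δ, (v, σ) => (v, Env.fst (Γ := Γ) (Δ := Δ) σ)

/-- The part of a concatenated valuation that belongs to the second context. -/
def Env.snd : {Γ Δ : Ctx} → Env (Γ ++ Δ) → Env Δ
  | [], _, τ => τ
  | _ :: Γ, Δ, (_, σ) => Env.snd (Γ := Γ) (Δ := Δ) σ

/-- Permutations that turn one list into another, as data. -/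
inductive LPerm {α : Type} : List α → List α → Type
  | nil : LPerm [] []
  | cons (a : α) {l l' : List α} : LPerm l l' → LPerm (a :: l) (a :: l')
  | swap (a b : α) (l : List α) : LPerm (a :: b :: l) (b :: a :: l)
  | trans {l₁ l₂ l₃ : List α} : LPerm l₁ l₂ → LPerm l₂ l₃ → LPerm l₁ l₃

/-- If `π` permutes `Γ` to `Γ'`, then `π.pull` sends the permuted valuation `π(σ)` back to `σ`. -/
def LPerm.pull : {Γ Γ' : Ctx} → LPerm Γ Γ' → Env Γ' → Env Γ
  | _, _, .nil, σ => σ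
  | _, _, .cons _ p, (v, σ) => (v, p.pull σ)
  | _, _, .swap _ _ _, (w, v, σ) => (v, w, σ)
  | _, _, .trans p q, σ => p.pull (q.pull σ)

/-- Occurrences of one list as a (not necessarily contiguous) subsequence of another, as data. -/
inductive LSub {α : Type} : List α → List α → Type
  | nil : LSub [] []
  | drop (a : α) {l₁ l₂ : List α} : LSub l₁ l₂ → LSub l₁ (a :: l₂)
  | keep (a : α) {l₁ l₂ : List α} : LSub l₁ l₂ → LSub (a :: l₁) (a :: l₂)

/-! ### Expressions and programs

`R` is the chosen representation of real constants. -/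

mutual
/-- Expressions. `ctrl e T n p b T'` is coherent control on `e : T` with the `n` branches
`p j ↦ b j` of type `T'`. -/
inductive Expr (R : Type) : Type
  | unit : Expr R
  | var (x : Var) : Expr R
  | pair (e₀ e₁ : Expr R) : Expr R
  | ctrl (e : Expr R) (T : Ty) (n : ℕ) (p b : Fin n → Expr R) (T' : Ty) : Expr R
  | tryCatch (e₀ e₁ : Expr R) : Expr R
  | app (f : Prog R) (e : Expr R) : Expr R
/-- Programs. `lam e T e'` is the abstraction from the pattern `e` of type `T` to `e'`. -/
inductive Prog (R : Type) : Type
  | u3 (rθ rφ rl : R) : Prog R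
  | left (T₀ T₁ : Ty) : Prog R
  | right (T₀ T₁ : Ty) : Prog R
  | lam (e : Expr R) (T : Ty) (e' : Expr R) : Prog R
  | rphase (T : Ty) (e : Expr R) (r r' : R) : Prog R
end

/-- Free variables (programs are closed; patterns bind their variables in the branch bodies). -/
def Expr.FV {R : Type} : Expr R → Finset Var
  | .unit => ∅
  | .var x => {x}
  | .pair e₀ e₁ => e₀.FV ∪ e₁.FV
  | .ctrl e _ _ p b _ => e.FV ∪ Finset.univ.biUnion fun j => (b j).FV \ (p j).FV
  | .tryCatch e₀ e₁ => e₀.FV ∪ e₁.FV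
  | .app _ e => e.FV

/-! ### Typing derivations

All judgments are families of derivation trees, since the semantics and the compiler are functions
of the derivation. -/

/-- Derivations that a list of patterns spans a type. -/
inductive Spanning (R : Type) : Ty → List (Expr R) → Type
  | void : Spanning R .void []
  | unit : Spanning R .unit [.unit]
  | var (T : Ty) (x : Var) : Spanning R T [.var x]
  | sum {T T' : Ty} {es es' : List (Expr R)} (s : Spanning R T es) (s' : Spanning R T' es') :
      Spanning R (.sum T T')
        (es.map (.app (.left T T')) ++ es'.map (.app (.right T T')))
  | pair {T T' : Ty} {m : ℕ} (e : Fin m → Expr R) (es' : Fin m → List (Expr R))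
      (s : Spanning R T (List.ofFn e)) (s' : ∀ j, Spanning R T' (es' j))
      (h : ∀ j, ∀ e' ∈ es' j, Disjoint (e j).FV e'.FV) :
      Spanning R (.prod T T') (List.ofFn fun j => (es' j).map (.pair (e j))).flatten
  | perm {T : Ty} {es₁ es₂ : List (Expr R)} (s : Spanning R T es₁) (π : LPerm es₁ es₂) :
      Spanning R T es₂

/-- Derivations that a list of patterns is orthogonal: a subsequence of a spanning list. -/
inductive Ortho (R : Type) : Ty → List (Expr R) → Type
  | mk {T : Ty} {es es' : List (Expr R)} (s : Spanning R T es') (u : LSub es es') : Ortho R T es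

/-- Derivations that all expressions of a list of type `T` carry the variable `x` at one common
place, from which it can be erased. -/
inductive Erases (R : Type) : Var → Ty → List (Expr R) → Type
  | var (x : Var) (T : Ty) (n : ℕ) : Erases R x T (List.replicate n (.var x))
  | gphase {x : Var} {T : Ty} (l₁ : List (Expr R)) (e : Expr R) (l₂ : List (Expr R))
      (y : Var) (r : R) (d : Erases R x T (l₁ ++ e :: l₂)) :
      Erases R x T (l₁ ++ .app (.rphase T (.var y) r r) e :: l₂)
  | ctrl {x : Var} {T : Ty} (l₁ : List (Expr R)) (e : Expr R) (T' : Ty) (n : ℕ)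
      (p b : Fin n → Expr R) (l₂ : List (Expr R))
      -- the patterns of the inner control must not rebind `x`
      (h : ∀ k, x ∉ (p k).FV)
      (d : Erases R x T (l₁ ++ (List.ofFn b ++ l₂))) :
      Erases R x T (l₁ ++ .ctrl e T' n p b T :: l₂)
  | pair₀ {x : Var} {T₀ : Ty} (T₁ : Ty) (l : List (Expr R × Expr R))
      (d : Erases R x T₀ (l.map Prod.fst)) :
      Erases R x (.prod T₀ T₁) (l.map fun q => .pair q.1 q.2)
  | pair₁ {x : Var} (T₀ : Ty) {T₁ : Ty} (l : List (Expr R × Expr R))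
      (d : Erases R x T₁ (l.map Prod.snd)) :
      Erases R x (.prod T₀ T₁) (l.map fun q => .pair q.1 q.2)

/-! The four typing judgments: `PureE R Γ Δ e T` (pure expressions, with classical context `Γ` and
quantum context `Δ`), `MixedE R Δ e T` (mixed expressions), `PureP R f T U` (coherent maps) and
`MixedP R f T U` (quantum channels). -/

mutual
inductive PureE (R : Type) : Ctx → Ctx → Expr R → Ty → Type
  | unit (Γ : Ctx) (h : WFCtx Γ []) : PureE R Γ [] .unit .unit
  | cvar (Γ : Ctx) (x : Var) (T : Ty) (Γ' : Ctx) (h : WFCtx (Γ ++ (x, T) :: Γ') []) :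
      PureE R (Γ ++ (x, T) :: Γ') [] (.var x) T
  | qvar (Γ : Ctx) (x : Var) (T : Ty) (h : WFCtx Γ [(x, T)]) :
      PureE R Γ [(x, T)] (.var x) T
  | pair {Γ : Ctx} (Δ Δ₀ Δ₁ : Ctx) {e₀ e₁ : Expr R} {T₀ T₁ : Ty}
      (h : WFCtx Γ (Δ ++ Δ₀ ++ Δ₁))
      (d₀ : PureE R Γ (Δ ++ Δ₀) e₀ T₀) (d₁ : PureE R Γ (Δ ++ Δ₁) e₁ T₁) :
      PureE R Γ (Δ ++ Δ₀ ++ Δ₁) (.pair e₀ e₁) (.prod T₀ T₁)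
  | ctrl (Γ Γ' Δ Δ' : Ctx) {e : Expr R} {T T' : Ty} {n : ℕ} {p b : Fin n → Expr R}
      (Γs : Fin n → Ctx) (h : WFCtx (Γ ++ Γ') (Δ ++ Δ'))
      (de : MixedE R (Γ ++ Δ) e T)
      (o : Ortho R T (List.ofFn p))
      (dp : ∀ j, PureE R [] (Γs j) (p j) T)
      (er : ∀ i : Fin Δ.length, Erases R (Δ.get i).1 T' (List.ofFn b))
      (db : ∀ j, PureE R (Γ ++ Γ' ++ Γs j) (Δ ++ Δ') (b j) T') :
      PureE R (Γ ++ Γ') (Δ ++ Δ') (.ctrl e T n p b T') T'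
  | app {Γ Δ : Ctx} {f : Prog R} {e : Expr R} {T T' : Ty}
      (df : PureP R f T T') (de : PureE R Γ Δ e T) : PureE R Γ Δ (.app f e) T'
  | perm {Γ Γ' Δ Δ' : Ctx} {e : Expr R} {T : Ty} (πg : LPerm Γ Γ') (πd : LPerm Δ Δ')
      (d : PureE R Γ Δ e T) : PureE R Γ' Δ' e T
inductive MixedE (R : Type) : Ctx → Expr R → Ty → Type
  | mix {Δ : Ctx} {e : Expr R} {T : Ty} (d : PureE R [] Δ e T) : MixedE R Δ e T
  | perm {Δ Δ' : Ctx} {e : Expr R} {T : Ty} (π : LPerm Δ Δ') (d : MixedE R Δ e T) :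
      MixedE R Δ' e T
  | pair (Δ Δ₀ Δ₁ : Ctx) {e₀ e₁ : Expr R} {T₀ T₁ : Ty}
      (h : WFCtx [] (Δ ++ Δ₀ ++ Δ₁))
      (d₀ : MixedE R (Δ ++ Δ₀) e₀ T₀) (d₁ : MixedE R (Δ ++ Δ₁) e₁ T₁) :
      MixedE R (Δ ++ Δ₀ ++ Δ₁) (.pair e₀ e₁) (.prod T₀ T₁)
  | tryCatch (Δ₀ Δ₁ : Ctx) {e₀ e₁ : Expr R} {T : Ty} (h : WFCtx [] (Δ₀ ++ Δ₁))
      (d₀ : MixedE R Δ₀ e₀ T) (d₁ : MixedE R Δ₁ e₁ T) :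
      MixedE R (Δ₀ ++ Δ₁) (.tryCatch e₀ e₁) T
  | app {Δ : Ctx} {f : Prog R} {e : Expr R} {T T' : Ty}
      (df : MixedP R f T T') (de : MixedE R Δ e T) : MixedE R Δ (.app f e) T'
inductive PureP (R : Type) : Prog R → Ty → Ty → Type
  | gate (rθ rφ rl : R) : PureP R (.u3 rθ rφ rl) .bit .bit
  | left (T₀ T₁ : Ty) : PureP R (.left T₀ T₁) T₀ (.sum T₀ T₁)
  | right (T₀ T₁ : Ty) : PureP R (.right T₀ T₁) T₁ (.sum T₀ T₁)
  | abs {Δ : Ctx} {e e' : Expr R} {T T' : Ty} (d : PureE R [] Δ e T)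
      (d' : PureE R [] Δ e' T') : PureP R (.lam e T e') T T'
  | rphase {Δ : Ctx} {e : Expr R} {T : Ty} (r r' : R) (d : PureE R [] Δ e T) :
      PureP R (.rphase T e r r') T T
inductive MixedP (R : Type) : Prog R → Ty → Ty → Type
  | channel {f : Prog R} {T T' : Ty} (d : PureP R f T T') : MixedP R f T T'
  | abs (Δ Δ₀ : Ctx) {e e' : Expr R} {T T' : Ty} (d : PureE R [] (Δ ++ Δ₀) e T)
      (d' : MixedE R Δ e' T') : MixedP R (.lam e T e') T T'
end

/-! ### Denotational semantics -/

/-- The parameterized single-qubit gate, in the basis `false, true`. -/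
noncomputable def u3Mat (θ φ l : ℝ) : Matrix Bool Bool ℂ
  | false, false => (Real.cos (θ / 2) : ℂ)
  | true, false => Complex.exp (Complex.I * φ) * (Real.sin (θ / 2) : ℂ)
  | false, true => -(Complex.exp (Complex.I * l) * (Real.sin (θ / 2) : ℂ))
  | true, true => Complex.exp (Complex.I * (φ + l)) * (Real.cos (θ / 2) : ℂ)

/-- The value `0` (left) of the bit type is `false`, the value `1` (right) is `true`. -/
def Val.toBool : Val .bit → Bool
  | .inl _ => false
  | .inr _ => true

/-- The linear map with prescribed values `φ a a'` on the basis operators `|a⟩⟨a'|`. -/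
noncomputable def superop {α β : Type} [Fintype α] (φ : α → α → Matrix β β ℂ) :
    Matrix α α ℂ →ₗ[ℂ] Matrix β β ℂ where
  toFun ρ := ∑ a, ∑ a', ρ a a' • φ a a'
  map_add' ρ ρ' := by simp [add_smul, Finset.sum_add_distrib]
  map_smul' c ρ := by simp [mul_smul, Finset.smul_sum]

/-- The basis operator `|a⟩⟨b|`. -/
abbrev ketbra {α : Type} [DecidableEq α] (a b : α) : Matrix α α ℂ := Matrix.single a b 1

/-- Partial trace over the second context. -/
noncomputable def ptrace {Δ Δ₀ : Ctx} (M : Matrix (Env (Δ ++ Δ₀)) (Env (Δ ++ Δ₀)) ℂ) :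
    Matrix (Env Δ) (Env Δ) ℂ :=
  fun τ τ' => ∑ τ₀ : Env Δ₀, M (τ.append τ₀) (τ'.append τ₀)

mutual
/-- Semantics of pure expressions: an operator for each valuation of the classical context. -/
noncomputable def PureE.sem {R : Type} (val : R → ℝ) : {Γ Δ : Ctx} → {e : Expr R} → {T : Ty} →
    PureE R Γ Δ e T → Env Γ → Matrix (Val T) (Env Δ) ℂ
  | _, _, _, _, .unit _ _, _ => fun _ _ => 1
  | _, _, _, _, .cvar Γ x T Γ' _, σ =>
      fun v _ => if v = (Env.snd (Γ := Γ) (Δ := (x, T) :: Γ') σ).1 then 1 else 0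
  | _, _, _, _, .qvar _ _ _ _, _ => fun v τ => if v = τ.1 then 1 else 0
  | _, _, _, _, .pair Δ Δ₀ Δ₁ _ d₀ d₁, σ => fun v t =>
      let τ : Env Δ := (Env.fst (Γ := Δ ++ Δ₀) (Δ := Δ₁) t).fst
      let τ₀ : Env Δ₀ := (Env.fst (Γ := Δ ++ Δ₀) (Δ := Δ₁) t).snd
      let τ₁ : Env Δ₁ := Env.snd (Γ := Δ ++ Δ₀) (Δ := Δ₁) t
      d₀.sem val σ v.1 (τ.append τ₀) * d₁.sem val σ v.2 (τ.append τ₁)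
  | _, _, _, _, .ctrl (T := T) (n := n) Γ Γ' Δ Δ' Γs _ de _ dp _ db, s => fun v' t =>
      let σ : Env Γ := s.fst
      let τ : Env Δ := t.fst
      ∑ v : Val T, de.sem val (ketbra (σ.append τ) (σ.append τ)) v v *
        ∑ j : Fin n, ∑ σj : Env (Γs j),
          ((dp j).sem val Env.empty).conjTranspose σj v * (db j).sem val (s.append σj) v' t
  | _, _, _, _, .app df de, σ => df.sem val * de.sem val σ
  | _, _, _, _, .perm πg πd d, σ => fun v τ => d.sem val (πg.pull σ) v (πd.pull τ)
/-- Semantics of mixed expressions: a superoperator. In the case of error recovery this is the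
bilinear extension of `E₀ ρ₀ + (1 - tr (E₀ ρ₀)) E₁ ρ₁` from states `ρ₀ ⊗ ρ₁` of trace one, that is,
`tr ρ₁ • E₀ ρ₀ + (tr ρ₀ - tr (E₀ ρ₀)) • E₁ ρ₁`. -/
noncomputable def MixedE.sem {R : Type} (val : R → ℝ) : {Δ : Ctx} → {e : Expr R} → {T : Ty} →
    MixedE R Δ e T → (Matrix (Env Δ) (Env Δ) ℂ →ₗ[ℂ] Matrix (Val T) (Val T) ℂ)
  | _, _, _, .mix d => superop fun τ τ' =>
      d.sem val Env.empty * ketbra τ τ' * (d.sem val Env.empty).conjTranspose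
  | _, _, _, .perm π d => superop fun τ τ' => d.sem val (ketbra (π.pull τ) (π.pull τ'))
  | _, _, _, .pair Δ Δ₀ Δ₁ _ d₀ d₁ => superop fun t t' =>
      let τ : Env Δ := (Env.fst (Γ := Δ ++ Δ₀) (Δ := Δ₁) t).fst
      let τ₀ : Env Δ₀ := (Env.fst (Γ := Δ ++ Δ₀) (Δ := Δ₁) t).snd
      let τ₁ : Env Δ₁ := Env.snd (Γ := Δ ++ Δ₀) (Δ := Δ₁) t
      let τ' : Env Δ := (Env.fst (Γ := Δ ++ Δ₀) (Δ := Δ₁) t').fst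
      let τ₀' : Env Δ₀ := (Env.fst (Γ := Δ ++ Δ₀) (Δ := Δ₁) t').snd
      let τ₁' : Env Δ₁ := Env.snd (Γ := Δ ++ Δ₀) (Δ := Δ₁) t'
      fun v v' => d₀.sem val (ketbra (τ.append τ₀) (τ'.append τ₀')) v.1 v'.1 *
        d₁.sem val (ketbra (τ.append τ₁) (τ'.append τ₁')) v.2 v'.2
  | _, _, _, .tryCatch Δ₀ Δ₁ _ d₀ d₁ => superop fun t t' =>
      let ρ₀ : Matrix (Env Δ₀) (Env Δ₀) ℂ := ketbra t.fst t'.fst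
      let ρ₁ : Matrix (Env Δ₁) (Env Δ₁) ℂ := ketbra t.snd t'.snd
      ρ₁.trace • d₀.sem val ρ₀ + (ρ₀.trace - (d₀.sem val ρ₀).trace) • d₁.sem val ρ₁
  | _, _, _, .app df de => (df.sem val).comp (de.sem val)
/-- Semantics of pure programs: an operator. -/
noncomputable def PureP.sem {R : Type} (val : R → ℝ) : {f : Prog R} → {T T' : Ty} →
    PureP R f T T' → Matrix (Val T') (Val T) ℂ
  | _, _, _, .gate rθ rφ rl => fun v' v =>
      u3Mat (val rθ) (val rφ) (val rl) (Val.toBool v') (Val.toBool v)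
  | _, _, _, .left T₀ T₁ => fun v' v => if v' = Val.mkLeft T₀ T₁ v then 1 else 0
  | _, _, _, .right T₀ T₁ => fun v' v => if v' = Val.mkRight T₀ T₁ v then 1 else 0
  | _, _, _, .abs d d' => d'.sem val Env.empty * (d.sem val Env.empty).conjTranspose
  | _, _, _, .rphase r r' d =>
      let P := d.sem val Env.empty * (d.sem val Env.empty).conjTranspose
      Complex.exp (Complex.I * val r) • P + Complex.exp (Complex.I * val r') • (1 - P)
/-- Semantics of mixed programs: a superoperator. -/
noncomputable def MixedP.sem {R : Type} (val : R → ℝ) : {f : Prog R} → {T T' : Ty} →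
    MixedP R f T T' → (Matrix (Val T) (Val T) ℂ →ₗ[ℂ] Matrix (Val T') (Val T') ℂ)
  | _, _, _, .channel d => superop fun v v' =>
      d.sem val * ketbra v v' * (d.sem val).conjTranspose
  | _, _, _, .abs Δ Δ₀ d d' => superop fun v v' =>
      d'.sem val (ptrace (Δ := Δ) (Δ₀ := Δ₀)
        ((d.sem val Env.empty).conjTranspose * ketbra v v' * d.sem val Env.empty))
end

/-! ### Low-level qubit circuits -/

/-- Symbolic gate parameters: real constants of the source language, `0`, `π`, negation. -/
inductive Angle (R : Type) : Type
  | const (r : R) : Angle R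
  | zero : Angle R
  | pi : Angle R
  | neg (a : Angle R) : Angle R

/-- The real number denoted by a gate parameter. -/
noncomputable def Angle.eval {R : Type} (val : R → ℝ) : Angle R → ℝ
  | .const r => val r
  | .zero => 0
  | .pi => Real.pi
  | .neg a => -a.eval val

/-- The single-qubit gate `exp(i α) u₃(θ, φ, l)` on wire `target`, controlled on all the wires in
`controls` (a plain single-qubit gate if this list is empty). -/
structure Gate (R : Type) : Type where
  controls : List ℕ
  target : ℕ
  α : Angle R
  θ : Angle R
  φ : Angle R
  l : Angle R

/-- The gate fits on `n` wires, and its target is not one of its controls. -/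
def Gate.Fits {R : Type} (g : Gate R) (n : ℕ) : Prop :=
  g.target < n ∧ (∀ i ∈ g.controls, i < n) ∧ g.target ∉ g.controls

/-- The single-qubit unitary of a gate. -/
noncomputable def Gate.local {R : Type} (val : R → ℝ) (g : Gate R) : Matrix Bool Bool ℂ :=
  Complex.exp (Complex.I * g.α.eval val) •
    u3Mat (g.θ.eval val) (g.φ.eval val) (g.l.eval val)

/-- The bit of a bit string of length `n` on wire `i`. -/
def bitAt {n : ℕ} (b : Fin n → Bool) (i : ℕ) : Bool := if h : i < n then b ⟨i, h⟩ else false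

/-- The operator of a gate on `n` qubits, in the basis of bit strings. -/
noncomputable def Gate.mat {R : Type} (val : R → ℝ) (n : ℕ) (g : Gate R) :
    Matrix (Fin n → Bool) (Fin n → Bool) ℂ := fun b' b =>
  if ∀ i ∈ g.controls, bitAt b i = true then
    if ∀ i : Fin n, i.val ≠ g.target → b' i = b i then
      g.local val (bitAt b' g.target) (bitAt b g.target)
    else 0
  else if b' = b then 1 else 0

/-- The operator of a sequence of gates, the head of the list being applied first. -/
noncomputable def circuitMat {R : Type} (val : R → ℝ) (n : ℕ) :
    List (Gate R) → Matrix (Fin n → Bool) (Fin n → Bool) ℂ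
  | [] => 1
  | g :: gs => circuitMat val n gs * g.mat val n

/-- A low-level circuit with its numbers of prep, flag and garbage qubits. -/
structure LowCircuit (R : Type) : Type where
  nprep : ℕ
  nflag : ℕ
  ngarb : ℕ
  gates : List (Gate R)

/-! ### Encoding of values into qubits -/

/-- Number of qubits used for a type. -/
def Ty.size : Ty → ℕ
  | .void => 0
  | .unit => 0
  | .sum a b => 1 + max a.size b.size
  | .prod a b => a.size + b.size

/-- The encoding of a value as a bit string of length `T.size` (after the tag of a sum, shorter
encodings are padded by zeros at the end). -/
def Val.enc : {T : Ty} → Val T → List Bool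
  | .unit, _ => []
  | .sum a b, .inl v => false :: (v.enc ++ List.replicate (max a.size b.size - a.size) false)
  | .sum a b, .inr v => true :: (v.enc ++ List.replicate (max a.size b.size - b.size) false)
  | .prod _ _, (v, w) => v.enc ++ w.enc

/-- Number of qubits used for a context. -/
def Ctx.size : Ctx → ℕ
  | [] => 0
  | b :: Γ => b.2.size + Ctx.size Γ

/-- The encoding of a valuation. -/
def Env.enc : {Γ : Ctx} → Env Γ → List Bool
  | [], _ => []
  | _ :: _, (v, σ) => v.enc ++ σ.enc

/-- A list of length `n` as a bit string on `n` wires. -/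
def toBits (n : ℕ) (l : List Bool) : Fin n → Bool := fun i => l.getD i.val false

/-- A string of `n` zeros. -/
abbrev zeros (n : ℕ) : List Bool := List.replicate n false

/-! ### Implementation of operators and superoperators by circuits -/

/-- The circuit implements the operator `E` with prep and flag qubits; the basis elements of the
input (output) space are encoded by `encIn` (`encOut`) as bit strings of length `a` (`b`). -/
def LowCircuit.ImplementsKraus {R : Type} (val : R → ℝ) (c : LowCircuit R) {ι κ : Type}
    (a b : ℕ) (encIn : ι → List Bool) (encOut : κ → List Bool) (E : Matrix κ ι ℂ) : Prop :=
  c.ngarb = 0 ∧ a + c.nprep = b + c.nflag ∧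
  (∀ g ∈ c.gates, g.Fits (a + c.nprep)) ∧
  circuitMat val (a + c.nprep) c.gates ∈ Matrix.unitaryGroup (Fin (a + c.nprep) → Bool) ℂ ∧
  ∀ (v : ι) (w : κ),
    circuitMat val (a + c.nprep) c.gates
      (toBits (a + c.nprep) (encOut w ++ zeros c.nflag))
      (toBits (a + c.nprep) (encIn v ++ zeros c.nprep)) = E w v

/-- The circuit implements the superoperator `E` with prep, flag and garbage qubits. -/
def LowCircuit.ImplementsSuperop {R : Type} (val : R → ℝ) (c : LowCircuit R) {ι κ : Type}
    [Fintype ι] (a b : ℕ) (encIn : ι → List Bool) (encOut : κ → List Bool)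
    (E : Matrix ι ι ℂ →ₗ[ℂ] Matrix κ κ ℂ) : Prop :=
  a + c.nprep = b + c.nflag + c.ngarb ∧
  (∀ g ∈ c.gates, g.Fits (a + c.nprep)) ∧
  circuitMat val (a + c.nprep) c.gates ∈ Matrix.unitaryGroup (Fin (a + c.nprep) → Bool) ℂ ∧
  ∀ (ρ : Matrix ι ι ℂ) (v₁ v₂ : κ),
    let U := circuitMat val (a + c.nprep) c.gates
    let ρ₀ : Matrix (Fin (a + c.nprep) → Bool) (Fin (a + c.nprep) → Bool) ℂ :=
      ∑ v, ∑ w, Matrix.single (toBits (a + c.nprep) (encIn v ++ zeros c.nprep))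
        (toBits (a + c.nprep) (encIn w ++ zeros c.nprep)) (ρ v w)
    E ρ v₁ v₂ = ∑ g : Fin c.ngarb → Bool, (U * ρ₀ * U.conjTranspose)
      (toBits (a + c.nprep) (encOut v₁ ++ zeros c.nflag ++ List.ofFn g))
      (toBits (a + c.nprep) (encOut v₂ ++ zeros c.nflag ++ List.ofFn g))

/-! ### Derivations as compiler input -/

/-- A derivation of any of the four typing judgments. -/
inductive Deriv (R : Type) : Type
  | pureE {Γ Δ : Ctx} {e : Expr R} {T : Ty} (d : PureE R Γ Δ e T) : Deriv R
  | mixedE {Δ : Ctx} {e : Expr R} {T : Ty} (d : MixedE R Δ e T) : Deriv R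
  | pureP {f : Prog R} {T T' : Ty} (d : PureP R f T T') : Deriv R
  | mixedP {f : Prog R} {T T' : Ty} (d : MixedP R f T T') : Deriv R

/-- The operator that the circuit of a pure expression has to implement: the classical register is
kept unchanged and parameterizes the operator applied to the quantum register. -/
noncomputable def PureE.op {R : Type} (val : R → ℝ) {Γ Δ : Ctx} {e : Expr R} {T : Ty}
    (d : PureE R Γ Δ e T) : Matrix (Env Γ × Val T) (Env Γ × Env Δ) ℂ :=
  fun q p => if q.1 = p.1 then d.sem val p.1 q.2 p.2 else 0

/-- The circuit implements the semantics of the judgment derived by `d`. -/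
def LowCircuit.Implements {R : Type} (val : R → ℝ) (c : LowCircuit R) : Deriv R → Prop
  | .pureE (Γ := Γ) (Δ := Δ) (T := T) d =>
      c.ImplementsKraus val (Γ.size + Δ.size) (Γ.size + T.size)
        (fun p => p.1.enc ++ p.2.enc) (fun q => q.1.enc ++ q.2.enc) (d.op val)
  | .mixedE (Δ := Δ) (T := T) d =>
      c.ImplementsSuperop val Δ.size T.size Env.enc Val.enc (d.sem val)
  | .pureP (T := T) (T' := T') d =>
      c.ImplementsKraus val T.size T'.size Val.enc Val.enc (d.sem val)
  | .mixedP (T := T) (T' := T') d =>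
      c.ImplementsSuperop val T.size T'.size Val.enc Val.enc (d.sem val)

/-! ### Gödel numbers of derivations and of circuits

A tree node is numbered by its label and the list of the numbers of its children. -/

/-- The number of a tree node. -/
def node (tag : ℕ) (l : List ℕ) : ℕ := Encodable.encode (tag :: l)

def Ty.code : Ty → ℕ
  | .void => node 0 []
  | .unit => node 1 []
  | .sum a b => node 2 [a.code, b.code]
  | .prod a b => node 3 [a.code, b.code]

def Ctx.code (Γ : Ctx) : ℕ := node 0 (Γ.map fun q => node 0 [q.1, q.2.code])

def LPerm.code {α : Type} : {l l' : List α} → LPerm l l' → ℕ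
  | _, _, .nil => node 0 []
  | _, _, .cons _ p => node 1 [p.code]
  | _, _, .swap _ _ _ => node 2 []
  | _, _, .trans p q => node 3 [p.code, q.code]

def LSub.code {α : Type} : {l l' : List α} → LSub l l' → ℕ
  | _, _, .nil => node 0 []
  | _, _, .drop _ s => node 1 [s.code]
  | _, _, .keep _ s => node 2 [s.code]

mutual
def Expr.code {R : Type} [Encodable R] : Expr R → ℕ
  | .unit => node 0 []
  | .var x => node 1 [x]
  | .pair e₀ e₁ => node 2 [e₀.code, e₁.code]
  | .ctrl e T _ p b T' => node 3 [e.code, T.code, node 0 (List.ofFn fun j => (p j).code),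
      node 0 (List.ofFn fun j => (b j).code), T'.code]
  | .tryCatch e₀ e₁ => node 4 [e₀.code, e₁.code]
  | .app f e => node 5 [f.code, e.code]
def Prog.code {R : Type} [Encodable R] : Prog R → ℕ
  | .u3 rθ rφ rl => node 0 [Encodable.encode rθ, Encodable.encode rφ, Encodable.encode rl]
  | .left T₀ T₁ => node 1 [T₀.code, T₁.code]
  | .right T₀ T₁ => node 2 [T₀.code, T₁.code]
  | .lam e T e' => node 3 [e.code, T.code, e'.code]
  | .rphase T e r r' => node 4 [T.code, e.code, Encodable.encode r, Encodable.encode r']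
end

/-- The number of a list of expressions. -/
def codeExprs {R : Type} [Encodable R] (es : List (Expr R)) : ℕ := node 0 (es.map Expr.code)

def Spanning.code {R : Type} [Encodable R] : {T : Ty} → {es : List (Expr R)} →
    Spanning R T es → ℕ
  | _, _, .void => node 0 []
  | _, _, .unit => node 1 []
  | _, _, .var T x => node 2 [T.code, x]
  | _, _, .sum (T := T) (T' := T') (es := es) (es' := es') s s' =>
      node 3 [T.code, T'.code, codeExprs es, codeExprs es', s.code, s'.code]
  | _, _, .pair (T := T) (T' := T') e es' s s' _ =>
      node 4 [T.code, T'.code, codeExprs (List.ofFn e),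
        node 0 (List.ofFn fun j => codeExprs (es' j)), s.code,
        node 0 (List.ofFn fun j => (s' j).code)]
  | _, _, .perm (T := T) (es₁ := es₁) (es₂ := es₂) s π =>
      node 5 [T.code, codeExprs es₁, codeExprs es₂, s.code, π.code]

def Ortho.code {R : Type} [Encodable R] {T : Ty} {es : List (Expr R)} : Ortho R T es → ℕ
  | .mk (es' := es') s u => node 0 [T.code, codeExprs es, codeExprs es', s.code, u.code]

def Erases.code {R : Type} [Encodable R] : {x : Var} → {T : Ty} → {es : List (Expr R)} →
    Erases R x T es → ℕ
  | _, _, _, .var x T n => node 0 [x, T.code, n]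
  | x, T, _, .gphase l₁ e l₂ y r d =>
      node 1 [x, T.code, codeExprs l₁, e.code, codeExprs l₂, y, Encodable.encode r, d.code]
  | x, T, _, .ctrl l₁ e T' _ p b l₂ _ d =>
      node 2 [x, T.code, codeExprs l₁, e.code, T'.code, codeExprs (List.ofFn p),
        codeExprs (List.ofFn b), codeExprs l₂, d.code]
  | x, _, _, .pair₀ (T₀ := T₀) T₁ l d =>
      node 3 [x, T₀.code, T₁.code, codeExprs (l.map Prod.fst), codeExprs (l.map Prod.snd), d.code]
  | x, _, _, .pair₁ (T₁ := T₁) T₀ l d =>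
      node 4 [x, T₀.code, T₁.code, codeExprs (l.map Prod.fst), codeExprs (l.map Prod.snd), d.code]

mutual
def PureE.code {R : Type} [Encodable R] : {Γ Δ : Ctx} → {e : Expr R} → {T : Ty} →
    PureE R Γ Δ e T → ℕ
  | _, _, _, _, .unit Γ _ => node 0 [Γ.code]
  | _, _, _, _, .cvar Γ x T Γ' _ => node 1 [Γ.code, x, T.code, Γ'.code]
  | _, _, _, _, .qvar Γ x T _ => node 2 [Γ.code, x, T.code]
  | Γ, _, _, _, .pair (e₀ := e₀) (e₁ := e₁) (T₀ := T₀) (T₁ := T₁) Δ Δ₀ Δ₁ _ d₀ d₁ =>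
      node 3 [Γ.code, Δ.code, Δ₀.code, Δ₁.code, e₀.code, e₁.code, T₀.code, T₁.code,
        d₀.code, d₁.code]
  | _, _, _, _, .ctrl (e := e) (T := T) (T' := T') (p := p) (b := b) Γ Γ' Δ Δ' Γs _ de o dp er db =>
      node 4 [Γ.code, Γ'.code, Δ.code, Δ'.code, e.code, T.code, T'.code,
        codeExprs (List.ofFn p), codeExprs (List.ofFn b),
        node 0 (List.ofFn fun j => (Γs j).code), de.code, o.code,
        node 0 (List.ofFn fun j => (dp j).code), node 0 (List.ofFn fun i => (er i).code),
        node 0 (List.ofFn fun j => (db j).code)]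
  | Γ, Δ, _, _, .app (f := f) (e := e) (T := T) (T' := T') df de =>
      node 5 [Γ.code, Δ.code, f.code, e.code, T.code, T'.code, df.code, de.code]
  | Γ', Δ', _, _, .perm (Γ := Γ) (Δ := Δ) (e := e) (T := T) πg πd d =>
      node 6 [Γ.code, Γ'.code, Δ.code, Δ'.code, e.code, T.code, πg.code, πd.code, d.code]
def MixedE.code {R : Type} [Encodable R] : {Δ : Ctx} → {e : Expr R} → {T : Ty} →
    MixedE R Δ e T → ℕ
  | Δ, e, T, .mix d => node 0 [Δ.code, e.code, T.code, d.code]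
  | Δ', e, T, .perm (Δ := Δ) π d => node 1 [Δ.code, Δ'.code, e.code, T.code, π.code, d.code]
  | _, _, _, .pair (e₀ := e₀) (e₁ := e₁) (T₀ := T₀) (T₁ := T₁) Δ Δ₀ Δ₁ _ d₀ d₁ =>
      node 2 [Δ.code, Δ₀.code, Δ₁.code, e₀.code, e₁.code, T₀.code, T₁.code, d₀.code, d₁.code]
  | _, _, T, .tryCatch (e₀ := e₀) (e₁ := e₁) Δ₀ Δ₁ _ d₀ d₁ =>
      node 3 [Δ₀.code, Δ₁.code, e₀.code, e₁.code, T.code, d₀.code, d₁.code]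
  | Δ, _, _, .app (f := f) (e := e) (T := T) (T' := T') df de =>
      node 4 [Δ.code, f.code, e.code, T.code, T'.code, df.code, de.code]
def PureP.code {R : Type} [Encodable R] : {f : Prog R} → {T T' : Ty} → PureP R f T T' → ℕ
  | _, _, _, .gate rθ rφ rl =>
      node 0 [Encodable.encode rθ, Encodable.encode rφ, Encodable.encode rl]
  | _, _, _, .left T₀ T₁ => node 1 [T₀.code, T₁.code]
  | _, _, _, .right T₀ T₁ => node 2 [T₀.code, T₁.code]
  | _, _, _, .abs (Δ := Δ) (e := e) (e' := e') (T := T) (T' := T') d d' =>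
      node 3 [Δ.code, e.code, e'.code, T.code, T'.code, d.code, d'.code]
  | _, _, _, .rphase (Δ := Δ) (e := e) (T := T) r r' d =>
      node 4 [Δ.code, e.code, T.code, Encodable.encode r, Encodable.encode r', d.code]
def MixedP.code {R : Type} [Encodable R] : {f : Prog R} → {T T' : Ty} → MixedP R f T T' → ℕ
  | f, T, T', .channel d => node 0 [f.code, T.code, T'.code, d.code]
  | _, _, _, .abs (e := e) (e' := e') (T := T) (T' := T') Δ Δ₀ d d' =>
      node 1 [Δ.code, Δ₀.code, e.code, e'.code, T.code, T'.code, d.code, d'.code]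
end

/-- The Gödel number of a typing derivation. -/
def Deriv.code {R : Type} [Encodable R] : Deriv R → ℕ
  | .pureE d => node 0 [d.code]
  | .mixedE d => node 1 [d.code]
  | .pureP d => node 2 [d.code]
  | .mixedP d => node 3 [d.code]

def Angle.code {R : Type} [Encodable R] : Angle R → ℕ
  | .const r => node 0 [Encodable.encode r]
  | .zero => node 1 []
  | .pi => node 2 []
  | .neg a => node 3 [a.code]

def Gate.code {R : Type} [Encodable R] (g : Gate R) : ℕ :=
  node 0 [node 0 g.controls, g.target, g.α.code, g.θ.code, g.φ.code, g.l.code]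

/-- The Gödel number of a low-level circuit. -/
def LowCircuit.code {R : Type} [Encodable R] (c : LowCircuit R) : ℕ :=
  node 0 [c.nprep, c.nflag, c.ngarb, node 0 (c.gates.map Gate.code)]

/-- A map from typing derivations to circuits is a recursive procedure: on Gödel numbers it is
given by a recursive (computable) function. -/
def IsRecursiveProcedure {R : Type} [Encodable R] (compile : Deriv R → LowCircuit R) : Prop :=
  ∃ f : ℕ → ℕ, Computable f ∧ ∀ d, f d.code = (compile d).code

/-!
A derivation is compiled in two steps. The first assigns to it a *two-level program* (`TL`): a list
of single-qubit gates, each of which acts on the plane spanned by two basis states of an infinite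
set of basis states labelled by natural numbers. Some labels stand for inputs and outputs (`inL`,
`outL`); an output label contains a garbage label as well. All labels can be handled by pairing
functions, so that running a program in superposition over a tag (`TL.fam`), handing the result of
one program to another (`TL.join`) and renaming inputs and outputs (`TL.wrap`) amount to relabelling.
The entries of the resulting operators are computed in `TL.amp_fam`, `TL.amp_join` and `TL.amp_wrap`.
As a program is a product of unitaries, reversing it yields the adjoint (`TL.amp_inv`).

The programs of the typing rules are in the namespace `Rule`. For an operator the amplitudes from
inputs to outputs are its entries (`TL.Acts`); for a superoperator they are the entries of a
Stinespring dilation with the garbage labels as environment (`TL.Dilates`). Three rules are not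
plain compositions.

* Coherent control runs the controlling program, then the branch that is selected by its value, and
  then the inverse of the controlling program, from which the weight `⟨v| ρ |v⟩` of the value `v`
  arises (`Rule.amp_ctrl`). The selection of the branch is injective, since patterns in an orthogonal
  list denote injections with disjoint ranges (`Ortho.patterns`, `PureE.pattern`). The erasure
  judgment says that the value of each variable of the shared quantum context stands at a known place
  of every value on which the result of a branch has nonzero amplitude (`Erases.carries`,
  `readBits_eq`), and so the last relabelling can remove this part of the context.
* In error recovery the labels, other than outputs, that the first program can reach serve as flags
  of failure. As columns of a unitary have norm one, the amplitudes on them account for the missing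
  part of the trace (`Rule.amp_tryCatch`, `Rule.sum_leftover`).
* A relative phase is a phase on the input labels of the pattern, conjugated by the inverse of its
  program (`Rule.amp_rphase`).

By induction over the four judgments every compiled program has the right amplitudes
(`PureE.correct`, `MixedE.correct`, `PureP.correct`, `MixedP.correct`).

The second step turns a two-level program into gates. A label `x` becomes a bit string that is `1`
on a marking wire and on one wire of its own (`Synth.hot`), which keeps it apart from the encodings
of inputs and outputs, and a two-level gate on bit strings becomes a gate controlled on all other
wires, conjugated by controlled `X` gates that move the two strings next to each other
(`Synth.runGates_twoLevel`). The number of wires and gates plays no role.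

The compiler is defined on Gödel numbers from the start, by recursion over trees (`foldNode`) and
operations on lists, and hence is primitive recursive (`primrec_compileDeriv`). It depends on the
constants only through their codes and not on their values.
-/

/-! ### Primitive recursive functions as a `fun_prop` class -/

section
variable {α β γ σ : Type} [Primcodable α] [Primcodable β] [Primcodable γ] [Primcodable σ]

attribute [fun_prop] Primrec
attribute [fun_prop] Primrec.const Primrec.comp

namespace Primrec

@[fun_prop] theorem fp_id : Primrec fun a : α => a := Primrec.id

@[fun_prop] theorem fp_fst {f : α → β × γ} (hf : Primrec f) : Primrec fun a => (f a).1 :=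
  Primrec.fst.comp hf

@[fun_prop] theorem fp_snd {f : α → β × γ} (hf : Primrec f) : Primrec fun a => (f a).2 :=
  Primrec.snd.comp hf

@[fun_prop] theorem fp_mk {f : α → β} {g : α → γ} (hf : Primrec f) (hg : Primrec g) :
    Primrec fun a => (f a, g a) := hf.pair hg

@[fun_prop] theorem fp_append {f g : α → List β} (hf : Primrec f) (hg : Primrec g) :
    Primrec fun a => f a ++ g a := Primrec.list_append.comp hf hg

@[fun_prop] theorem fp_cons {f : α → β} {g : α → List β} (hf : Primrec f) (hg : Primrec g) :
    Primrec fun a => f a :: g a := Primrec.list_cons.comp hf hg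

@[fun_prop] theorem fp_flatMap {f : α → List β} {g : α → β → List γ} (hf : Primrec f)
    (hg : Primrec fun p : α × β => g p.1 p.2) : Primrec fun a => (f a).flatMap (g a) :=
  Primrec.list_flatMap hf hg

@[fun_prop] theorem fp_map {f : α → List β} {g : α → β → γ} (hf : Primrec f)
    (hg : Primrec fun p : α × β => g p.1 p.2) : Primrec fun a => (f a).map (g a) :=
  Primrec.list_map hf hg

@[fun_prop] theorem fp_foldr {f : α → List β} {g : α → γ} {h : α → β → γ → γ} (hf : Primrec f)
    (hg : Primrec g) (hh : Primrec fun p : α × (β × γ) => h p.1 p.2.1 p.2.2) :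
    Primrec fun a => (f a).foldr (h a) (g a) :=
  Primrec.list_foldr (h := fun a p => h a p.1 p.2) hf hg hh

@[fun_prop] theorem fp_flatten {f : α → List (List β)} (hf : Primrec f) :
    Primrec fun a => (f a).flatten := Primrec.list_flatten.comp hf

@[fun_prop] theorem fp_reverse {f : α → List β} (hf : Primrec f) :
    Primrec fun a => (f a).reverse := Primrec.list_reverse.comp hf

@[fun_prop] theorem fp_tail {f : α → List β} (hf : Primrec f) :
    Primrec fun a => (f a).tail := Primrec.list_tail.comp hf

@[fun_prop] theorem fp_length {f : α → List β} (hf : Primrec f) :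
    Primrec fun a => (f a).length := Primrec.list_length.comp hf

@[fun_prop] theorem fp_range {f : α → ℕ} (hf : Primrec f) :
    Primrec fun a => List.range (f a) := Primrec.list_range.comp hf

@[fun_prop] theorem fp_getD {f : α → List β} {g : α → ℕ} {h : α → β} (hf : Primrec f)
    (hg : Primrec g) (hh : Primrec h) : Primrec fun a => (f a).getD (g a) (h a) := by
  simp only [List.getD_eq_getElem?_getD]
  exact Primrec.option_getD.comp (Primrec.list_getElem?.comp hf hg) hh

@[fun_prop] theorem fp_take {f : α → ℕ} {g : α → List β} (hf : Primrec f) (hg : Primrec g) :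
    Primrec fun a => (g a).take (f a) := Primrec.list_take.comp hf hg

@[fun_prop] theorem fp_drop {f : α → ℕ} {g : α → List β} (hf : Primrec f) (hg : Primrec g) :
    Primrec fun a => (g a).drop (f a) := Primrec.list_drop.comp hf hg

@[fun_prop] theorem fp_replicate {f : α → ℕ} {g : α → β} (hf : Primrec f) (hg : Primrec g) :
    Primrec fun a => List.replicate (f a) (g a) := by
  have : (fun a => List.replicate (f a) (g a)) = fun a => (List.range (f a)).map fun _ => g a := by
    funext a; simp
  rw [this]; fun_prop

@[fun_prop] theorem fp_product {f : α → List β} {g : α → List γ} (hf : Primrec f)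
    (hg : Primrec g) : Primrec fun a => f a ×ˢ g a := by
  change Primrec fun a => (f a).flatMap fun b => (g a).map (Prod.mk b)
  fun_prop

@[fun_prop] theorem fp_add {f g : α → ℕ} (hf : Primrec f) (hg : Primrec g) :
    Primrec fun a => f a + g a := Primrec.nat_add.comp hf hg

@[fun_prop] theorem fp_sub {f g : α → ℕ} (hf : Primrec f) (hg : Primrec g) :
    Primrec fun a => f a - g a := Primrec.nat_sub.comp hf hg

@[fun_prop] theorem fp_max {f g : α → ℕ} (hf : Primrec f) (hg : Primrec g) :
    Primrec fun a => max (f a) (g a) := Primrec.nat_max.comp hf hg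

@[fun_prop] theorem fp_encode {f : α → β} (hf : Primrec f) :
    Primrec fun a => Encodable.encode (f a) := Primrec.encode.comp hf

@[fun_prop] theorem fp_natPair {f g : α → ℕ} (hf : Primrec f) (hg : Primrec g) :
    Primrec fun a => Nat.pair (f a) (g a) := Primrec₂.natPair.comp hf hg

@[fun_prop] theorem fp_ite_eq [DecidableEq β] {f g : α → β} {h k : α → γ} (hf : Primrec f)
    (hg : Primrec g) (hh : Primrec h) (hk : Primrec k) :
    Primrec fun a => if f a = g a then h a else k a :=
  Primrec.ite (Primrec.eq.comp hf hg) hh hk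

@[fun_prop] theorem fp_ite_lt {f g : α → ℕ} {h k : α → γ} (hf : Primrec f)
    (hg : Primrec g) (hh : Primrec h) (hk : Primrec k) :
    Primrec fun a => if f a < g a then h a else k a :=
  Primrec.ite (Primrec.nat_lt.comp hf hg) hh hk

@[fun_prop] theorem fp_idxOf [DecidableEq β] {f : α → β} {g : α → List β} (hf : Primrec f)
    (hg : Primrec g) : Primrec fun a => (g a).idxOf (f a) := Primrec.list_idxOf.comp hf hg

@[fun_prop] theorem fp_node {f : α → ℕ} {g : α → List ℕ} (hf : Primrec f) (hg : Primrec g) :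
    Primrec fun a => node (f a) (g a) := by unfold node; fun_prop

end Primrec
end

/-! ### Recursion over tree codes -/

/-- The label of the tree node with the given number. -/
def tagOf (n : ℕ) : ℕ := ((Encodable.decode n : Option (List ℕ)).getD []).getD 0 0

/-- The numbers of the children of the tree node with the given number. -/
def kids (n : ℕ) : List ℕ := ((Encodable.decode n : Option (List ℕ)).getD []).tail

@[simp] theorem tagOf_node (t : ℕ) (l : List ℕ) : tagOf (node t l) = t := by simp [tagOf, node]

@[simp] theorem kids_node (t : ℕ) (l : List ℕ) : kids (node t l) = l := by simp [kids, node]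

theorem node_injective {t t' : ℕ} {l l' : List ℕ} (h : node t l = node t' l') : t = t' ∧ l = l' := by
  simpa [node] using h

theorem lt_encode_of_mem {c : ℕ} {l : List ℕ} (h : c ∈ l) : c < Encodable.encode l := by
  induction l with
  | nil => simp at h
  | cons a l ih =>
    rw [Encodable.encode_list_cons]
    rcases List.mem_cons.1 h with rfl | h
    · exact Nat.lt_succ_of_le (by simpa using Nat.left_le_pair c (Encodable.encode l))
    · exact Nat.lt_succ_of_lt ((ih h).trans_le (Nat.right_le_pair _ _))

theorem lt_of_mem_kids {c n : ℕ} (h : c ∈ kids n) : c < n := by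
  unfold kids at h
  rw [Denumerable.decode_eq_ofNat, Option.getD_some] at h
  have := lt_encode_of_mem (List.mem_of_mem_tail h)
  simpa using this

/-- Recursion over trees on the level of their numbers: the value at a node is computed from the
label, the numbers of the children and the values at the children. -/
def foldNode {σ : Type} (G : ℕ × List ℕ × List σ → σ) (n : ℕ) : σ :=
  G (tagOf n, kids n, (kids n).attach.map fun c => foldNode G c.1)
termination_by n
decreasing_by exact lt_of_mem_kids c.2

theorem foldNode_eq {σ : Type} (G : ℕ × List ℕ × List σ → σ) (n : ℕ) :
    foldNode G n = G (tagOf n, kids n, (kids n).map (foldNode G)) := by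
  rw [foldNode]
  congr 3
  exact (List.map_map (g := foldNode G) (f := Subtype.val)).symm.trans (by rw [List.attach_map_subtype_val])

theorem foldNode_node {σ : Type} (G : ℕ × List ℕ × List σ → σ) (t : ℕ) (l : List ℕ) :
    foldNode G (node t l) = G (t, l, l.map (foldNode G)) := by
  rw [foldNode_eq, tagOf_node, kids_node]

section
variable {α σ : Type} [Primcodable α] [Primcodable σ]

@[fun_prop] theorem Primrec.fp_tagOf {f : α → ℕ} (hf : Primrec f) :
    Primrec fun a => tagOf (f a) := by
  have : Primrec fun a => (Encodable.decode (f a) : Option (List ℕ)).getD [] :=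
    Primrec.option_getD.comp (Primrec.decode.comp hf) (Primrec.const _)
  unfold tagOf; fun_prop

@[fun_prop] theorem Primrec.fp_kids {f : α → ℕ} (hf : Primrec f) :
    Primrec fun a => kids (f a) := by
  have : Primrec fun a => (Encodable.decode (f a) : Option (List ℕ)).getD [] :=
    Primrec.option_getD.comp (Primrec.decode.comp hf) (Primrec.const _)
  unfold kids; fun_prop

theorem Primrec.foldNode {G : ℕ × List ℕ × List σ → σ} (hG : Primrec G) :
    Primrec (foldNode G) := by
  have hg : Primrec₂ fun (_ : Unit) (prev : List σ) => some (G (tagOf prev.length,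
      kids prev.length, (kids prev.length).map fun c => prev.getD c (G (0, [], [])))) := by
    refine Primrec.option_some.comp (hG.comp ?_)
    fun_prop
  refine (Primrec.nat_strong_rec (fun (_ : Unit) n => _root_.foldNode G n) hg ?_).comp
    (Primrec.const ()) Primrec.id
  intro _ n
  simp only [List.length_map, List.length_range, Option.some.injEq]
  rw [foldNode_eq G n]
  congr 3
  refine List.map_congr_left fun c hc => ?_
  rw [List.getD_eq_getElem _ _ (by simpa using lt_of_mem_kids hc)]
  simp

end

/-! ### Two-level programs -/

/-- Bit strings. -/
abbrev Bits : Type := List Bool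

/-- The codes of the four parameters `α, θ, φ, l` of a single-qubit gate `exp(i α) u₃(θ, φ, l)`. -/
abbrev Params : Type := ℕ × ℕ × ℕ × ℕ

/-- A two-level program over a set `L` of labels of basis states.  The item `(a, b, g)` stands for
the unitary that acts as the single-qubit gate `g` on the plane spanned by `|a⟩` (in the role of
`|0⟩`) and `|b⟩` (in the role of `|1⟩`) and fixes all other basis states; it is skipped if
`a = b`.  The head of the list is applied first. -/
abbrev TL (L : Type) : Type := List (L × L × Params)

/-- The code of the angle `0`. -/
def zeroCode : ℕ := node 1 []

/-- The code of the angle `π`. -/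
def piCode : ℕ := node 2 []

/-- The code of the opposite angle. -/
def negCode (n : ℕ) : ℕ := node 3 [n]

/-- The parameters of the `X` gate, `u₃(π, 0, π)`. -/
def xParams : Params := (zeroCode, piCode, zeroCode, piCode)

/-- The parameters of the inverse gate. -/
def Params.inv (g : Params) : Params :=
  (negCode g.1, negCode g.2.1, negCode g.2.2.2, negCode g.2.2.1)

namespace TL
variable {K L : Type}

/-- Renaming of labels. -/
def relabel (e : K → L) (p : TL K) : TL L := p.map fun x => (e x.1, e x.2.1, x.2.2)

/-- The inverse program. -/
def inv (p : TL L) : TL L := (p.map fun x => (x.1, x.2.1, Params.inv x.2.2)).reverse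

/-- The swaps of the pairs of a table. -/
def swaps (t : List (L × L)) : TL L := t.map fun x => (x.1, x.2, xParams)

/-- The phase `exp(i a)` on each of the listed labels.  The partner of a label in the two-level gate
is immaterial, as `u₃(0, a, 0)` fixes it. -/
def phase (a : ℕ) (l : List ℕ) : TL ℕ := l.map fun x => (x + 1, x, (zeroCode, zeroCode, a, zeroCode))

/-- Input along a table, then a program on renamed labels, then output along a table. -/
def pipe (e : K → L) (tin : List (L × K)) (q : TL K) (tout : List (K × L)) : TL L :=
  swaps (tin.map fun x => (x.1, e x.2)) ++ q.relabel e ++ swaps (tout.map fun x => (e x.1, x.2))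

/-- The program `q` with inputs and outputs renamed along tables. A basis state of the input space
with code `a` has the label `Nat.pair 0 a`, one of the output space with code `b` has the label
`Nat.pair 1 b`. -/
def wrap (tin : List (ℕ × ℕ)) (q : TL ℕ) (tout : List (ℕ × ℕ)) : TL ℕ :=
  pipe (Nat.pair 2) (tin.map fun x => (Nat.pair 0 x.1, x.2)) q
    (tout.map fun x => (x.1, Nat.pair 1 x.2))

/-- The program `p`, then a transfer of labels of `p` to labels of `q` along a table, then `q`. -/
def join (p : TL ℕ) (t : List (ℕ × ℕ)) (q : TL ℕ) : TL ℕ :=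
  p.relabel (Nat.pair 0) ++ swaps (t.map fun x => (Nat.pair 0 x.1, Nat.pair 1 x.2)) ++
    q.relabel (Nat.pair 1)

/-- The direct sum of a tagged family of programs. -/
def fam (l : List (ℕ × TL ℕ)) : TL ℕ := l.flatMap fun x => x.2.relabel (Nat.pair x.1)

end TL

section
variable {α : Type} [Primcodable α]

namespace Primrec

@[fun_prop] theorem fp_relabel {K L : Type} [Primcodable K] [Primcodable L] {e : α → K → L}
    {p : α → TL K} (he : Primrec fun x : α × K => e x.1 x.2) (hp : Primrec p) :
    Primrec fun a => (p a).relabel (e a) := by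
  unfold TL.relabel
  exact Primrec.fp_map hp ((he.comp (by fun_prop : Primrec fun x : α × (K × K × Params) =>
    (x.1, x.2.1))).pair ((he.comp (by fun_prop : Primrec fun x : α × (K × K × Params) =>
    (x.1, x.2.2.1))).pair (by fun_prop)))

@[fun_prop] theorem fp_negCode {f : α → ℕ} (hf : Primrec f) : Primrec fun a => negCode (f a) := by
  unfold negCode; fun_prop

@[fun_prop] theorem fp_paramsInv {f : α → Params} (hf : Primrec f) :
    Primrec fun a => Params.inv (f a) := by
  unfold Params.inv; fun_prop

@[fun_prop] theorem fp_inv {p : α → TL ℕ} (hp : Primrec p) : Primrec fun a => (p a).inv := by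
  unfold TL.inv; fun_prop

@[fun_prop] theorem fp_swaps {L : Type} [Primcodable L] {p : α → List (L × L)} (hp : Primrec p) :
    Primrec fun a => TL.swaps (p a) := by
  unfold TL.swaps; fun_prop

@[fun_prop] theorem fp_phase {f : α → ℕ} {l : α → List ℕ} (hf : Primrec f) (hl : Primrec l) :
    Primrec fun a => TL.phase (f a) (l a) := by
  unfold TL.phase; fun_prop

@[fun_prop] theorem fp_wrap {tin tout : α → List (ℕ × ℕ)} {q : α → TL ℕ} (h : Primrec tin)
    (hq : Primrec q) (h' : Primrec tout) : Primrec fun a => TL.wrap (tin a) (q a) (tout a) := by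
  unfold TL.wrap TL.pipe; fun_prop

@[fun_prop] theorem fp_join {t : α → List (ℕ × ℕ)} {p q : α → TL ℕ} (hp : Primrec p)
    (ht : Primrec t) (hq : Primrec q) : Primrec fun a => TL.join (p a) (t a) (q a) := by
  unfold TL.join; fun_prop

@[fun_prop] theorem fp_fam {l : α → List (ℕ × TL ℕ)} (hl : Primrec l) :
    Primrec fun a => TL.fam (l a) := by
  unfold TL.fam; fun_prop

end Primrec
end

/-! ### Programs for the typing rules

A valuation is represented by the list `s` of the encodings of its values, a value by its encoding.
The sets of values and valuations that a program refers to are given as lists. -/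

/-- The bit strings that encode the values of the variables of a context. -/
abbrev EnvBits : Type := List Bits

/-- The code of an input: the valuations of the classical and of the quantum context. -/
def inCode (s t : EnvBits) : ℕ := Encodable.encode (s, t)

/-- The code of an output: the valuation of the classical context, the value, and a garbage label
(`0` for operators). -/
def outCode (s : EnvBits) (v : Bits) (g : ℕ) : ℕ := Encodable.encode (s, v, g)

/-- The label of an input. -/
def inL (s t : EnvBits) : ℕ := Nat.pair 0 (inCode s t)

/-- The label of an output. -/
def outL (s : EnvBits) (v : Bits) (g : ℕ) : ℕ := Nat.pair 1 (outCode s v g)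

section
variable {α : Type} [Primcodable α]

@[fun_prop] theorem Primrec.fp_inCode {s t : α → EnvBits} (hs : Primrec s) (ht : Primrec t) :
    Primrec fun a => inCode (s a) (t a) := by unfold inCode; fun_prop

@[fun_prop] theorem Primrec.fp_outCode {s : α → EnvBits} {v : α → Bits} {g : α → ℕ}
    (hs : Primrec s) (hv : Primrec v) (hg : Primrec g) :
    Primrec fun a => outCode (s a) (v a) (g a) := by unfold outCode; fun_prop

@[fun_prop] theorem Primrec.fp_inL {s t : α → EnvBits} (hs : Primrec s) (ht : Primrec t) :
    Primrec fun a => inL (s a) (t a) := by unfold inL; fun_prop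

@[fun_prop] theorem Primrec.fp_outL {s : α → EnvBits} {v : α → Bits} {g : α → ℕ}
    (hs : Primrec s) (hv : Primrec v) (hg : Primrec g) :
    Primrec fun a => outL (s a) (v a) (g a) := by unfold outL; fun_prop

end

open Encodable (encode)

namespace Rule

/-- The unit expression. -/
def unit (S : List EnvBits) : TL ℕ :=
  TL.wrap (S.map fun s => (inCode s [], encode s)) [] (S.map fun s => (encode s, outCode s [] 0))

/-- A variable of the classical context. -/
def cvar (S : List EnvBits) (V : List Bits) (S' : List EnvBits) : TL ℕ :=
  TL.wrap ((S ×ˢ V ×ˢ S').map fun i => (inCode (i.1 ++ i.2.1 :: i.2.2) [], encode i)) []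
    ((S ×ˢ V ×ˢ S').map fun i => (encode i, outCode (i.1 ++ i.2.1 :: i.2.2) i.2.1 0))

/-- A variable of the quantum context. -/
def qvar (S : List EnvBits) (V : List Bits) : TL ℕ :=
  TL.wrap ((S ×ˢ V).map fun i => (inCode i.1 [i.2], encode i)) []
    ((S ×ˢ V).map fun i => (encode i, outCode i.1 i.2 0))

/-- Pairing, with duplication of the basis states of the shared context `D`. -/
def pair (S D D₀ D₁ : List EnvBits) (V₀ V₁ : List Bits) (p₀ : TL ℕ) (G₀ : List ℕ) (p₁ : TL ℕ)
    (G₁ : List ℕ) : TL ℕ :=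
  TL.wrap
    ((S ×ˢ D ×ˢ D₀ ×ˢ D₁).map fun i => (inCode i.1 (i.2.1 ++ i.2.2.1 ++ i.2.2.2),
      Nat.pair 0 (Nat.pair (encode (i.2.1, i.2.2.2)) (inL i.1 (i.2.1 ++ i.2.2.1)))))
    (TL.join (TL.fam ((D ×ˢ D₁).map fun i => (encode i, p₀)))
      ((S ×ˢ D ×ˢ D₁ ×ˢ V₀ ×ˢ G₀).map fun i =>
        (Nat.pair (encode (i.2.1, i.2.2.1)) (outL i.1 i.2.2.2.1 i.2.2.2.2),
          Nat.pair (encode i.2.2.2) (inL i.1 (i.2.1 ++ i.2.2.1))))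
      (TL.fam ((V₀ ×ˢ G₀).map fun i => (encode i, p₁))))
    ((S ×ˢ (V₀ ×ˢ G₀) ×ˢ V₁ ×ˢ G₁).map fun i =>
      (Nat.pair 1 (Nat.pair (encode i.2.1) (outL i.1 i.2.2.1 i.2.2.2)),
        outCode i.1 (i.2.1.1 ++ i.2.2.1) (Nat.pair i.2.1.2 i.2.2.2)))

/-- Application of the program `q` to the output of `p`. -/
def app (S D : List EnvBits) (V V' : List Bits) (p : TL ℕ) (G : List ℕ) (q : TL ℕ)
    (G' : List ℕ) : TL ℕ :=
  TL.wrap ((S ×ˢ D).map fun i => (inCode i.1 i.2, Nat.pair 0 (inL i.1 i.2)))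
    (TL.join p
      ((S ×ˢ V ×ˢ G).map fun i =>
        (outL i.1 i.2.1 i.2.2, Nat.pair (encode (i.1, i.2.2)) (inL [] [i.2.1])))
      (TL.fam ((S ×ˢ G).map fun i => (encode i, q))))
    ((S ×ˢ G ×ˢ V' ×ˢ G').map fun i =>
      (Nat.pair 1 (Nat.pair (encode (i.1, i.2.1)) (outL [] i.2.2.1 i.2.2.2)),
        outCode i.1 i.2.2.1 (Nat.pair i.2.1 i.2.2.2)))

/-- Exchange of the entries number `k` and `k + 1`. -/
def swapAt (k : ℕ) (s : EnvBits) : EnvBits :=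
  s.take k ++ ((s.drop (k + 1)).take 1 ++ ((s.drop k).take 1 ++ s.drop (k + 2)))

/-- A sequence of exchanges of neighbours, the last one being performed first. -/
def swapsAt (l : List ℕ) (s : EnvBits) : EnvBits := l.foldr swapAt s

/-- Permutation of both contexts. -/
def perm (S D : List EnvBits) (V : List Bits) (G : List ℕ) (πg πd : List ℕ) (p : TL ℕ) : TL ℕ :=
  TL.wrap ((S ×ˢ D).map fun i => (inCode i.1 i.2, inL (swapsAt πg i.1) (swapsAt πd i.2))) p
    ((S ×ˢ V ×ˢ G).map fun i => (outL (swapsAt πg i.1) i.2.1 i.2.2, outCode i.1 i.2.1 i.2.2))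

/-- Abstraction: the adjoint of the pattern, then the body; the valuation of the part `D₀` of the
context of the pattern that the body does not use is garbage. -/
def abs (D D₀ : List EnvBits) (V V' : List Bits) (p q : TL ℕ) (G : List ℕ) : TL ℕ :=
  TL.wrap (V.map fun v => (inCode [] [v], Nat.pair 0 (outL [] v 0)))
    (TL.join p.inv
      ((D ×ˢ D₀).map fun i => (inL [] (i.1 ++ i.2), Nat.pair (encode i.2) (inL [] i.1)))
      (TL.fam (D₀.map fun i => (encode i, q))))
    ((D₀ ×ˢ V' ×ˢ G).map fun i => (Nat.pair 1 (Nat.pair (encode i.1) (outL [] i.2.1 i.2.2)),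
      outCode [] i.2.1 (Nat.pair (encode i.1) i.2.2)))

/-- The tag of a sum, an encoding, and padding. -/
def tagged (b : Bool) (pad : ℕ) (v : Bits) : Bits := b :: (v ++ List.replicate pad false)

/-- Injections into sums. -/
def inj (V : List Bits) (b : Bool) (pad : ℕ) : TL ℕ :=
  TL.wrap (V.map fun v => (inCode [] [v], encode v)) []
    (V.map fun v => (encode v, outCode [] (tagged b pad v) 0))

/-- A parameterized gate on one qubit. -/
def gate (θ φ l : ℕ) : TL ℕ :=
  TL.wrap ([false, true].map fun b => (inCode [] [[b]], encode b))
    [(encode false, encode true, (zeroCode, θ, φ, l))]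
    ([false, true].map fun b => (encode b, outCode [] [b] 0))

/-- Relative phase: conjugation of a phase on the contexts of the pattern by the program of the
pattern, and a phase on all values. -/
def rphase (D : List EnvBits) (V : List Bits) (p : TL ℕ) (r r' : ℕ) : TL ℕ :=
  TL.wrap (V.map fun v => (inCode [] [v], outL [] v 0))
    (p.inv ++ TL.phase r (D.map (inL [])) ++ TL.phase (negCode r') (D.map (inL [])) ++ p ++
      TL.phase r' (V.map fun v => outL [] v 0))
    (V.map fun v => (outL [] v 0, outCode [] v 0))

/-- The elements of the first list that are not in the second. -/
def minus (l l' : List ℕ) : List ℕ :=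
  l.flatMap fun x => if l'.idxOf x < l'.length then [] else [x]

/-- A strict upper bound of the labels of a program and of a list of further labels. -/
def bound (p : TL ℕ) (l : List ℕ) : ℕ :=
  p.foldr (fun x n => x.1 + x.2.1 + n) (l.foldr (fun x n => x + n) 1)

/-- The labels, other than outputs, on which amplitude can be left by the program `p`. -/
def leftover (D : List EnvBits) (V : List Bits) (p : TL ℕ) (G : List ℕ) : List ℕ :=
  minus (List.range (bound p (D.map (inL []))))
    ((V ×ˢ G).map fun i => outL [] i.1 i.2)

/-- The garbage labels of error recovery: those of success and those of failure. -/
def tryGarbage (D₀ D₁ : List EnvBits) (V : List Bits) (p₀ : TL ℕ) (G₀ G₁ : List ℕ) : List ℕ :=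
  ((D₁ ×ˢ G₀).map fun i => Nat.pair 0 (encode i)) ++
    ((leftover D₀ V p₀ G₀ ×ˢ G₁).map fun i => Nat.pair 1 (encode i))

/-- Error recovery: the amplitude that the first program does not send to outputs serves as the
control for the second program. -/
def tryCatch (D₀ D₁ : List EnvBits) (V : List Bits) (p₀ : TL ℕ) (G₀ : List ℕ) (p₁ : TL ℕ)
    (G₁ : List ℕ) : TL ℕ :=
  TL.wrap
    ((D₀ ×ˢ D₁).map fun i => (inCode [] (i.1 ++ i.2),
      Nat.pair 0 (Nat.pair (encode i.2) (inL [] i.1))))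
    (TL.join (TL.fam (D₁.map fun i => (encode i, p₀)))
      ((D₁ ×ˢ leftover D₀ V p₀ G₀).map fun i =>
        (Nat.pair (encode i.1) i.2, Nat.pair i.2 (inL [] i.1)))
      (TL.fam ((leftover D₀ V p₀ G₀).map fun i => (i, p₁))))
    (((V ×ˢ D₁ ×ˢ G₀).map fun i => (Nat.pair 0 (Nat.pair (encode i.2.1) (outL [] i.1 i.2.2)),
        outCode [] i.1 (Nat.pair 0 (encode i.2)))) ++
      ((V ×ˢ leftover D₀ V p₀ G₀ ×ˢ G₁).map fun i =>
        (Nat.pair 1 (Nat.pair i.2.1 (outL [] i.1 i.2.2)),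
          outCode [] i.1 (Nat.pair 1 (encode i.2)))))

/-- The branches of a control: the number of the pattern, the valuation of its variables, and the
value that is matched. -/
def branches (n : ℕ) (m : List (List (EnvBits × Bits))) : List (ℕ × EnvBits × Bits) :=
  (List.range n).flatMap fun j => (m.getD j []).map fun x => (j, x)

/-- The valuation that can be read off from a value at the given positions (offset and length). -/
def readBits (rd : List (ℕ × ℕ)) (v : Bits) : EnvBits := rd.map fun x => (v.drop x.1).take x.2

/-- Coherent control. The program `p` of the controlling expression is run, tagged by the full input;
its output determines the branch; the program of the branch is run; and `p` is undone, tagged by the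
classical context, the shared quantum context and the value of the branch. In the end the shared
quantum context is erased, being determined by this value. -/
def ctrl (S S' D D' : List EnvBits) (V V' : List Bits) (n : ℕ) (m : List (List (EnvBits × Bits)))
    (rd : List (ℕ × ℕ)) (p : TL ℕ) (G : List ℕ) (q : List (TL ℕ)) : TL ℕ :=
  TL.wrap
    (((S ×ˢ S') ×ˢ D ×ˢ D').map fun i => (inCode (i.1.1 ++ i.1.2) (i.2.1 ++ i.2.2),
      Nat.pair 0 (Nat.pair 0 (Nat.pair (encode i) (inL [] (i.1.1 ++ i.2.1))))))
    (TL.join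
      (TL.join (TL.fam (((S ×ˢ S') ×ˢ D ×ˢ D').map fun i => (encode i, p)))
        ((((S ×ˢ S') ×ˢ D ×ˢ D') ×ˢ branches n m ×ˢ G).map fun i =>
          (Nat.pair (encode i.1) (outL [] i.2.1.2.2 i.2.2),
            Nat.pair (encode (i.2.1.1, i.1.2.1, i.2.1.2.2, i.2.2))
              (inL (i.1.1.1 ++ i.1.1.2 ++ i.2.1.2.1) (i.1.2.1 ++ i.1.2.2))))
        (TL.fam ((List.range n ×ˢ D ×ˢ V ×ˢ G).map fun i => (encode i, q.getD i.1 []))))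
      ((((S ×ˢ S') ×ˢ D ×ˢ V') ×ˢ branches n m ×ˢ G).map fun i =>
        (Nat.pair 1 (Nat.pair (encode (i.2.1.1, i.1.2.1, i.2.1.2.2, i.2.2))
            (outL (i.1.1.1 ++ i.1.1.2 ++ i.2.1.2.1) i.1.2.2 0)),
          Nat.pair (encode i.1) (outL [] i.2.1.2.2 i.2.2)))
      (TL.fam (((S ×ˢ S') ×ˢ D ×ˢ V').map fun i => (encode i, p.inv))))
    (((S ×ˢ S') ×ˢ V').map fun i =>
      (Nat.pair 1 (Nat.pair (encode (i.1, readBits rd i.2, i.2))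
        (inL [] (i.1.1 ++ readBits rd i.2))), outCode (i.1.1 ++ i.1.2) i.2 0))

end Rule

section
variable {α : Type} [Primcodable α] {S S' D D' D₀ D₁ : α → List EnvBits}
  {V V' V₀ V₁ : α → List Bits} {p q : α → TL ℕ} {G G' : α → List ℕ}

namespace Primrec

@[fun_prop] theorem rule_unit (hS : Primrec S) : Primrec fun a => Rule.unit (S a) := by
  unfold Rule.unit; fun_prop

@[fun_prop] theorem rule_cvar (hS : Primrec S) (hV : Primrec V) (hS' : Primrec S') :
    Primrec fun a => Rule.cvar (S a) (V a) (S' a) := by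
  unfold Rule.cvar; fun_prop

@[fun_prop] theorem rule_qvar (hS : Primrec S) (hV : Primrec V) :
    Primrec fun a => Rule.qvar (S a) (V a) := by
  unfold Rule.qvar; fun_prop

@[fun_prop] theorem rule_pair (hS : Primrec S) (hD : Primrec D) (hD₀ : Primrec D₀)
    (hD₁ : Primrec D₁) (hV₀ : Primrec V₀) (hV₁ : Primrec V₁) (hp : Primrec p) (hG : Primrec G)
    (hq : Primrec q) (hG' : Primrec G') :
    Primrec fun a => Rule.pair (S a) (D a) (D₀ a) (D₁ a) (V₀ a) (V₁ a) (p a) (G a) (q a) (G' a) := by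
  unfold Rule.pair; fun_prop

@[fun_prop] theorem rule_app (hS : Primrec S) (hD : Primrec D) (hV : Primrec V) (hV' : Primrec V')
    (hp : Primrec p) (hG : Primrec G) (hq : Primrec q) (hG' : Primrec G') :
    Primrec fun a => Rule.app (S a) (D a) (V a) (V' a) (p a) (G a) (q a) (G' a) := by
  unfold Rule.app; fun_prop

@[fun_prop] theorem rule_swapsAt {l : α → List ℕ} {s : α → EnvBits} (hl : Primrec l)
    (hs : Primrec s) : Primrec fun a => Rule.swapsAt (l a) (s a) := by
  unfold Rule.swapsAt Rule.swapAt; fun_prop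

@[fun_prop] theorem rule_perm {l l' : α → List ℕ} (hS : Primrec S) (hD : Primrec D)
    (hV : Primrec V) (hG : Primrec G) (hl : Primrec l) (hl' : Primrec l') (hp : Primrec p) :
    Primrec fun a => Rule.perm (S a) (D a) (V a) (G a) (l a) (l' a) (p a) := by
  unfold Rule.perm; fun_prop

@[fun_prop] theorem rule_abs (hD : Primrec D) (hD₀ : Primrec D₀) (hV : Primrec V)
    (hV' : Primrec V') (hp : Primrec p) (hq : Primrec q) (hG : Primrec G) :
    Primrec fun a => Rule.abs (D a) (D₀ a) (V a) (V' a) (p a) (q a) (G a) := by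
  unfold Rule.abs; fun_prop

@[fun_prop] theorem rule_tagged {b : α → Bool} {n : α → ℕ} {v : α → Bits} (hb : Primrec b)
    (hn : Primrec n) (hv : Primrec v) : Primrec fun a => Rule.tagged (b a) (n a) (v a) := by
  unfold Rule.tagged; fun_prop

@[fun_prop] theorem rule_inj {b : α → Bool} {n : α → ℕ} (hV : Primrec V) (hb : Primrec b)
    (hn : Primrec n) : Primrec fun a => Rule.inj (V a) (b a) (n a) := by
  unfold Rule.inj; fun_prop

@[fun_prop] theorem rule_gate {θ φ l : α → ℕ} (hθ : Primrec θ) (hφ : Primrec φ)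
    (hl : Primrec l) : Primrec fun a => Rule.gate (θ a) (φ a) (l a) := by
  unfold Rule.gate; fun_prop

@[fun_prop] theorem rule_rphase {r r' : α → ℕ} (hD : Primrec D) (hV : Primrec V)
    (hp : Primrec p) (hr : Primrec r) (hr' : Primrec r') :
    Primrec fun a => Rule.rphase (D a) (V a) (p a) (r a) (r' a) := by
  unfold Rule.rphase; fun_prop

@[fun_prop] theorem rule_bound {l : α → List ℕ} (hp : Primrec p) (hl : Primrec l) :
    Primrec fun a => Rule.bound (p a) (l a) := by
  unfold Rule.bound; fun_prop

@[fun_prop] theorem rule_leftover (hD : Primrec D) (hV : Primrec V) (hp : Primrec p)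
    (hG : Primrec G) : Primrec fun a => Rule.leftover (D a) (V a) (p a) (G a) := by
  unfold Rule.leftover Rule.minus; fun_prop

@[fun_prop] theorem rule_tryGarbage (hD₀ : Primrec D₀) (hD₁ : Primrec D₁) (hV : Primrec V)
    (hp : Primrec p) (hG : Primrec G) (hG' : Primrec G') :
    Primrec fun a => Rule.tryGarbage (D₀ a) (D₁ a) (V a) (p a) (G a) (G' a) := by
  unfold Rule.tryGarbage; fun_prop

@[fun_prop] theorem rule_tryCatch (hD₀ : Primrec D₀) (hD₁ : Primrec D₁) (hV : Primrec V)
    (hp : Primrec p) (hG : Primrec G) (hq : Primrec q) (hG' : Primrec G') :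
    Primrec fun a => Rule.tryCatch (D₀ a) (D₁ a) (V a) (p a) (G a) (q a) (G' a) := by
  unfold Rule.tryCatch; fun_prop

@[fun_prop] theorem rule_branches {n : α → ℕ} {m : α → List (List (EnvBits × Bits))}
    (hn : Primrec n) (hm : Primrec m) : Primrec fun a => Rule.branches (n a) (m a) := by
  unfold Rule.branches; fun_prop

@[fun_prop] theorem rule_readBits {rd : α → List (ℕ × ℕ)} {v : α → Bits}
    (hr : Primrec rd) (hv : Primrec v) : Primrec fun a => Rule.readBits (rd a) (v a) := by
  unfold Rule.readBits; fun_prop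

@[fun_prop] theorem rule_ctrl {n : α → ℕ} {m : α → List (List (EnvBits × Bits))}
    {rd : α → List (ℕ × ℕ)} {r : α → List (TL ℕ)} (hS : Primrec S) (hS' : Primrec S')
    (hD : Primrec D) (hD' : Primrec D') (hV : Primrec V) (hV' : Primrec V') (hn : Primrec n)
    (hm : Primrec m) (hrd : Primrec rd) (hp : Primrec p) (hG : Primrec G) (hr : Primrec r) :
    Primrec fun a => Rule.ctrl (S a) (S' a) (D a) (D' a) (V a) (V' a) (n a) (m a) (rd a) (p a)
      (G a) (r a) := by
  unfold Rule.ctrl; fun_prop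

end Primrec
end

/-! ### Types, contexts, permutations, erasure positions and patterns on the level of codes -/

/-- The size of a type and the encodings of its values. -/
def tyData : ℕ → ℕ × List Bits :=
  foldNode fun x =>
    let a := x.2.2.getD 0 (0, [])
    let b := x.2.2.getD 1 (0, [])
    [(0, []), (0, [[]]),
      (1 + max a.1 b.1, a.2.map (Rule.tagged false (max a.1 b.1 - a.1)) ++
        b.2.map (Rule.tagged true (max a.1 b.1 - b.1))),
      (a.1 + b.1, (a.2 ×ˢ b.2).map fun v => v.1 ++ v.2)].getD x.1 (0, [])

@[fun_prop] theorem Primrec.fp_tyData {α : Type} [Primcodable α] {f : α → ℕ} (hf : Primrec f) :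
    Primrec fun a => tyData (f a) := by
  refine (Primrec.foldNode ?_).comp hf
  fun_prop

/-- The codes of the types of a context. -/
def ctxTys (n : ℕ) : List ℕ := (kids n).map fun c => (kids c).getD 1 0

/-- The valuations of a context whose types have the given codes. -/
def envs (l : List ℕ) : List EnvBits :=
  l.foldr (fun T acc => ((tyData T).2 ×ˢ acc).map fun x => x.1 :: x.2) [[]]

/-- The positions at which a permutation successively exchanges neighbours. -/
def permData : ℕ → List ℕ :=
  foldNode fun x =>
    [[], (x.2.2.getD 0 []).map (· + 1), [0], x.2.2.getD 0 [] ++ x.2.2.getD 1 []].getD x.1 []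

/-- Offset and length of the place of the erased variable; for a list of derivations, the list of
these. -/
def eraseData : ℕ → (ℕ × ℕ) × List (ℕ × ℕ) :=
  foldNode fun x =>
    ([(0, (tyData (x.2.1.getD 1 0)).1), (x.2.2.getD 7 ((0, 0), [])).1,
      (x.2.2.getD 8 ((0, 0), [])).1, (x.2.2.getD 5 ((0, 0), [])).1,
      ((tyData (x.2.1.getD 1 0)).1 + (x.2.2.getD 5 ((0, 0), [])).1.1,
        (x.2.2.getD 5 ((0, 0), [])).1.2)].getD x.1 (0, 0), x.2.2.map Prod.fst)

/-- The value that a table assigns to a valuation. -/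
def look (m : List (EnvBits × Bits)) (s : EnvBits) : Bits :=
  (m.flatMap fun x => if x.1 = s then x.2 else [])

section
variable {α : Type} [Primcodable α] {f : α → ℕ}

namespace Primrec

@[fun_prop] theorem fp_ctxTys (hf : Primrec f) : Primrec fun a => ctxTys (f a) := by
  unfold ctxTys; fun_prop

@[fun_prop] theorem fp_envs {f : α → List ℕ} (hf : Primrec f) : Primrec fun a => envs (f a) := by
  unfold envs; fun_prop

@[fun_prop] theorem fp_permData (hf : Primrec f) : Primrec fun a => permData (f a) := by
  refine (Primrec.foldNode ?_).comp hf
  fun_prop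

@[fun_prop] theorem fp_eraseData (hf : Primrec f) : Primrec fun a => eraseData (f a) := by
  refine (Primrec.foldNode ?_).comp hf
  fun_prop

@[fun_prop] theorem fp_look {m : α → List (EnvBits × Bits)} {s : α → EnvBits} (hm : Primrec m)
    (hs : Primrec s) : Primrec fun a => look (m a) (s a) := by
  unfold look; fun_prop

end Primrec
end

/-- The table of a pattern, and for a list of patterns the list of their tables. -/
abbrev PatData : Type := List (EnvBits × Bits) × List (List (EnvBits × Bits))

/-- The table of a pair of patterns whose contexts have the parts `Δ, Δ₀` and `Δ, Δ₁`. -/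
def pairTable (Δ Δ₀ Δ₁ : List ℕ) (m₀ m₁ : List (EnvBits × Bits)) : List (EnvBits × Bits) :=
  (envs (Δ ++ Δ₀ ++ Δ₁)).map fun s =>
    (s, look m₀ (s.take (Δ.length + Δ₀.length)) ++
      look m₁ (s.take Δ.length ++ s.drop (Δ.length + Δ₀.length)))

/-- The table of the injection with code `f`, applied to a pattern. -/
def injTable (f : ℕ) (m : List (EnvBits × Bits)) : List (EnvBits × Bits) :=
  m.map fun y => (y.1,
    if tagOf f = 1 then
      Rule.tagged false (max (tyData ((kids f).getD 0 0)).1 (tyData ((kids f).getD 1 0)).1 -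
        (tyData ((kids f).getD 0 0)).1) y.2
    else
      Rule.tagged true (max (tyData ((kids f).getD 0 0)).1 (tyData ((kids f).getD 1 0)).1 -
        (tyData ((kids f).getD 1 0)).1) y.2)

section
variable {α : Type} [Primcodable α]

namespace Primrec

@[fun_prop] theorem fp_pairTable {Δ Δ₀ Δ₁ : α → List ℕ} {m₀ m₁ : α → List (EnvBits × Bits)}
    (h : Primrec Δ) (h₀ : Primrec Δ₀) (h₁ : Primrec Δ₁) (hm₀ : Primrec m₀) (hm₁ : Primrec m₁) :
    Primrec fun a => pairTable (Δ a) (Δ₀ a) (Δ₁ a) (m₀ a) (m₁ a) := by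
  unfold pairTable; fun_prop

@[fun_prop] theorem fp_injTable {f : α → ℕ} {m : α → List (EnvBits × Bits)} (hf : Primrec f)
    (hm : Primrec m) : Primrec fun a => injTable (f a) (m a) := by
  unfold injTable; fun_prop

end Primrec
end

/-- The table of a pattern from those of its parts. -/
def patStep (x : ℕ × List ℕ × List PatData) : PatData :=
  ([[([], [])],
    [],
    (tyData (x.2.1.getD 2 0)).2.map fun v => ([v], v),
    pairTable (ctxTys (x.2.1.getD 1 0)) (ctxTys (x.2.1.getD 2 0)) (ctxTys (x.2.1.getD 3 0))
      (x.2.2.getD 8 ([], [])).1 (x.2.2.getD 9 ([], [])).1,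
    [],
    injTable (x.2.1.getD 2 0) (x.2.2.getD 7 ([], [])).1,
    (envs (ctxTys (x.2.1.getD 3 0))).map fun s => (s,
      look (x.2.2.getD 8 ([], [])).1 (Rule.swapsAt (permData (x.2.1.getD 7 0)) s))].getD x.1 [],
    x.2.2.map Prod.fst)

theorem Primrec.patStep : Primrec patStep := by
  unfold _root_.patStep; fun_prop

/-- The valuations of the quantum context of a pattern, with the values that they match; for a list
of patterns, the list of these tables. -/
def patData : ℕ → PatData := foldNode patStep

@[fun_prop] theorem Primrec.fp_patData {α : Type} [Primcodable α] {f : α → ℕ} (hf : Primrec f) :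
    Primrec fun a => patData (f a) :=
  (Primrec.foldNode Primrec.patStep).comp hf

/-! ### The compiler on the level of codes -/

/-- The programs of a derivation, read as a derivation of each of the four judgments, with garbage
labels in the mixed cases; for a list of derivations of pure expressions, the list of their
programs. The components are, in this order, those for pure expressions, mixed expressions, pure
programs, mixed programs, and lists. -/
abbrev Compiled : Type :=
  TL ℕ × (TL ℕ × List ℕ) × TL ℕ × (TL ℕ × List ℕ) × List (TL ℕ)

/-- The entry of a list of results for a given child. -/
def Compiled.at (l : List Compiled) (i : ℕ) : Compiled := l.getD i ([], ([], []), [], ([], []), [])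

/-- The valuations of the context with code `n`. -/
def ctxEnvs (n : ℕ) : List EnvBits := envs (ctxTys n)

/-- The encodings of the values of the type with code `n`. -/
def tyVals (n : ℕ) : List Bits := (tyData n).2

section
variable {α : Type} [Primcodable α]

namespace Primrec

@[fun_prop] theorem fp_at {l : α → List Compiled} {i : α → ℕ} (hl : Primrec l) (hi : Primrec i) :
    Primrec fun a => Compiled.at (l a) (i a) := by
  unfold Compiled.at; fun_prop

@[fun_prop] theorem fp_ctxEnvs {f : α → ℕ} (hf : Primrec f) :
    Primrec fun a => ctxEnvs (f a) := by unfold ctxEnvs; fun_prop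

@[fun_prop] theorem fp_tyVals {f : α → ℕ} (hf : Primrec f) :
    Primrec fun a => tyVals (f a) := by unfold tyVals; fun_prop

end Primrec
end

/-- The program of coherent control from the codes `l` and the results `r` of the parts. -/
def ctrlCase (l : List ℕ) (r : List Compiled) : TL ℕ :=
  Rule.ctrl (ctxEnvs (l.getD 0 0)) (ctxEnvs (l.getD 1 0)) (ctxEnvs (l.getD 2 0))
    (ctxEnvs (l.getD 3 0)) (tyVals (l.getD 5 0)) (tyVals (l.getD 6 0))
    (kids (l.getD 12 0)).length (patData (l.getD 12 0)).2 (eraseData (l.getD 13 0)).2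
    (Compiled.at r 10).2.1.1 (Compiled.at r 10).2.1.2 (Compiled.at r 14).2.2.2.2

/-- The program of a pure expression. -/
def pureECase (t : ℕ) (l : List ℕ) (r : List Compiled) : TL ℕ :=
  [Rule.unit (ctxEnvs (l.getD 0 0)),
    Rule.cvar (ctxEnvs (l.getD 0 0)) (tyVals (l.getD 2 0)) (ctxEnvs (l.getD 3 0)),
    Rule.qvar (ctxEnvs (l.getD 0 0)) (tyVals (l.getD 2 0)),
    Rule.pair (ctxEnvs (l.getD 0 0)) (ctxEnvs (l.getD 1 0)) (ctxEnvs (l.getD 2 0))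
      (ctxEnvs (l.getD 3 0)) (tyVals (l.getD 6 0)) (tyVals (l.getD 7 0)) (Compiled.at r 8).1 [0]
      (Compiled.at r 9).1 [0],
    ctrlCase l r,
    Rule.app (ctxEnvs (l.getD 0 0)) (ctxEnvs (l.getD 1 0)) (tyVals (l.getD 4 0))
      (tyVals (l.getD 5 0)) (Compiled.at r 7).1 [0] (Compiled.at r 6).2.2.1 [0],
    Rule.perm (ctxEnvs (l.getD 1 0)) (ctxEnvs (l.getD 3 0)) (tyVals (l.getD 5 0)) [0]
      (permData (l.getD 6 0)) (permData (l.getD 7 0)) (Compiled.at r 8).1].getD t []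

/-- The program of a mixed expression, with its garbage labels. -/
def mixedECase (t : ℕ) (l : List ℕ) (r : List Compiled) : TL ℕ × List ℕ :=
  [((Compiled.at r 3).1, [0]),
    (Rule.perm [[]] (ctxEnvs (l.getD 1 0)) (tyVals (l.getD 3 0)) (Compiled.at r 5).2.1.2 []
      (permData (l.getD 4 0)) (Compiled.at r 5).2.1.1, (Compiled.at r 5).2.1.2),
    (Rule.pair [[]] (ctxEnvs (l.getD 0 0)) (ctxEnvs (l.getD 1 0)) (ctxEnvs (l.getD 2 0))
      (tyVals (l.getD 5 0)) (tyVals (l.getD 6 0)) (Compiled.at r 7).2.1.1 (Compiled.at r 7).2.1.2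
      (Compiled.at r 8).2.1.1 (Compiled.at r 8).2.1.2,
      ((Compiled.at r 7).2.1.2 ×ˢ (Compiled.at r 8).2.1.2).map fun i => Nat.pair i.1 i.2),
    (Rule.tryCatch (ctxEnvs (l.getD 0 0)) (ctxEnvs (l.getD 1 0)) (tyVals (l.getD 4 0))
      (Compiled.at r 5).2.1.1 (Compiled.at r 5).2.1.2 (Compiled.at r 6).2.1.1
      (Compiled.at r 6).2.1.2,
      Rule.tryGarbage (ctxEnvs (l.getD 0 0)) (ctxEnvs (l.getD 1 0)) (tyVals (l.getD 4 0))
      (Compiled.at r 5).2.1.1 (Compiled.at r 5).2.1.2 (Compiled.at r 6).2.1.2),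
    (Rule.app [[]] (ctxEnvs (l.getD 0 0)) (tyVals (l.getD 3 0)) (tyVals (l.getD 4 0))
      (Compiled.at r 6).2.1.1 (Compiled.at r 6).2.1.2 (Compiled.at r 5).2.2.2.1.1
      (Compiled.at r 5).2.2.2.1.2,
      ((Compiled.at r 6).2.1.2 ×ˢ (Compiled.at r 5).2.2.2.1.2).map fun i =>
        Nat.pair i.1 i.2)].getD t ([], [])

/-- The program of a pure program. -/
def purePCase (t : ℕ) (l : List ℕ) (r : List Compiled) : TL ℕ :=
  [Rule.gate (node 0 [l.getD 0 0]) (node 0 [l.getD 1 0]) (node 0 [l.getD 2 0]),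
    Rule.inj (tyVals (l.getD 0 0)) false
      (max (tyData (l.getD 0 0)).1 (tyData (l.getD 1 0)).1 - (tyData (l.getD 0 0)).1),
    Rule.inj (tyVals (l.getD 1 0)) true
      (max (tyData (l.getD 0 0)).1 (tyData (l.getD 1 0)).1 - (tyData (l.getD 1 0)).1),
    Rule.abs (ctxEnvs (l.getD 0 0)) [[]] (tyVals (l.getD 3 0)) (tyVals (l.getD 4 0))
      (Compiled.at r 5).1 (Compiled.at r 6).1 [0],
    Rule.rphase (ctxEnvs (l.getD 0 0)) (tyVals (l.getD 2 0)) (Compiled.at r 5).1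
      (node 0 [l.getD 3 0]) (node 0 [l.getD 4 0])].getD t []

/-- The program of a mixed program, with its garbage labels. -/
def mixedPCase (t : ℕ) (l : List ℕ) (r : List Compiled) : TL ℕ × List ℕ :=
  [((Compiled.at r 3).2.2.1, [0]),
    (Rule.abs (ctxEnvs (l.getD 0 0)) (ctxEnvs (l.getD 1 0)) (tyVals (l.getD 4 0))
      (tyVals (l.getD 5 0)) (Compiled.at r 6).1 (Compiled.at r 7).2.1.1 (Compiled.at r 7).2.1.2,
      (ctxEnvs (l.getD 1 0) ×ˢ (Compiled.at r 7).2.1.2).map fun i =>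
        Nat.pair (encode i.1) i.2)].getD t ([], [])

section
variable {α : Type} [Primcodable α] {t : α → ℕ} {l : α → List ℕ} {r : α → List Compiled}

namespace Primrec

@[fun_prop] theorem fp_ctrlCase (hl : Primrec l) (hr : Primrec r) :
    Primrec fun a => ctrlCase (l a) (r a) := by
  unfold ctrlCase; fun_prop

@[fun_prop] theorem fp_pureECase (ht : Primrec t) (hl : Primrec l) (hr : Primrec r) :
    Primrec fun a => pureECase (t a) (l a) (r a) := by
  unfold pureECase; fun_prop

@[fun_prop] theorem fp_mixedECase (ht : Primrec t) (hl : Primrec l) (hr : Primrec r) :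
    Primrec fun a => mixedECase (t a) (l a) (r a) := by
  unfold mixedECase; fun_prop

@[fun_prop] theorem fp_purePCase (ht : Primrec t) (hl : Primrec l) (hr : Primrec r) :
    Primrec fun a => purePCase (t a) (l a) (r a) := by
  unfold purePCase; fun_prop

@[fun_prop] theorem fp_mixedPCase (ht : Primrec t) (hl : Primrec l) (hr : Primrec r) :
    Primrec fun a => mixedPCase (t a) (l a) (r a) := by
  unfold mixedPCase; fun_prop

end Primrec
end

/-- The programs of a derivation from those of its parts. -/
def compileStep (x : ℕ × List ℕ × List Compiled) : Compiled :=
  (pureECase x.1 x.2.1 x.2.2, mixedECase x.1 x.2.1 x.2.2, purePCase x.1 x.2.1 x.2.2,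
    mixedPCase x.1 x.2.1 x.2.2, x.2.2.map Prod.fst)

/-- The programs of the derivation with the given number. -/
def compileCode : ℕ → Compiled := foldNode compileStep

@[fun_prop] theorem Primrec.fp_compileCode {α : Type} [Primcodable α] {f : α → ℕ}
    (hf : Primrec f) : Primrec fun a => compileCode (f a) := by
  refine (Primrec.foldNode ?_).comp hf
  unfold compileStep; fun_prop

/-! ### Circuits from two-level programs, on the level of codes -/

namespace Synth

/-- A gate on the level of codes: controls, target, parameters. -/
abbrev RawGate : Type := List ℕ × ℕ × Params

/-- The code of a gate. -/
def RawGate.code (g : RawGate) : ℕ :=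
  node 0 [node 0 g.1, g.2.1, g.2.2.1, g.2.2.2.1, g.2.2.2.2.1, g.2.2.2.2.2]

/-- `X` gates and controlled `X` gates on `n` wires that map the string `a` to the string that is `0`
on the wire `t` and `1` on all others, and `b` to the string of ones, if `a` and `b` differ on the
wire `t`. -/
def align (n t : ℕ) (a b : Bits) : List RawGate :=
  (if a.getD t false = true then [([], t, xParams)] else []) ++
    (List.range n).flatMap fun i => if i = t then [] else
      (if a.getD i false = true then [] else [([], i, xParams)]) ++
      (if a.getD i false = b.getD i false then [] else [([t], i, xParams)])

/-- The first wire on which two strings differ. -/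
def diff (n : ℕ) (a b : Bits) : ℕ :=
  (List.range n).findIdx fun i => if a.getD i false = b.getD i false then false else true

/-- Gates on `n` wires for the two-level unitary of `g` on the strings `a` and `b`. -/
def twoLevel (n : ℕ) (a b : Bits) (g : Params) : List RawGate :=
  if diff n a b < n then
    align n (diff n a b) a b ++
      (((List.range n).flatMap fun i => if i = diff n a b then [] else [i], diff n a b, g) ::
        (align n (diff n a b) a b).reverse)
  else []

/-- Gates on `n` wires for a two-level program on bit strings. -/
def gates (n : ℕ) (p : TL Bits) : List RawGate := p.flatMap fun x => twoLevel n x.1 x.2.1 x.2.2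

/-- The bit string of the internal label `x`: the wire `M`, which is `0` for inputs and outputs, and
the wire `M + 1 + x` are `1`. -/
def hot (M x : ℕ) : Bits :=
  List.replicate M false ++ true :: (List.replicate x false ++ [true])

/-- A bound for the labels of a program and the labels of its inputs and outputs. -/
def labelBound (S D : List EnvBits) (V : List Bits) (p : TL ℕ) (G : List (ℕ × Bits)) : ℕ :=
  Rule.bound p (((S ×ˢ D).map fun i => inL i.1 i.2) ++
    ((S ×ˢ V ×ˢ G).map fun i => outL i.1 i.2.1 i.2.2.1))

/-- The program on bit strings: the encodings of inputs are transferred to internal labels, and the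
outputs to their encodings, followed by zeros on `f` flag wires and the bits of the garbage label. -/
def bitProgram (S D : List EnvBits) (V : List Bits) (M f : ℕ) (p : TL ℕ) (G : List (ℕ × Bits)) :
    TL Bits :=
  TL.pipe (hot M) ((S ×ˢ D).map fun i => (i.1.flatten ++ i.2.flatten, inL i.1 i.2)) p
    ((S ×ˢ V ×ˢ G).map fun i => (outL i.1 i.2.1 i.2.2.1,
      i.1.flatten ++ i.2.1 ++ List.replicate f false ++ i.2.2.2))

/-- The code of the circuit for a program whose inputs and outputs have `a` and `b` bits, with `ng`
garbage wires. -/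
def circuitCode (S D : List EnvBits) (V : List Bits) (a b : ℕ) (p : TL ℕ) (G : List (ℕ × Bits))
    (ng : ℕ) : ℕ :=
  node 0 [b + 1 + labelBound S D V p G + ng, a + 1 + labelBound S D V p G, ng,
    node 0 ((gates (a + (b + 1 + labelBound S D V p G + ng))
      (bitProgram S D V (a + b) (a + 1 + labelBound S D V p G) p G)).map RawGate.code)]

/-- The wires of the garbage labels: one wire for each. -/
def garbageBits (G : List ℕ) : List (ℕ × Bits) :=
  (List.range G.length).map fun k => (G.getD k 0, List.replicate k false ++ [true])

end Synth

section
variable {α : Type} [Primcodable α]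

namespace Primrec

@[fun_prop] theorem fp_findIdx {β : Type} [Primcodable β] {f : α → List β} {p : α → β → Bool}
    (hf : Primrec f) (hp : Primrec fun x : α × β => p x.1 x.2) :
    Primrec fun a => (f a).findIdx (p a) := Primrec.list_findIdx hf hp

@[fun_prop] theorem synth_rawGateCode {g : α → Synth.RawGate} (hg : Primrec g) :
    Primrec fun a => (g a).code := by
  unfold Synth.RawGate.code; fun_prop

@[fun_prop] theorem synth_align {n t : α → ℕ} {a b : α → Bits} (hn : Primrec n) (ht : Primrec t)
    (ha : Primrec a) (hb : Primrec b) :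
    Primrec fun x => Synth.align (n x) (t x) (a x) (b x) := by
  unfold Synth.align; fun_prop

@[fun_prop] theorem synth_diff {n : α → ℕ} {a b : α → Bits} (hn : Primrec n) (ha : Primrec a)
    (hb : Primrec b) : Primrec fun x => Synth.diff (n x) (a x) (b x) := by
  unfold Synth.diff; fun_prop

@[fun_prop] theorem synth_twoLevel {n : α → ℕ} {a b : α → Bits} {g : α → Params}
    (hn : Primrec n) (ha : Primrec a) (hb : Primrec b) (hg : Primrec g) :
    Primrec fun x => Synth.twoLevel (n x) (a x) (b x) (g x) := by
  unfold Synth.twoLevel; fun_prop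

@[fun_prop] theorem synth_gates {n : α → ℕ} {p : α → TL Bits} (hn : Primrec n) (hp : Primrec p) :
    Primrec fun x => Synth.gates (n x) (p x) := by
  unfold Synth.gates; fun_prop

@[fun_prop] theorem synth_hot {M n : α → ℕ} (hM : Primrec M) (hn : Primrec n) :
    Primrec fun x => Synth.hot (M x) (n x) := by
  unfold Synth.hot; fun_prop

@[fun_prop] theorem synth_labelBound {S D : α → List EnvBits} {V : α → List Bits} {p : α → TL ℕ}
    {G : α → List (ℕ × Bits)} (hS : Primrec S) (hD : Primrec D) (hV : Primrec V) (hp : Primrec p)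
    (hG : Primrec G) : Primrec fun x => Synth.labelBound (S x) (D x) (V x) (p x) (G x) := by
  unfold Synth.labelBound; fun_prop

@[fun_prop] theorem synth_bitProgram {S D : α → List EnvBits} {V : α → List Bits} {p : α → TL ℕ}
    {G : α → List (ℕ × Bits)} {M f : α → ℕ} (hS : Primrec S) (hD : Primrec D) (hV : Primrec V)
    (hM : Primrec M) (hf : Primrec f) (hp : Primrec p) (hG : Primrec G) :
    Primrec fun x => Synth.bitProgram (S x) (D x) (V x) (M x) (f x) (p x) (G x) := by
  unfold Synth.bitProgram TL.pipe; fun_prop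

@[fun_prop] theorem synth_circuitCode {S D : α → List EnvBits} {V : α → List Bits} {p : α → TL ℕ}
    {G : α → List (ℕ × Bits)} {a b ng : α → ℕ} (hS : Primrec S) (hD : Primrec D) (hV : Primrec V)
    (ha : Primrec a) (hb : Primrec b) (hp : Primrec p) (hG : Primrec G) (hng : Primrec ng) :
    Primrec fun x => Synth.circuitCode (S x) (D x) (V x) (a x) (b x) (p x) (G x) (ng x) := by
  unfold Synth.circuitCode; fun_prop

@[fun_prop] theorem synth_garbageBits {G : α → List ℕ} (hG : Primrec G) :
    Primrec fun x => Synth.garbageBits (G x) := by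
  unfold Synth.garbageBits; fun_prop

end Primrec
end

/-- The contexts (as lists of type codes) and the type code of the conclusion of a derivation. -/
abbrev Concl : Type := List ℕ × List ℕ × ℕ

/-- The conclusion of the derivation of a pure expression with code `n`. -/
def pureEConcl (n : ℕ) : Concl :=
  [(ctxTys ((kids n).getD 0 0), [], node 1 []),
    (ctxTys ((kids n).getD 0 0) ++ (kids n).getD 2 0 :: ctxTys ((kids n).getD 3 0), [],
      (kids n).getD 2 0),
    (ctxTys ((kids n).getD 0 0), [(kids n).getD 2 0], (kids n).getD 2 0),
    (ctxTys ((kids n).getD 0 0), ctxTys ((kids n).getD 1 0) ++ ctxTys ((kids n).getD 2 0) ++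
      ctxTys ((kids n).getD 3 0), node 3 [(kids n).getD 6 0, (kids n).getD 7 0]),
    (ctxTys ((kids n).getD 0 0) ++ ctxTys ((kids n).getD 1 0),
      ctxTys ((kids n).getD 2 0) ++ ctxTys ((kids n).getD 3 0), (kids n).getD 6 0),
    (ctxTys ((kids n).getD 0 0), ctxTys ((kids n).getD 1 0), (kids n).getD 5 0),
    (ctxTys ((kids n).getD 1 0), ctxTys ((kids n).getD 3 0), (kids n).getD 5 0)].getD
      (tagOf n) ([], [], 0)

/-- The conclusion of the derivation of a mixed expression with code `n`. -/
def mixedEConcl (n : ℕ) : Concl :=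
  [([], ctxTys ((kids n).getD 0 0), (kids n).getD 2 0),
    ([], ctxTys ((kids n).getD 1 0), (kids n).getD 3 0),
    ([], ctxTys ((kids n).getD 0 0) ++ ctxTys ((kids n).getD 1 0) ++ ctxTys ((kids n).getD 2 0),
      node 3 [(kids n).getD 5 0, (kids n).getD 6 0]),
    ([], ctxTys ((kids n).getD 0 0) ++ ctxTys ((kids n).getD 1 0), (kids n).getD 4 0),
    ([], ctxTys ((kids n).getD 0 0), (kids n).getD 4 0)].getD (tagOf n) ([], [], 0)

/-- The conclusion of the derivation of a pure program with code `n`; the input type takes the place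
of a quantum context with one variable. -/
def purePConcl (n : ℕ) : Concl :=
  [([], [node 2 [node 1 [], node 1 []]], node 2 [node 1 [], node 1 []]),
    ([], [(kids n).getD 0 0], node 2 [(kids n).getD 0 0, (kids n).getD 1 0]),
    ([], [(kids n).getD 1 0], node 2 [(kids n).getD 0 0, (kids n).getD 1 0]),
    ([], [(kids n).getD 3 0], (kids n).getD 4 0),
    ([], [(kids n).getD 2 0], (kids n).getD 2 0)].getD (tagOf n) ([], [], 0)

/-- The conclusion of the derivation of a mixed program with code `n`. -/
def mixedPConcl (n : ℕ) : Concl :=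
  [([], [(kids n).getD 1 0], (kids n).getD 2 0),
    ([], [(kids n).getD 4 0], (kids n).getD 5 0)].getD (tagOf n) ([], [], 0)

/-- The number of bits for a list of types. -/
def tysSize (l : List ℕ) : ℕ := l.foldr (fun T n => (tyData T).1 + n) 0

/-- The circuit of an operator. -/
def pureCircuit (c : Concl) (p : TL ℕ) : ℕ :=
  Synth.circuitCode (envs c.1) (envs c.2.1) (tyVals c.2.2) (tysSize c.1 + tysSize c.2.1)
    (tysSize c.1 + (tyData c.2.2).1) p [(0, [])] 0

/-- The circuit of a superoperator. -/
def mixedCircuit (c : Concl) (p : TL ℕ × List ℕ) : ℕ :=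
  Synth.circuitCode (envs c.1) (envs c.2.1) (tyVals c.2.2) (tysSize c.1 + tysSize c.2.1)
    (tysSize c.1 + (tyData c.2.2).1) p.1 (Synth.garbageBits p.2) p.2.length

/-- The code of the circuit of the derivation with code `n`. -/
def compileDeriv (n : ℕ) : ℕ :=
  [pureCircuit (pureEConcl ((kids n).getD 0 0)) (compileCode ((kids n).getD 0 0)).1,
    mixedCircuit (mixedEConcl ((kids n).getD 0 0)) (compileCode ((kids n).getD 0 0)).2.1,
    pureCircuit (purePConcl ((kids n).getD 0 0)) (compileCode ((kids n).getD 0 0)).2.2.1,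
    mixedCircuit (mixedPConcl ((kids n).getD 0 0)) (compileCode ((kids n).getD 0 0)).2.2.2.1].getD
      (tagOf n) 0

section
variable {α : Type} [Primcodable α] {n : α → ℕ} {c : α → Concl}

namespace Primrec

@[fun_prop] theorem fp_pureEConcl (hn : Primrec n) : Primrec fun a => pureEConcl (n a) := by
  unfold pureEConcl; fun_prop

@[fun_prop] theorem fp_mixedEConcl (hn : Primrec n) : Primrec fun a => mixedEConcl (n a) := by
  unfold mixedEConcl; fun_prop

@[fun_prop] theorem fp_purePConcl (hn : Primrec n) : Primrec fun a => purePConcl (n a) := by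
  unfold purePConcl; fun_prop

@[fun_prop] theorem fp_mixedPConcl (hn : Primrec n) : Primrec fun a => mixedPConcl (n a) := by
  unfold mixedPConcl; fun_prop

@[fun_prop] theorem fp_tysSize {l : α → List ℕ} (hl : Primrec l) :
    Primrec fun a => tysSize (l a) := by
  unfold tysSize; fun_prop

@[fun_prop] theorem fp_pureCircuit {p : α → TL ℕ} (hc : Primrec c) (hp : Primrec p) :
    Primrec fun a => pureCircuit (c a) (p a) := by
  unfold pureCircuit; fun_prop

@[fun_prop] theorem fp_mixedCircuit {p : α → TL ℕ × List ℕ} (hc : Primrec c) (hp : Primrec p) :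
    Primrec fun a => mixedCircuit (c a) (p a) := by
  unfold mixedCircuit; fun_prop

end Primrec

theorem primrec_compileDeriv : Primrec compileDeriv := by
  unfold compileDeriv; fun_prop

end

/-! ### The operators of two-level programs -/

section
variable {R : Type}

theorem Angle.code_injective [Encodable R] : Function.Injective (Angle.code (R := R)) := by
  intro a
  induction a with
  | const r => intro b h; cases b <;> simp_all [Angle.code, node]
  | zero => intro b h; cases b <;> simp_all [Angle.code, node]
  | pi => intro b h; cases b <;> simp_all [Angle.code, node]
  | neg a ih =>
    intro b h
    cases b with
    | neg b => rw [ih (by simpa [Angle.code, node] using h)]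
    | _ => simp_all [Angle.code, node]

variable [Encodable R] (val : R → ℝ)

open Classical in
/-- The angle with the given code; `0` if there is none. -/
noncomputable def angleVal (n : ℕ) : ℝ :=
  if h : ∃ a : Angle R, a.code = n then h.choose.eval val else 0

theorem angleVal_code (a : Angle R) : angleVal val a.code = a.eval val := by
  have h : ∃ b : Angle R, b.code = a.code := ⟨a, rfl⟩
  rw [angleVal, dif_pos h, Angle.code_injective h.choose_spec]

@[simp] theorem angleVal_zero : angleVal val zeroCode = 0 := angleVal_code val .zero

@[simp] theorem angleVal_pi : angleVal val piCode = Real.pi := angleVal_code val .pi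

@[simp] theorem angleVal_const (r : R) : angleVal val (node 0 [encode r]) = val r :=
  angleVal_code val (.const r)

@[simp] theorem angleVal_neg (n : ℕ) : angleVal val (negCode n) = -angleVal val n := by
  by_cases h : ∃ a : Angle R, a.code = n
  · obtain ⟨a, rfl⟩ := h
    rw [angleVal_code]
    exact angleVal_code val (.neg a)
  · have h' : ¬ ∃ a : Angle R, a.code = negCode n := by
      rintro ⟨a, ha⟩
      cases a with
      | neg a => exact h ⟨a, by simpa [negCode] using (node_injective ha).2⟩
      | _ => simp [Angle.code, negCode, node] at ha
    rw [angleVal, angleVal, dif_neg h, dif_neg h', neg_zero]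

/-- The unitary of a single-qubit gate given by codes of parameters. -/
noncomputable def Params.mat (g : Params) : Matrix Bool Bool ℂ :=
  Complex.exp (Complex.I * angleVal val g.1) •
    u3Mat (angleVal val g.2.1) (angleVal val g.2.2.1) (angleVal val g.2.2.2)

theorem conj_exp_I_mul (x : ℝ) :
    (starRingEnd ℂ) (Complex.exp (Complex.I * x)) = Complex.exp (Complex.I * ((-x : ℝ) : ℂ)) := by
  rw [← Complex.exp_conj]; simp

theorem Params.mat_inv (g : Params) (x y : Bool) :
    g.inv.mat val x y = (starRingEnd ℂ) (g.mat val y x) := by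
  have h (z w : ℝ) : (starRingEnd ℂ) (Complex.exp (Complex.I * (z + w))) =
      Complex.exp (Complex.I * (((-w : ℝ) : ℂ) + ((-z : ℝ) : ℂ))) := by
    rw [← Complex.exp_conj]; congr 1; simp; ring
  cases x <;> cases y <;>
    simp only [Params.mat, Params.inv, u3Mat, angleVal_neg, Matrix.smul_apply, smul_eq_mul, map_mul,
      map_neg, conj_exp_I_mul, neg_div, h, Complex.conj_ofReal, Real.cos_neg, Real.sin_neg] <;>
    push_cast <;> ring

theorem Params.mat_inv_mul (g : Params) (x y : Bool) :
    g.inv.mat val x false * g.mat val false y + g.inv.mat val x true * g.mat val true y =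
      if x = y then 1 else 0 := by
  rw [Params.mat_inv, Params.mat_inv]
  have hE (z : ℝ) : (starRingEnd ℂ) (Complex.exp (Complex.I * z)) *
      Complex.exp (Complex.I * z) = 1 := by
    rw [conj_exp_I_mul, ← Complex.exp_add]; simp
  have h₁ := hE (angleVal val g.1)
  have h₂ := hE (angleVal val g.2.2.1)
  have h₃ := hE (angleVal val g.2.2.2)
  have h₀ : (Real.cos (angleVal val g.2.1 / 2) : ℂ) ^ 2 +
      (Real.sin (angleVal val g.2.1 / 2) : ℂ) ^ 2 = 1 := by
    exact_mod_cast Real.cos_sq_add_sin_sq _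
  cases x <;> cases y <;>
    simp only [Params.mat, u3Mat, Matrix.smul_apply, smul_eq_mul, map_mul, map_neg, mul_add,
      Complex.exp_add, Complex.conj_ofReal, if_true, reduceCtorEq, if_false] <;>
    generalize (starRingEnd ℂ) (Complex.exp (Complex.I * (angleVal val g.1 : ℂ))) = a' at * <;>
    generalize (starRingEnd ℂ) (Complex.exp (Complex.I * (angleVal val g.2.2.1 : ℂ))) = p' at * <;>
    generalize (starRingEnd ℂ) (Complex.exp (Complex.I * (angleVal val g.2.2.2 : ℂ))) = q' at * <;>
    generalize Complex.exp (Complex.I * (angleVal val g.1 : ℂ)) = a at * <;>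
    generalize Complex.exp (Complex.I * (angleVal val g.2.2.1 : ℂ)) = p at * <;>
    generalize Complex.exp (Complex.I * (angleVal val g.2.2.2 : ℂ)) = q at * <;>
    generalize (Real.cos (angleVal val g.2.1 / 2) : ℂ) = c at * <;>
    generalize (Real.sin (angleVal val g.2.1 / 2) : ℂ) = s at *
  · linear_combination (c ^ 2 + p' * p * s ^ 2) * h₁ + s ^ 2 * h₂ + h₀
  · linear_combination (-q * c * s + p' * p * q * s * c) * h₁ + q * s * c * h₂
  · linear_combination (-q' * c * s + p' * p * q' * s * c) * h₁ + q' * s * c * h₂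
  · linear_combination (q' * q * s ^ 2 + p' * p * q' * q * c ^ 2) * h₁ + q' * q * c ^ 2 * h₂ +
      (c ^ 2 + s ^ 2) * h₃ + h₀

theorem Params.mat_mul_inv (g : Params) (x y : Bool) :
    g.mat val x false * g.inv.mat val false y + g.mat val x true * g.inv.mat val true y =
      if x = y then 1 else 0 := by
  have h : g.inv.mat val * g.mat val = 1 := by
    ext i j
    simpa [Matrix.mul_apply, add_comm, Matrix.one_apply] using Params.mat_inv_mul val g i j
  have h' : (g.mat val * g.inv.mat val) x y = (1 : Matrix Bool Bool ℂ) x y := by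
    rw [mul_eq_one_comm.1 h]
  simpa [Matrix.mul_apply, add_comm, Matrix.one_apply] using h'

theorem Params.mat_xParams : Params.mat val xParams = fun x y => if x = y then 0 else 1 := by
  funext x y
  cases x <;> cases y <;> simp [Params.mat, xParams, u3Mat, Complex.exp_pi_mul_I, mul_comm Complex.I]

/-- All parameters of a gate are codes of angles. -/
def Params.Valid (R : Type) [Encodable R] (g : Params) : Prop :=
  (∃ a : Angle R, a.code = g.1) ∧ (∃ a : Angle R, a.code = g.2.1) ∧
    (∃ a : Angle R, a.code = g.2.2.1) ∧ ∃ a : Angle R, a.code = g.2.2.2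

theorem Params.valid_xParams : Params.Valid R xParams :=
  ⟨⟨.zero, rfl⟩, ⟨.pi, rfl⟩, ⟨.zero, rfl⟩, ⟨.pi, rfl⟩⟩

theorem Params.Valid.inv {g : Params} (h : g.Valid R) : g.inv.Valid R := by
  obtain ⟨⟨a, ha⟩, ⟨b, hb⟩, ⟨c, hc⟩, ⟨d, hd⟩⟩ := h
  exact ⟨⟨a.neg, by simp [Angle.code, Params.inv, negCode, ha]⟩,
    ⟨b.neg, by simp [Angle.code, Params.inv, negCode, hb]⟩,
    ⟨d.neg, by simp [Angle.code, Params.inv, negCode, hd]⟩,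
    ⟨c.neg, by simp [Angle.code, Params.inv, negCode, hc]⟩⟩

namespace TL
variable {K L : Type}

open Classical in
/-- The two-level unitary of one item of a program. -/
noncomputable def step (x : L × L × Params) : (L → ℂ) →ₗ[ℂ] (L → ℂ) where
  toFun ψ c :=
    if x.1 = x.2.1 then ψ c
    else if c = x.1 then x.2.2.mat val false false * ψ x.1 + x.2.2.mat val false true * ψ x.2.1
    else if c = x.2.1 then x.2.2.mat val true false * ψ x.1 + x.2.2.mat val true true * ψ x.2.1
    else ψ c
  map_add' ψ φ := by funext c; simp only [Pi.add_apply]; split_ifs <;> ring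
  map_smul' k ψ := by
    funext c; simp only [Pi.smul_apply, smul_eq_mul, RingHom.id_apply]; split_ifs <;> ring

/-- The operator of a two-level program. -/
noncomputable def run : TL L → (L → ℂ) →ₗ[ℂ] (L → ℂ)
  | [] => LinearMap.id
  | x :: p => (run p).comp (step val x)

open Classical in
/-- The basis state with label `a`. -/
noncomputable def ket (a : L) : L → ℂ := fun c => if c = a then 1 else 0

/-- The matrix entry `⟨b| p |a⟩`. -/
noncomputable def amp (p : TL L) (b a : L) : ℂ := run val p (ket a) b

@[simp] theorem ket_self (a : L) : ket a a = 1 := if_pos rfl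

theorem ket_ne {a b : L} (h : b ≠ a) : ket a b = 0 := if_neg h

@[simp] theorem run_nil (ψ : L → ℂ) : run val [] ψ = ψ := rfl

theorem run_cons (x : L × L × Params) (p : TL L) (ψ : L → ℂ) :
    run val (x :: p) ψ = run val p (step val x ψ) := rfl

theorem run_append (p q : TL L) (ψ : L → ℂ) : run val (p ++ q) ψ = run val q (run val p ψ) := by
  induction p generalizing ψ with
  | nil => rfl
  | cons x p ih => simp [run_cons, ih]

/-- `c` does not occur as a label in the program. -/
def Untouched (p : TL L) (c : L) : Prop := ∀ x ∈ p, c ≠ x.1 ∧ c ≠ x.2.1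

theorem run_untouched {p : TL L} {c : L} (h : Untouched p c) (ψ : L → ℂ) :
    run val p ψ c = ψ c := by
  induction p generalizing ψ with
  | nil => rfl
  | cons x p ih =>
    have hx := h x (by simp)
    rw [run_cons, ih fun y hy => h y (by simp [hy])]
    simp [step, hx.1, hx.2]

theorem run_eq_sum (p : TL L) (F : Finset L) (ψ : L → ℂ) (h : ∀ m ∉ F, ψ m = 0) (b : L) :
    run val p ψ b = ∑ m ∈ F, amp val p b m * ψ m := by
  have : ψ = ∑ m ∈ F, ψ m • ket m := by
    classical
    funext c
    simp only [Finset.sum_apply, Pi.smul_apply, smul_eq_mul, ket, mul_ite, mul_one, mul_zero,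
      Finset.sum_ite_eq]
    split_ifs with hc
    · rfl
    · exact h c hc
  conv_lhs => rw [this]
  simp [amp, mul_comm]

/-! #### Renaming -/

theorem step_comp {e : K → L} (he : Function.Injective e) (x : K × K × Params) (ψ : L → ℂ) :
    step val (e x.1, e x.2.1, x.2.2) ψ ∘ e = step val x (ψ ∘ e) := by
  classical
  funext c
  simp [step, he.eq_iff]

theorem run_relabel {e : K → L} (he : Function.Injective e) (p : TL K) (ψ : L → ℂ) (c : K) :
    run val (p.relabel e) ψ (e c) = run val p (ψ ∘ e) c := by
  induction p generalizing ψ with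
  | nil => rfl
  | cons x p ih => rw [run_cons, ← step_comp val he, ← ih]; rfl

theorem run_relabel_of_notMem {e : K → L} (p : TL K) (ψ : L → ℂ) {c : L}
    (h : c ∉ Set.range e) : run val (p.relabel e) ψ c = ψ c := by
  refine run_untouched val (fun x hx => ?_) ψ
  obtain ⟨y, -, rfl⟩ := List.mem_map.1 hx
  exact ⟨fun hc => h ⟨_, hc.symm⟩, fun hc => h ⟨_, hc.symm⟩⟩

theorem ket_comp {e : K → L} (he : Function.Injective e) (a : K) : ket (e a) ∘ e = ket a := by
  classical
  funext c; simp [ket, he.eq_iff]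

theorem amp_relabel {e : K → L} (he : Function.Injective e) (p : TL K) (b a : K) :
    amp val (p.relabel e) (e b) (e a) = amp val p b a := by
  rw [amp, run_relabel val he, ket_comp he, amp]

/-! #### Swaps -/

theorem step_swap {a b : L} (h : a ≠ b) (ψ : L → ℂ) :
    step val (a, b, xParams) ψ a = ψ b ∧ step val (a, b, xParams) ψ b = ψ a := by
  simp [step, h, h.symm, Params.mat_xParams]

theorem run_swaps_of_notMem {t : List (L × L)} {c : L} (h : ∀ x ∈ t, c ≠ x.1 ∧ c ≠ x.2)
    (ψ : L → ℂ) : run val (swaps t) ψ c = ψ c := by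
  refine run_untouched val (fun x hx => ?_) ψ
  obtain ⟨y, hy, rfl⟩ := List.mem_map.1 hx
  exact h y hy

theorem run_swaps {t : List (L × L)} (h₁ : (t.map Prod.fst).Nodup) (h₂ : (t.map Prod.snd).Nodup)
    (h : ∀ x ∈ t, ∀ y ∈ t, x.1 ≠ y.2) (ψ : L → ℂ) {x : L × L} (hx : x ∈ t) :
    run val (swaps t) ψ x.1 = ψ x.2 ∧ run val (swaps t) ψ x.2 = ψ x.1 := by
  induction t generalizing ψ with
  | nil => simp at hx
  | cons y t ih =>
    simp only [List.map_cons, List.nodup_cons, List.mem_map, not_exists, not_and] at h₁ h₂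
    change run val (swaps t) (step val (y.1, y.2, xParams) ψ) _ = _ ∧
      run val (swaps t) (step val (y.1, y.2, xParams) ψ) _ = _
    have hy := step_swap val (h y (by simp) y (by simp)) ψ
    rcases List.mem_cons.1 hx with rfl | hx'
    · rw [run_swaps_of_notMem, run_swaps_of_notMem]
      · exact hy
      · exact fun z hz => ⟨(h z (by simp [hz]) x (by simp)).symm, fun e => h₂.1 z hz e.symm⟩
      · exact fun z hz => ⟨fun e => h₁.1 z hz e.symm, h x (by simp) z (by simp [hz])⟩
    · have := ih h₁.2 h₂.2 (fun u hu v hv => h u (by simp [hu]) v (by simp [hv]))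
        (step val (y.1, y.2, xParams) ψ) hx'
      rw [this.1, this.2]
      have e₁ : x.1 ≠ y.1 := h₁.1 x hx'
      have e₂ : x.2 ≠ y.2 := h₂.1 x hx'
      have e₃ : x.1 ≠ y.2 := h x (by simp [hx']) y (by simp)
      have e₄ : x.2 ≠ y.1 := (h y (by simp) x (by simp [hx'])).symm
      simp [step, e₁, e₂, e₃, e₄]

/-! #### Inverses -/

theorem step_inv (x : L × L × Params) (ψ : L → ℂ) :
    step val (x.1, x.2.1, x.2.2.inv) (step val x ψ) = ψ := by
  have h (i j) := Params.mat_inv_mul val x.2.2 i j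
  have h₁ := h false false
  have h₂ := h false true
  have h₃ := h true false
  have h₄ := h true true
  simp only [if_true, reduceCtorEq, if_false] at h₁ h₂ h₃ h₄
  by_cases hx : x.1 = x.2.1
  · funext c; simp [step, hx]
  · funext c
    by_cases c₁ : c = x.1
    · subst c₁
      simp only [step, LinearMap.coe_mk, AddHom.coe_mk, if_neg hx, if_true, if_neg (Ne.symm hx)]
      linear_combination ψ x.1 * h₁ + ψ x.2.1 * h₂
    · by_cases c₂ : c = x.2.1
      · subst c₂
        simp only [step, LinearMap.coe_mk, AddHom.coe_mk, if_neg hx, if_true, if_neg (Ne.symm hx)]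
        linear_combination ψ x.1 * h₃ + ψ x.2.1 * h₄
      · simp [step, c₁, c₂]

theorem step_step_inv (x : L × L × Params) (ψ : L → ℂ) :
    step val x (step val (x.1, x.2.1, x.2.2.inv) ψ) = ψ := by
  have h (i j) := Params.mat_mul_inv val x.2.2 i j
  have h₁ := h false false
  have h₂ := h false true
  have h₃ := h true false
  have h₄ := h true true
  simp only [if_true, reduceCtorEq, if_false] at h₁ h₂ h₃ h₄
  by_cases hx : x.1 = x.2.1
  · funext c; simp [step, hx]
  · funext c
    by_cases c₁ : c = x.1
    · subst c₁
      simp only [step, LinearMap.coe_mk, AddHom.coe_mk, if_neg hx, if_true, if_neg (Ne.symm hx)]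
      linear_combination ψ x.1 * h₁ + ψ x.2.1 * h₂
    · by_cases c₂ : c = x.2.1
      · subst c₂
        simp only [step, LinearMap.coe_mk, AddHom.coe_mk, if_neg hx, if_true, if_neg (Ne.symm hx)]
        linear_combination ψ x.1 * h₃ + ψ x.2.1 * h₄
      · simp [step, c₁, c₂]

theorem inv_cons (x : L × L × Params) (p : TL L) :
    inv (x :: p) = inv p ++ [(x.1, x.2.1, x.2.2.inv)] := by simp [inv]

theorem run_inv_run (p : TL L) (ψ : L → ℂ) : run val p.inv (run val p ψ) = ψ := by
  induction p generalizing ψ with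
  | nil => rfl
  | cons x p ih => rw [inv_cons, run_append, run_cons, run_nil, run_cons, ih, step_inv]

open Classical in
theorem amp_cons (x : L × L × Params) (p : TL L) (b a : L) :
    amp val (x :: p) b a = if x.1 = x.2.1 then amp val p b a
      else if a = x.1 then amp val p b x.1 * x.2.2.mat val false false +
        amp val p b x.2.1 * x.2.2.mat val true false
      else if a = x.2.1 then amp val p b x.1 * x.2.2.mat val false true +
        amp val p b x.2.1 * x.2.2.mat val true true
      else amp val p b a := by
  have key : step val x (ket a) = if x.1 = x.2.1 then ket a
      else if a = x.1 then x.2.2.mat val false false • ket x.1 + x.2.2.mat val true false • ket x.2.1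
      else if a = x.2.1 then
        x.2.2.mat val false true • ket x.1 + x.2.2.mat val true true • ket x.2.1
      else ket a := by
    funext c
    by_cases hx : x.1 = x.2.1
    · simp [step, hx]
    · have hx' := Ne.symm hx
      simp only [step, LinearMap.coe_mk, AddHom.coe_mk, if_neg hx]
      by_cases h₁ : a = x.1
      · subst h₁
        by_cases c₁ : c = x.1
        · subst c₁; simp [ket, hx, hx']
        · by_cases c₂ : c = x.2.1
          · subst c₂; simp [ket, hx']
          · simp [ket, c₁, c₂]
      · by_cases h₂ : a = x.2.1
        · subst h₂
          by_cases c₁ : c = x.1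
          · subst c₁; simp [ket, hx, hx']
          · by_cases c₂ : c = x.2.1
            · subst c₂; simp [ket, hx, hx']
            · simp [ket, hx', c₁, c₂]
        · by_cases c₁ : c = x.1
          · subst c₁; simp [ket, h₁, h₂, Ne.symm h₁, Ne.symm h₂]
          · by_cases c₂ : c = x.2.1
            · subst c₂; simp [ket, h₁, h₂, Ne.symm h₁, Ne.symm h₂]
            · simp [h₁, h₂, c₁, c₂]
  rw [amp, run_cons, key]
  split_ifs <;> simp [amp, mul_comm]

theorem amp_inv (p : TL L) (b a : L) :
    amp val p.inv b a = (starRingEnd ℂ) (amp val p a b) := by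
  induction p generalizing b with
  | nil =>
    simp only [inv, List.map_nil, List.reverse_nil, amp, run_nil, ket]
    by_cases h : b = a
    · simp [h]
    · simp [h, Ne.symm h]
  | cons x p ih =>
    have e : amp val (inv (x :: p)) b a =
        step val (x.1, x.2.1, x.2.2.inv) (fun c => amp val (inv p) c a) b := by
      rw [amp, inv_cons, run_append]; rfl
    rw [e, amp_cons]
    simp only [step, LinearMap.coe_mk, AddHom.coe_mk, ih, Params.mat_inv]
    split_ifs <;> simp [mul_comm]

theorem run_run_inv (p : TL L) (ψ : L → ℂ) : run val p (run val p.inv ψ) = ψ := by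
  induction p generalizing ψ with
  | nil => rfl
  | cons x p ih =>
    rw [inv_cons, run_append, run_cons, run_cons, run_nil, step_step_inv, ih]

end TL
end

/-! ### Matrix entries of combined programs -/

section
variable {R : Type} [Encodable R] (val : R → ℝ)

namespace TL
variable {K L : Type}

theorem amp_pipe {e : K → L} (he : Function.Injective e) {tin : List (L × K)} {q : TL K}
    {tout : List (K × L)} (h₁ : (tin.map Prod.fst).Nodup) (h₂ : (tin.map Prod.snd).Nodup)
    (h₃ : (tout.map Prod.fst).Nodup) (h₄ : (tout.map Prod.snd).Nodup)
    (h₅ : ∀ x ∈ tin, x.1 ∉ Set.range e) (h₆ : ∀ x ∈ tout, x.2 ∉ Set.range e) :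
    (∀ x ∈ tin, ∀ y ∈ tout, amp val (pipe e tin q tout) y.2 x.1 = amp val q y.1 x.2) ∧
    (∀ x ∈ tin, ∀ b, b ∉ tout.map Prod.snd → b ∉ Set.range e →
      amp val (pipe e tin q tout) b x.1 = 0) ∧
    (∀ a, a ∉ tin.map Prod.fst → a ∉ Set.range e → ∀ y ∈ tout,
      amp val (pipe e tin q tout) y.2 a = 0) ∧
    (∀ a, a ∉ tin.map Prod.fst → a ∉ Set.range e → ∀ b, b ∉ tout.map Prod.snd → b ∉ Set.range e →
      b ≠ a → amp val (pipe e tin q tout) b a = 0) := by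
  classical
  set sin : TL L := swaps (tin.map fun x => (x.1, e x.2)) with hsin
  set sout : TL L := swaps (tout.map fun x => (e x.1, x.2)) with hsout
  have amp_eq (b a : L) : amp val (pipe e tin q tout) b a =
      run val sout (run val (q.relabel e) (run val sin (ket a))) b := by
    rw [amp, pipe, run_append, run_append]
  have swap_in (ψ : L → ℂ) (x) (hx : x ∈ tin) :
      run val sin ψ x.1 = ψ (e x.2) ∧ run val sin ψ (e x.2) = ψ x.1 := by
    refine run_swaps val ?_ ?_ ?_ ψ (List.mem_map_of_mem (f := fun x => (x.1, e x.2)) hx)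
    · simpa [List.map_map, Function.comp_def] using h₁
    · have := h₂.map he
      simpa [List.map_map, Function.comp_def] using this
    · simp only [List.mem_map, forall_exists_index, and_imp, forall_apply_eq_imp_iff₂]
      exact fun y hy z _ h => h₅ y hy ⟨_, h.symm⟩
  have swap_out (ψ : L → ℂ) (y) (hy : y ∈ tout) :
      run val sout ψ (e y.1) = ψ y.2 ∧ run val sout ψ y.2 = ψ (e y.1) := by
    refine run_swaps val ?_ ?_ ?_ ψ (List.mem_map_of_mem (f := fun x => (e x.1, x.2)) hy)
    · have := h₃.map he
      simpa [List.map_map, Function.comp_def] using this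
    · simpa [List.map_map, Function.comp_def] using h₄
    · simp only [List.mem_map, forall_exists_index, and_imp, forall_apply_eq_imp_iff₂]
      exact fun y _ z hz h => h₆ z hz ⟨_, h⟩
  have stay_in (ψ : L → ℂ) (c) (hc : c ∉ tin.map Prod.fst) (hc' : c ∉ Set.range e) :
      run val sin ψ c = ψ c := by
    refine run_swaps_of_notMem val ?_ ψ
    simp only [List.mem_map, forall_exists_index, and_imp, forall_apply_eq_imp_iff₂]
    exact fun y hy => ⟨fun h => hc (h ▸ List.mem_map_of_mem hy), fun h => hc' ⟨_, h.symm⟩⟩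
  have stay_out (ψ : L → ℂ) (c) (hc : c ∉ tout.map Prod.snd) (hc' : c ∉ Set.range e) :
      run val sout ψ c = ψ c := by
    refine run_swaps_of_notMem val ?_ ψ
    simp only [List.mem_map, forall_exists_index, and_imp, forall_apply_eq_imp_iff₂]
    exact fun y hy => ⟨fun h => hc' ⟨_, h.symm⟩, fun h => hc (h ▸ List.mem_map_of_mem hy)⟩
  -- the input is transferred to its internal label, and nothing is left outside of these labels
  have in_ket (x) (hx : x ∈ tin) : run val sin (ket x.1) = ket (e x.2) := by
    funext c
    by_cases hc : c ∈ tin.map Prod.fst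
    · obtain ⟨y, hy, rfl⟩ := List.mem_map.1 hc
      rw [(swap_in _ y hy).1, ket_ne (fun h => h₅ x hx ⟨_, h⟩), ket_ne (fun h => h₅ y hy ⟨_, h.symm⟩)]
    · by_cases hc' : c ∈ Set.range e
      · obtain ⟨k, rfl⟩ := hc'
        by_cases hk : k ∈ tin.map Prod.snd
        · obtain ⟨y, hy, rfl⟩ := List.mem_map.1 hk
          rw [(swap_in _ y hy).2]
          by_cases hyx : y.2 = x.2
          · rw [List.inj_on_of_nodup_map h₂ hy hx hyx]; simp
          · rw [ket_ne (fun h => hyx ?_), ket_ne (he.ne hyx)]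
            rw [List.inj_on_of_nodup_map h₁ hy hx h]
        · rw [run_swaps_of_notMem]
          · rw [ket_ne (fun h => h₅ x hx ⟨_, h⟩), ket_ne]
            exact he.ne fun h => hk (h ▸ List.mem_map_of_mem hx)
          · simp only [List.mem_map, forall_exists_index, and_imp, forall_apply_eq_imp_iff₂]
            exact fun y hy => ⟨fun h => h₅ y hy ⟨_, h⟩,
              fun h => hk (he h ▸ List.mem_map_of_mem hy)⟩
      · rw [stay_in _ c hc hc', ket_ne (fun h => hc (List.mem_map.2 ⟨x, hx, h.symm⟩)),
          ket_ne (fun h => hc' ⟨_, h.symm⟩)]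
  have in_stay (a) (ha : a ∉ tin.map Prod.fst) (ha' : a ∉ Set.range e) :
      run val sin (ket a) = ket a := by
    funext c
    by_cases hc : c ∈ tin.map Prod.fst
    · obtain ⟨y, hy, rfl⟩ := List.mem_map.1 hc
      rw [(swap_in _ y hy).1, ket_ne (fun h => ha' ⟨_, h⟩), ket_ne (fun h => ha (List.mem_map.2 ⟨y, hy, h⟩))]
    · by_cases hc' : c ∈ Set.range e
      · obtain ⟨k, rfl⟩ := hc'
        by_cases hk : k ∈ tin.map Prod.snd
        · obtain ⟨y, hy, rfl⟩ := List.mem_map.1 hk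
          rw [(swap_in _ y hy).2, ket_ne (fun h => ha (List.mem_map.2 ⟨y, hy, h⟩)),
            ket_ne (fun h => ha' ⟨_, h⟩)]
        · rw [run_swaps_of_notMem]
          simp only [List.mem_map, forall_exists_index, and_imp, forall_apply_eq_imp_iff₂]
          exact fun y hy => ⟨fun h => h₅ y hy ⟨_, h⟩, fun h => hk (he h ▸ List.mem_map_of_mem hy)⟩
      · rw [stay_in _ c hc hc']
  have zero_comp (a) (ha' : a ∉ Set.range e) : (ket a : L → ℂ) ∘ e = 0 := by
    funext k; exact ket_ne fun h => ha' ⟨_, h⟩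
  refine ⟨fun x hx y hy => ?_, fun x hx b hb hb' => ?_, fun a ha ha' y hy => ?_,
    fun a ha ha' b hb hb' hba => ?_⟩
  · rw [amp_eq, (swap_out _ y hy).2, in_ket x hx, run_relabel val he, ket_comp he, amp]
  · rw [amp_eq, stay_out _ b hb hb', in_ket x hx, run_relabel_of_notMem val q _ hb',
      ket_ne fun h => hb' ⟨_, h.symm⟩]
  · rw [amp_eq, (swap_out _ y hy).2, in_stay a ha ha', run_relabel val he, zero_comp a ha', map_zero]
    rfl
  · rw [amp_eq, stay_out _ b hb hb', in_stay a ha ha', run_relabel_of_notMem val q _ hb',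
      ket_ne hba]

theorem pair_injective (k : ℕ) : Function.Injective (Nat.pair k) := fun _ _ h =>
  (Nat.pair_eq_pair.1 h).2

theorem pair_notMem_range {j k : ℕ} (h : j ≠ k) (a : ℕ) : Nat.pair j a ∉ Set.range (Nat.pair k) := by
  rintro ⟨b, hb⟩
  exact h (Nat.pair_eq_pair.1 hb).1.symm

/-- A table without repetitions among the first and among the second components. -/
def Table (t : List (ℕ × ℕ)) : Prop := (t.map Prod.fst).Nodup ∧ (t.map Prod.snd).Nodup

theorem table_map {ι : Type} {l : List ι} (hl : l.Nodup) {f : ι → ℕ × ℕ}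
    (h₁ : Function.Injective fun i => (f i).1) (h₂ : Function.Injective fun i => (f i).2) :
    Table (l.map f) := by
  rw [Table, List.map_map, List.map_map]
  exact ⟨hl.map h₁, hl.map h₂⟩

section wrap
variable {tin tout : List (ℕ × ℕ)} (hin : Table tin) (hout : Table tout) (q : TL ℕ)
include hin hout

theorem amp_wrap_aux :
    (∀ x ∈ tin, ∀ y ∈ tout, amp val (wrap tin q tout) (Nat.pair 1 y.2) (Nat.pair 0 x.1) =
      amp val q y.1 x.2) ∧
    (∀ a b, (a ∉ tin.map Prod.fst ∨ b ∉ tout.map Prod.snd) →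
      amp val (wrap tin q tout) (Nat.pair 1 b) (Nat.pair 0 a) = 0) := by
  have H := amp_pipe val (pair_injective 2) (tin := tin.map fun x => (Nat.pair 0 x.1, x.2)) (q := q)
    (tout := tout.map fun x => (x.1, Nat.pair 1 x.2))
    (by simpa [List.map_map, Function.comp_def] using hin.1.map (pair_injective 0))
    (by simpa [List.map_map, Function.comp_def] using hin.2)
    (by simpa [List.map_map, Function.comp_def] using hout.1)
    (by simpa [List.map_map, Function.comp_def] using hout.2.map (pair_injective 1))
    (by
      simp only [List.mem_map, forall_exists_index, and_imp, forall_apply_eq_imp_iff₂]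
      exact fun x _ => pair_notMem_range (by decide) _)
    (by
      simp only [List.mem_map, forall_exists_index, and_imp, forall_apply_eq_imp_iff₂]
      exact fun x _ => pair_notMem_range (by decide) _)
  have ha (a) : Nat.pair 0 a ∈ (tin.map fun x => (Nat.pair 0 x.1, x.2)).map Prod.fst ↔
      a ∈ tin.map Prod.fst := by
    simp [Nat.pair_eq_pair]
  have hb (b) : Nat.pair 1 b ∈ (tout.map fun x => (x.1, Nat.pair 1 x.2)).map Prod.snd ↔
      b ∈ tout.map Prod.snd := by
    simp [Nat.pair_eq_pair]
  have n0 (a) : Nat.pair 0 a ∉ Set.range (Nat.pair 2) := pair_notMem_range (by decide) _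
  have n1 (a) : Nat.pair 1 a ∉ Set.range (Nat.pair 2) := pair_notMem_range (by decide) _
  refine ⟨fun x hx y hy => H.1 _ (List.mem_map_of_mem hx) _ (List.mem_map_of_mem hy),
    fun a b hab => ?_⟩
  by_cases h : a ∈ tin.map Prod.fst
  · obtain ⟨x, hx, rfl⟩ := List.mem_map.1 h
    refine H.2.1 _ (List.mem_map_of_mem hx) _ ?_ (n1 _)
    rw [hb]
    exact hab.resolve_left (not_not.2 h)
  · by_cases h' : b ∈ tout.map Prod.snd
    · obtain ⟨y, hy, rfl⟩ := List.mem_map.1 h'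
      exact H.2.2.1 _ (by rwa [ha]) (n0 _) _ (List.mem_map_of_mem hy)
    · refine H.2.2.2 _ (by rwa [ha]) (n0 _) _ (by rwa [hb]) (n1 _) ?_
      simp [Nat.pair_eq_pair]

theorem amp_wrap {a b k k' : ℕ} (h : (a, k) ∈ tin) (h' : (k', b) ∈ tout) :
    amp val (wrap tin q tout) (Nat.pair 1 b) (Nat.pair 0 a) = amp val q k' k :=
  (amp_wrap_aux val hin hout q).1 _ h _ h'

theorem amp_wrap_of_notMem {a b : ℕ} (h : a ∉ tin.map Prod.fst ∨ b ∉ tout.map Prod.snd) :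
    amp val (wrap tin q tout) (Nat.pair 1 b) (Nat.pair 0 a) = 0 :=
  (amp_wrap_aux val hin hout q).2 a b h

end wrap

theorem run_swaps_join {t : List (ℕ × ℕ)} (ht : Table t) (ψ : ℕ → ℂ) :
    (∀ x ∈ t, run val (swaps (t.map fun x => (Nat.pair 0 x.1, Nat.pair 1 x.2))) ψ
      (Nat.pair 1 x.2) = ψ (Nat.pair 0 x.1)) ∧
    (∀ c ∉ t.map Prod.fst, run val (swaps (t.map fun x => (Nat.pair 0 x.1, Nat.pair 1 x.2))) ψ
      (Nat.pair 0 c) = ψ (Nat.pair 0 c)) ∧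
    (∀ c ∉ t.map Prod.snd, run val (swaps (t.map fun x => (Nat.pair 0 x.1, Nat.pair 1 x.2))) ψ
      (Nat.pair 1 c) = ψ (Nat.pair 1 c)) := by
  refine ⟨fun x hx => ?_, fun c hc => run_swaps_of_notMem val ?_ ψ,
    fun c hc => run_swaps_of_notMem val ?_ ψ⟩
  · refine (run_swaps val ?_ ?_ ?_ ψ
      (List.mem_map_of_mem (f := fun x : ℕ × ℕ => (Nat.pair 0 x.1, Nat.pair 1 x.2)) hx)).2
    · simpa [List.map_map, Function.comp_def] using ht.1.map (pair_injective 0)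
    · simpa [List.map_map, Function.comp_def] using ht.2.map (pair_injective 1)
    · simp only [List.mem_map, forall_exists_index, and_imp, forall_apply_eq_imp_iff₂, ne_eq,
        Nat.pair_eq_pair]
      simp
  · simp only [List.mem_map, forall_exists_index, and_imp, forall_apply_eq_imp_iff₂,
      ne_eq, Nat.pair_eq_pair]
    exact fun x hx => ⟨fun h => hc (h.2 ▸ List.mem_map_of_mem hx), by simp⟩
  · simp only [List.mem_map, forall_exists_index, and_imp, forall_apply_eq_imp_iff₂,
      ne_eq, Nat.pair_eq_pair]
    exact fun x hx => ⟨by simp, fun h => hc (h.2 ▸ List.mem_map_of_mem hx)⟩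

/-- The amplitude of two successive programs is a sum over the entries of the table between them. -/
theorem amp_join {t : List (ℕ × ℕ)} (ht : Table t) (p q : TL ℕ) (c a : ℕ) :
    amp val (join p t q) (Nat.pair 1 c) (Nat.pair 0 a) =
      (t.map fun x => amp val q c x.2 * amp val p x.1 a).sum := by
  rw [amp, join, run_append, run_append, run_relabel val (pair_injective 1)]
  set χ := run val (p.relabel (Nat.pair 0)) (ket (Nat.pair 0 a)) with hχ
  have h0 (m) : χ (Nat.pair 0 m) = amp val p m a := by
    rw [hχ, ← amp, amp_relabel val (pair_injective 0)]
  have h1 (m) : χ (Nat.pair 1 m) = 0 := by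
    rw [hχ, run_relabel_of_notMem val p _ (pair_notMem_range (by decide) _), ket_ne]
    simp [Nat.pair_eq_pair]
  have H := run_swaps_join val ht χ
  have key : run val (swaps (t.map fun x => (Nat.pair 0 x.1, Nat.pair 1 x.2))) χ ∘ Nat.pair 1 =
      (t.map fun x => amp val p x.1 a • (ket x.2 : ℕ → ℂ)).sum := by
    have aux (l : List (ℕ × ℕ)) (hl : (l.map Prod.snd).Nodup) (m : ℕ) :
        (∀ x ∈ l, m = x.2 → (l.map fun x => amp val p x.1 a • (ket x.2 : ℕ → ℂ)).sum m =
          amp val p x.1 a) ∧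
        (m ∉ l.map Prod.snd → (l.map fun x => amp val p x.1 a • (ket x.2 : ℕ → ℂ)).sum m = 0) := by
      induction l with
      | nil => simp
      | cons y l ih =>
        rw [List.map_cons, List.nodup_cons] at hl
        simp only [List.map_cons, List.sum_cons, Pi.add_apply, Pi.smul_apply, smul_eq_mul]
        refine ⟨fun x hx hm => ?_, fun hm => ?_⟩
        · subst hm
          rcases List.mem_cons.1 hx with rfl | hx
          · rw [(ih hl.2).2 hl.1]; simp
          · rw [(ih hl.2).1 x hx rfl, ket_ne, mul_zero, zero_add]
            exact fun h => hl.1 (h ▸ List.mem_map_of_mem hx)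
        · simp only [List.mem_cons, not_or] at hm
          rw [(ih hl.2).2 hm.2, ket_ne hm.1]; simp
    funext m
    by_cases hm : m ∈ t.map Prod.snd
    · obtain ⟨x, hx, rfl⟩ := List.mem_map.1 hm
      rw [(aux t ht.2 x.2).1 x hx rfl, Function.comp_apply, H.1 x hx, h0]
    · rw [(aux t ht.2 m).2 hm, Function.comp_apply, H.2.2 m hm, h1]
  rw [key, map_list_sum, List.map_map]
  have (l : List (ℕ × ℕ)) : (l.map ((run val q) ∘ fun x => amp val p x.1 a • ket x.2)).sum c =
      (l.map fun x => amp val q c x.2 * amp val p x.1 a).sum := by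
    induction l with
    | nil => rfl
    | cons x l ih =>
      rw [List.map_cons, List.sum_cons, Pi.add_apply, ih, List.map_cons, List.sum_cons,
        Function.comp_apply, map_smul, Pi.smul_apply, smul_eq_mul, mul_comm]
      rfl
  exact this t

/-- Amplitude on labels of the first program that are not transferred stays there. -/
theorem amp_join_left {t : List (ℕ × ℕ)} (ht : Table t) (p q : TL ℕ) {c : ℕ}
    (hc : c ∉ t.map Prod.fst) (a : ℕ) :
    amp val (join p t q) (Nat.pair 0 c) (Nat.pair 0 a) = amp val p c a := by
  rw [amp, join, run_append, run_append, run_relabel_of_notMem val q _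
    (pair_notMem_range (by decide) _), (run_swaps_join val ht _).2.1 c hc, ← amp,
    amp_relabel val (pair_injective 0)]

theorem run_fam_of_notMem {l : List (ℕ × TL ℕ)} {k : ℕ} (h : k ∉ l.map Prod.fst) (ψ : ℕ → ℂ)
    (c : ℕ) : run val (fam l) ψ (Nat.pair k c) = ψ (Nat.pair k c) := by
  refine run_untouched val (fun x hx => ?_) ψ
  obtain ⟨y, hy, hx⟩ := List.mem_flatMap.1 hx
  obtain ⟨z, -, rfl⟩ := List.mem_map.1 hx
  simp only [ne_eq, Nat.pair_eq_pair]
  exact ⟨fun e => h (e.1 ▸ List.mem_map_of_mem hy), fun e => h (e.1 ▸ List.mem_map_of_mem hy)⟩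

theorem run_fam {l : List (ℕ × TL ℕ)} (hl : (l.map Prod.fst).Nodup) {k : ℕ} {p : TL ℕ}
    (h : (k, p) ∈ l) (ψ : ℕ → ℂ) (c : ℕ) :
    run val (fam l) ψ (Nat.pair k c) = run val p (ψ ∘ Nat.pair k) c := by
  induction l generalizing ψ with
  | nil => simp at h
  | cons y l ih =>
    rw [List.map_cons, List.nodup_cons] at hl
    change run val (y.2.relabel (Nat.pair y.1) ++ fam l) ψ _ = _
    rw [run_append]
    rcases List.mem_cons.1 h with rfl | h
    · rw [run_fam_of_notMem val hl.1, run_relabel val (pair_injective k)]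
    · rw [ih hl.2 h]
      have : run val (y.2.relabel (Nat.pair y.1)) ψ ∘ Nat.pair k = ψ ∘ Nat.pair k := by
        funext m
        refine run_relabel_of_notMem val _ _ (pair_notMem_range (fun e => hl.1 ?_) _)
        exact e ▸ List.mem_map_of_mem h
      rw [this]

theorem amp_fam {l : List (ℕ × TL ℕ)} (hl : (l.map Prod.fst).Nodup) {k : ℕ} {p : TL ℕ}
    (h : (k, p) ∈ l) (c a : ℕ) :
    amp val (fam l) (Nat.pair k c) (Nat.pair k a) = amp val p c a := by
  rw [amp, run_fam val hl h, ket_comp (pair_injective k), amp]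

theorem amp_fam_ne {l : List (ℕ × TL ℕ)} (hl : (l.map Prod.fst).Nodup) {k k' : ℕ} (h : k' ≠ k)
    (c a : ℕ) : amp val (fam l) (Nat.pair k' c) (Nat.pair k a) = 0 := by
  have h0 : (ket (Nat.pair k a) : ℕ → ℂ) ∘ Nat.pair k' = 0 := by
    funext m; exact ket_ne fun e => h (Nat.pair_eq_pair.1 e).1
  by_cases hk : k' ∈ l.map Prod.fst
  · obtain ⟨y, hy, rfl⟩ := List.mem_map.1 hk
    rw [amp, run_fam val hl (p := y.2) (by simpa using hy), h0, map_zero]; rfl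
  · rw [amp, run_fam_of_notMem val hk]
    exact congrFun h0 c

theorem amp_nil (b a : L) : amp val [] b a = ket a b := rfl

open Classical in
theorem run_phase (r : ℕ) {l : List ℕ} (hl : l.Nodup) (ψ : ℕ → ℂ) (c : ℕ) :
    run val (phase r l) ψ c =
      if c ∈ l then Complex.exp (Complex.I * angleVal val r) * ψ c else ψ c := by
  induction l generalizing ψ with
  | nil => rfl
  | cons y l ih =>
    rw [List.nodup_cons] at hl
    change run val (phase r l) (step val (y + 1, y, _) ψ) c = _
    rw [ih hl.2]
    have hs : step val (y + 1, y, (zeroCode, zeroCode, r, zeroCode)) ψ c =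
        if c = y then Complex.exp (Complex.I * angleVal val r) * ψ c else ψ c := by
      by_cases h₁ : c = y
      · subst h₁; simp [step, Params.mat, u3Mat]
      · by_cases h₂ : c = y + 1
        · subst h₂; simp [step, Params.mat, u3Mat]
        · simp [step, h₁, h₂]
    rw [hs]
    by_cases h₁ : c = y
    · subst h₁; simp [hl.1]
    · simp [h₁]

/-- The columns of the operator of a program have norm one. -/
theorem sum_conj_amp_mul_amp (p : TL L) (F : Finset L) (a a' : L)
    (hF : ∀ m ∉ F, amp val p m a = 0) :
    ∑ m ∈ F, (starRingEnd ℂ) (amp val p m a') * amp val p m a = ket a a' := by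
  have h := congrFun (run_inv_run val p (ket a)) a'
  rw [run_eq_sum val (inv p) F (run val p (ket a)) hF] at h
  rw [← h]
  exact Finset.sum_congr rfl fun m _ => by rw [amp_inv]; rfl

/-- All gates of a program have parameters that are codes of angles. -/
def Valid (R : Type) [Encodable R] (p : TL L) : Prop := ∀ x ∈ p, x.2.2.Valid R

theorem Valid.relabel {p : TL K} (h : p.Valid R) (e : K → L) : (p.relabel e).Valid R := by
  intro x hx
  obtain ⟨y, hy, rfl⟩ := List.mem_map.1 hx
  exact h y hy

theorem Valid.append {p q : TL L} (h : p.Valid R) (h' : q.Valid R) : Valid R (p ++ q) := by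
  intro x hx
  rcases List.mem_append.1 hx with hx | hx
  exacts [h x hx, h' x hx]

theorem Valid.inv {p : TL L} (h : p.Valid R) : p.inv.Valid R := by
  intro x hx
  obtain ⟨y, hy, rfl⟩ := List.mem_map.1 (List.mem_reverse.1 hx)
  exact (h y hy).inv

theorem valid_nil : Valid R ([] : TL L) := fun x hx => by simp at hx

theorem valid_swaps (t : List (L × L)) : Valid R (swaps t) := by
  intro x hx
  obtain ⟨y, -, rfl⟩ := List.mem_map.1 hx
  exact Params.valid_xParams

theorem valid_phase {r : ℕ} (hr : ∃ a : Angle R, a.code = r) (l : List ℕ) :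
    Valid R (phase r l) := by
  intro x hx
  obtain ⟨y, -, rfl⟩ := List.mem_map.1 hx
  exact ⟨⟨.zero, rfl⟩, ⟨.zero, rfl⟩, hr, ⟨.zero, rfl⟩⟩

theorem Valid.pipe {q : TL K} (h : q.Valid R) (e : K → L) (tin : List (L × K))
    (tout : List (K × L)) : (pipe e tin q tout).Valid R :=
  ((valid_swaps _).append (h.relabel e)).append (valid_swaps _)

theorem Valid.wrap {q : TL ℕ} (h : q.Valid R) (tin tout : List (ℕ × ℕ)) :
    (wrap tin q tout).Valid R := h.pipe _ _ _

theorem Valid.join {p q : TL ℕ} (h : p.Valid R) (h' : q.Valid R) (t : List (ℕ × ℕ)) :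
    (join p t q).Valid R :=
  ((h.relabel _).append (valid_swaps _)).append (h'.relabel _)

theorem valid_fam {l : List (ℕ × TL ℕ)} (h : ∀ x ∈ l, x.2.Valid R) : (fam l).Valid R := by
  intro x hx
  obtain ⟨y, hy, hx⟩ := List.mem_flatMap.1 hx
  exact (h y hy).relabel _ x hx

end TL
end

/-! ### Enumerations of values and valuations -/

section lists
variable {α β γ δ ι κ : Type}

theorem List.product_map_map (f : α → γ) (g : β → δ) (l : List α) (l' : List β) :
    (l.map f) ×ˢ (l'.map g) = (l ×ˢ l').map fun x => (f x.1, g x.2) := by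
  induction l with
  | nil => rfl
  | cons a l ih =>
    rw [List.map_cons, List.product_cons, List.product_cons, List.map_append, ih]
    simp [Function.comp_def]

theorem List.sum_map_eq_sum_univ [Fintype ι] {l : List ι} (hl : l.Nodup) (h : ∀ i, i ∈ l)
    (f : ι → ℂ) : (l.map f).sum = ∑ i, f i := by
  classical
  rw [← List.sum_toFinset f hl]
  congr 1
  ext i; simp [h]

/-- A sum reduces to the indices on which the summand can be nonzero. -/
theorem List.sum_map_reindex {l : List ι} {l' : List κ} (hl : l.Nodup) (hl' : l'.Nodup)
    (e : κ → ι) (he : Function.Injective e) (h : ∀ k ∈ l', e k ∈ l) (f : ι → ℂ)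
    (hf : ∀ i ∈ l, (∀ k ∈ l', e k ≠ i) → f i = 0) :
    (l.map f).sum = (l'.map fun k => f (e k)).sum := by
  classical
  rw [← List.sum_toFinset f hl, ← List.sum_toFinset (fun k => f (e k)) hl',
    ← Finset.sum_image (f := f) (g := e) fun _ _ _ _ h => he h]
  refine (Finset.sum_subset ?_ ?_).symm
  · intro i hi
    obtain ⟨k, hk, rfl⟩ := Finset.mem_image.1 hi
    simpa using h k (by simpa using hk)
  · intro i hi hi'
    refine hf i (by simpa using hi) fun k hk e => hi' ?_
    exact Finset.mem_image.2 ⟨k, by simpa using hk, e⟩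

theorem List.sum_map_single {l : List ι} (hl : l.Nodup) {i : ι} (hi : i ∈ l) (f : ι → ℂ)
    (hf : ∀ j ∈ l, j ≠ i → f j = 0) : (l.map f).sum = f i := by
  rw [List.sum_map_reindex hl (l' := [()]) (by simp) (fun _ => i) (fun _ _ _ => rfl)
    (by simpa using hi) f (fun j hj h => hf j hj fun e => h () (by simp) e.symm)]
  simp

theorem List.sum_map_product (l : List ι) (l' : List κ) (f : ι × κ → ℂ) :
    ((l ×ˢ l').map f).sum = (l.map fun i => (l'.map fun k => f (i, k)).sum).sum := by
  induction l with
  | nil => rfl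
  | cons a l ih => rw [List.product_cons, List.map_append, List.sum_append, ih]; simp [Function.comp_def]

end lists

/-- All values of a type. -/
def Val.all : (T : Ty) → List (Val T)
  | .void => []
  | .unit => [()]
  | .sum a b => (Val.all a).map (Val.mkLeft a b) ++ (Val.all b).map (Val.mkRight a b)
  | .prod a b => Val.all a ×ˢ Val.all b

theorem Val.mem_all : (T : Ty) → (v : Val T) → v ∈ Val.all T
  | .void, v => v.elim
  | .unit, _ => List.mem_singleton.2 rfl
  | .sum a _, .inl v =>
    List.mem_append_left _ (List.mem_map_of_mem (Val.mem_all a v))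
  | .sum _ b, .inr v =>
    List.mem_append_right _ (List.mem_map_of_mem (Val.mem_all b v))
  | .prod a b, (v, w) => List.mem_product.2 ⟨Val.mem_all a v, Val.mem_all b w⟩

theorem Val.nodup_all : (T : Ty) → (Val.all T).Nodup
  | .void => List.nodup_nil
  | .unit => List.nodup_singleton _
  | .sum a b => by
    refine List.Nodup.append ((Val.nodup_all a).map fun _ _ h => Sum.inl_injective h)
      ((Val.nodup_all b).map fun _ _ h => Sum.inr_injective h) ?_
    intro x hx hx'
    obtain ⟨v, -, rfl⟩ := List.mem_map.1 hx
    obtain ⟨w, -, h⟩ := List.mem_map.1 hx'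
    exact Sum.inr_ne_inl h
  | .prod a b => (Val.nodup_all a).product (Val.nodup_all b)

theorem Val.length_enc : (T : Ty) → (v : Val T) → v.enc.length = T.size
  | .void, v => v.elim
  | .unit, _ => rfl
  | .sum a b, .inl v => by
    simp only [Val.enc, Ty.size, List.length_cons, List.length_append, List.length_replicate,
      Val.length_enc a v]
    omega
  | .sum a b, .inr v => by
    simp only [Val.enc, Ty.size, List.length_cons, List.length_append, List.length_replicate,
      Val.length_enc b v]
    omega
  | .prod a b, (v, w) => by
    simp only [Val.enc, Ty.size, List.length_append, Val.length_enc a v, Val.length_enc b w]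

theorem Val.enc_injective : (T : Ty) → Function.Injective (Val.enc (T := T))
  | .void => fun v => v.elim
  | .unit => fun _ _ _ => rfl
  | .sum a b => by
    rintro (v | v) (w | w) h
    · simp only [Val.enc, List.cons.injEq, true_and, List.append_cancel_right_eq] at h
      rw [Val.enc_injective a h]
    · simp [Val.enc] at h
    · simp [Val.enc] at h
    · simp only [Val.enc, List.cons.injEq, true_and, List.append_cancel_right_eq] at h
      rw [Val.enc_injective b h]
  | .prod a b => by
    rintro ⟨v, w⟩ ⟨v', w'⟩ h
    simp only [Val.enc] at h
    obtain ⟨h₁, h₂⟩ := List.append_inj h (by rw [Val.length_enc, Val.length_enc])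
    rw [Val.enc_injective a h₁, Val.enc_injective b h₂]

@[simp] theorem Val.enc_inj {T : Ty} {v w : Val T} : v.enc = w.enc ↔ v = w :=
  (Val.enc_injective T).eq_iff

@[simp] theorem Val.enc_append_inj {T T' : Ty} {v w : Val T} {v' w' : Val T'} :
    v.enc ++ v'.enc = w.enc ++ w'.enc ↔ v = w ∧ v' = w' := by
  refine ⟨fun h => ?_, fun h => by rw [h.1, h.2]⟩
  obtain ⟨h₁, h₂⟩ := List.append_inj h (by rw [Val.length_enc, Val.length_enc])
  exact ⟨Val.enc_inj.1 h₁, Val.enc_inj.1 h₂⟩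

/-- All valuations of a context. -/
def Env.all : (Γ : Ctx) → List (Env Γ)
  | [] => [()]
  | b :: Γ => Val.all b.2 ×ˢ Env.all Γ

theorem Env.mem_all : (Γ : Ctx) → (σ : Env Γ) → σ ∈ Env.all Γ
  | [], _ => List.mem_singleton.2 rfl
  | b :: Γ, (v, σ) => List.mem_product.2 ⟨Val.mem_all b.2 v, Env.mem_all Γ σ⟩

theorem Env.nodup_all : (Γ : Ctx) → (Env.all Γ).Nodup
  | [] => List.nodup_singleton _
  | b :: Γ => (Val.nodup_all b.2).product (Env.nodup_all Γ)

/-- The encodings of the values of a valuation. -/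
def Env.bits : {Γ : Ctx} → Env Γ → EnvBits
  | [], _ => []
  | _ :: _, (v, σ) => v.enc :: σ.bits

theorem Env.length_bits : {Γ : Ctx} → (σ : Env Γ) → σ.bits.length = Γ.length
  | [], _ => rfl
  | _ :: _, (_, σ) => by simp [Env.bits, Env.length_bits σ]

theorem Env.flatten_bits : {Γ : Ctx} → (σ : Env Γ) → σ.bits.flatten = σ.enc
  | [], _ => rfl
  | _ :: _, (_, σ) => by simp [Env.bits, Env.enc, Env.flatten_bits σ]

theorem Env.length_enc : {Γ : Ctx} → (σ : Env Γ) → σ.enc.length = Γ.size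
  | [], _ => rfl
  | _ :: _, (_, σ) => by
    simp [Env.enc, Ctx.size, Env.length_enc σ, Val.length_enc]

theorem Env.bits_injective : {Γ : Ctx} → Function.Injective (Env.bits (Γ := Γ))
  | [] => fun _ _ _ => rfl
  | _ :: Γ => by
    rintro ⟨v, σ⟩ ⟨w, τ⟩ h
    simp only [Env.bits, List.cons.injEq, Val.enc_inj] at h
    rw [h.1, Env.bits_injective h.2]

theorem Env.enc_injective : {Γ : Ctx} → Function.Injective (Env.enc (Γ := Γ))
  | [] => fun _ _ _ => rfl
  | _ :: Γ => by
    rintro ⟨v, σ⟩ ⟨w, τ⟩ h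
    simp only [Env.enc] at h
    obtain ⟨h₁, h₂⟩ := List.append_inj h (by rw [Val.length_enc, Val.length_enc])
    rw [Val.enc_inj.1 h₁, Env.enc_injective h₂]

@[simp] theorem Env.bits_inj {Γ : Ctx} {σ τ : Env Γ} : σ.bits = τ.bits ↔ σ = τ :=
  Env.bits_injective.eq_iff

@[simp] theorem Env.bits_append_inj {Γ Δ : Ctx} {σ σ' : Env Γ} {τ τ' : Env Δ} :
    σ.bits ++ τ.bits = σ'.bits ++ τ'.bits ↔ σ = σ' ∧ τ = τ' := by
  refine ⟨fun h => ?_, fun h => by rw [h.1, h.2]⟩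
  obtain ⟨h₁, h₂⟩ := List.append_inj h (by rw [Env.length_bits, Env.length_bits])
  exact ⟨Env.bits_inj.1 h₁, Env.bits_inj.1 h₂⟩

theorem Env.bits_append : {Γ Δ : Ctx} → (σ : Env Γ) → (τ : Env Δ) →
    (σ.append τ).bits = σ.bits ++ τ.bits
  | [], _, _, _ => rfl
  | _ :: _, _, (v, σ), τ => by
    change v.enc :: (σ.append τ).bits = _
    rw [Env.bits_append σ τ]; rfl

theorem Env.append_fst_snd : {Γ Δ : Ctx} → (σ : Env (Γ ++ Δ)) →
    Env.append (Env.fst (Γ := Γ) (Δ := Δ) σ) (Env.snd (Γ := Γ) (Δ := Δ) σ) = σ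
  | [], _, _ => rfl
  | _ :: Γ, Δ, (v, σ) => congrArg (Prod.mk v) (Env.append_fst_snd (Γ := Γ) (Δ := Δ) σ)

theorem Env.fst_append : {Γ Δ : Ctx} → (σ : Env Γ) → (τ : Env Δ) → (σ.append τ).fst = σ
  | [], _, _, _ => rfl
  | _ :: _, _, (v, σ), τ => congrArg (Prod.mk v) (Env.fst_append σ τ)

theorem Env.snd_append : {Γ Δ : Ctx} → (σ : Env Γ) → (τ : Env Δ) → (σ.append τ).snd = τ
  | [], _, _, _ => rfl
  | _ :: _, _, (_, σ), τ => Env.snd_append σ τ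

theorem Env.exists_append {Γ Δ : Ctx} (σ : Env (Γ ++ Δ)) :
    ∃ (σ₁ : Env Γ) (σ₂ : Env Δ), σ = σ₁.append σ₂ :=
  ⟨_, _, (Env.append_fst_snd σ).symm⟩

theorem Env.append_inj {Γ Δ : Ctx} {σ σ' : Env Γ} {τ τ' : Env Δ} :
    σ.append τ = σ'.append τ' ↔ σ = σ' ∧ τ = τ' := by
  rw [← Env.bits_inj, Env.bits_append, Env.bits_append, Env.bits_append_inj]

/-- The valuation with first value `v`. -/
def Env.cons {b : Var × Ty} {Γ : Ctx} (v : Val b.2) (σ : Env Γ) : Env (b :: Γ) := (v, σ)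

theorem Env.exists_cons {b : Var × Ty} {Γ : Ctx} (σ : Env (b :: Γ)) :
    ∃ (v : Val b.2) (ρ : Env Γ), σ = Env.cons v ρ := ⟨σ.1, σ.2, rfl⟩

theorem Env.bits_cons {b : Var × Ty} {Γ : Ctx} (v : Val b.2) (σ : Env Γ) :
    (Env.cons v σ).bits = v.enc :: σ.bits := rfl

theorem Env.fst_cons {b : Var × Ty} {Γ : Ctx} (v : Val b.2) (σ : Env Γ) :
    Prod.fst (α := Val b.2) (β := Env Γ) (Env.cons v σ) = v := rfl

theorem Env.cons_inj {b : Var × Ty} {Γ : Ctx} {v w : Val b.2} {σ τ : Env Γ} :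
    Env.cons v σ = Env.cons w τ ↔ v = w ∧ σ = τ := Prod.ext_iff

@[simp] theorem Env.bits_append_cons_inj {Γ Δ : Ctx} {T : Ty} {σ σ' : Env Γ} {v v' : Val T}
    {τ τ' : Env Δ} : σ.bits ++ v.enc :: τ.bits = σ'.bits ++ v'.enc :: τ'.bits ↔
      σ = σ' ∧ v = v' ∧ τ = τ' := by
  have h := Env.bits_append_inj (σ := σ) (σ' := σ') (τ := Env.cons (b := (0, T)) v τ)
    (τ' := Env.cons v' τ')
  rwa [Env.bits_cons, Env.bits_cons, Env.cons_inj] at h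

/-! ### The code-level data agree with the typed ones -/

theorem Val.enc_mkLeft (a b : Ty) (v : Val a) :
    (Val.mkLeft a b v).enc = Rule.tagged false (max a.size b.size - a.size) v.enc := by
  simp only [Val.mkLeft, Val.enc, Rule.tagged]

theorem Val.enc_mkRight (a b : Ty) (v : Val b) :
    (Val.mkRight a b v).enc = Rule.tagged true (max a.size b.size - b.size) v.enc := by
  simp only [Val.mkRight, Val.enc, Rule.tagged]

theorem tyData_code : (T : Ty) → tyData T.code = (T.size, (Val.all T).map Val.enc)
  | .void => by rw [tyData, Ty.code, foldNode_node]; rfl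
  | .unit => by rw [tyData, Ty.code, foldNode_node]; rfl
  | .sum a b => by
    rw [tyData, Ty.code, foldNode_node, ← tyData]
    have h₁ : Val.enc ∘ Val.mkLeft a b = Rule.tagged false (max a.size b.size - a.size) ∘ Val.enc :=
      funext fun v => Val.enc_mkLeft a b v
    have h₂ : Val.enc ∘ Val.mkRight a b = Rule.tagged true (max a.size b.size - b.size) ∘ Val.enc :=
      funext fun v => Val.enc_mkRight a b v
    simp only [List.map_cons, List.map_nil, tyData_code a, tyData_code b, Val.all, List.map_append,
      List.map_map, h₁, h₂, List.getD_cons_succ, List.getD_cons_zero, Ty.size]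
  | .prod a b => by
    rw [tyData, Ty.code, foldNode_node, ← tyData]
    simp only [List.map_cons, List.map_nil, tyData_code a, tyData_code b, Val.all]
    change (_, ((_ : List Bits) ×ˢ (_ : List Bits)).map _) = _
    simp only [List.getD_cons_zero, List.getD_cons_succ, List.product_map_map, List.map_map]
    rfl

@[simp] theorem tyVals_code (T : Ty) : tyVals T.code = (Val.all T).map Val.enc := by
  rw [tyVals, tyData_code]

theorem ctxTys_code (Γ : Ctx) : ctxTys Γ.code = Γ.map fun b => b.2.code := by
  simp [ctxTys, Ctx.code, Function.comp_def]

theorem envs_map_code (Γ : Ctx) : envs (Γ.map fun b => b.2.code) = (Env.all Γ).map Env.bits := by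
  induction Γ with
  | nil => rfl
  | cons b Γ ih =>
    rw [List.map_cons, envs, List.foldr_cons, ← envs, ih, tyData_code]
    simp only [Env.all, List.product_map_map, List.map_map]
    rfl

@[simp] theorem ctxEnvs_code (Γ : Ctx) : ctxEnvs Γ.code = (Env.all Γ).map Env.bits := by
  rw [ctxEnvs, ctxTys_code, envs_map_code]

theorem tysSize_map_code (Γ : Ctx) : tysSize (Γ.map fun b => b.2.code) = Γ.size := by
  induction Γ with
  | nil => rfl
  | cons b Γ ih => rw [List.map_cons, tysSize, List.foldr_cons, ← tysSize, ih, tyData_code]; rfl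

namespace Rule

theorem swapAt_succ (k : ℕ) (a : Bits) (s : EnvBits) :
    swapAt (k + 1) (a :: s) = a :: swapAt k s := by simp [swapAt]

theorem swapsAt_map_succ (l : List ℕ) (a : Bits) (s : EnvBits) :
    swapsAt (l.map (· + 1)) (a :: s) = a :: swapsAt l s := by
  induction l with
  | nil => rfl
  | cons k l ih =>
    rw [List.map_cons, swapsAt, List.foldr_cons, ← swapsAt, ih, swapAt_succ]; rfl

theorem bits_pull : {Γ Γ' : Ctx} → (π : LPerm Γ Γ') → (σ : Env Γ') →
    (π.pull σ).bits = swapsAt (permData π.code) σ.bits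
  | _, _, .nil, _ => by rw [permData, LPerm.code, foldNode_node]; rfl
  | _, _, .cons b p, (v, σ) => by
    rw [permData, LPerm.code, foldNode_node, ← permData]
    change v.enc :: (p.pull σ).bits = swapsAt ((permData p.code).map (· + 1)) (v.enc :: σ.bits)
    rw [swapsAt_map_succ, bits_pull p]
  | _, _, .swap _ _ _, (w, v, σ) => by rw [permData, LPerm.code, foldNode_node]; rfl
  | _, _, .trans p q, σ => by
    rw [permData, LPerm.code, foldNode_node, ← permData]
    change (p.pull (q.pull σ)).bits = swapsAt (permData p.code ++ permData q.code) σ.bits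
    rw [bits_pull p, bits_pull q, swapsAt, swapsAt, swapsAt, List.foldr_append]

end Rule

theorem LPerm.pull_injective : {Γ Γ' : Ctx} → (π : LPerm Γ Γ') → Function.Injective π.pull
  | _, _, .nil => fun _ _ h => h
  | _, _, .cons _ p => by
    rintro ⟨v, σ⟩ ⟨w, τ⟩ h
    have h' : (v, p.pull σ) = (w, p.pull τ) := h
    rw [Prod.mk.injEq] at h'
    rw [h'.1, p.pull_injective h'.2]
  | _, _, .swap _ _ _ => by
    rintro ⟨w, v, σ⟩ ⟨w', v', σ'⟩ h
    have h' : (v, w, σ) = (v', w', σ') := h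
    simp only [Prod.mk.injEq] at h'
    rw [h'.1, h'.2.1, h'.2.2]
  | _, _, .trans p q => fun _ _ h => q.pull_injective (p.pull_injective h)

@[simp] theorem inCode_inj {s s' t t' : EnvBits} : inCode s t = inCode s' t' ↔ s = s' ∧ t = t' := by
  simp [inCode]

@[simp] theorem outCode_inj {s s' : EnvBits} {v v' : Bits} {g g' : ℕ} :
    outCode s v g = outCode s' v' g' ↔ s = s' ∧ v = v' ∧ g = g' := by
  simp [outCode]

@[simp] theorem inL_inj {s s' t t' : EnvBits} : inL s t = inL s' t' ↔ s = s' ∧ t = t' := by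
  simp [inL, Nat.pair_eq_pair]

@[simp] theorem outL_inj {s s' : EnvBits} {v v' : Bits} {g g' : ℕ} :
    outL s v g = outL s' v' g' ↔ s = s' ∧ v = v' ∧ g = g' := by
  simp [outL, Nat.pair_eq_pair]

/-! ### Amplitudes of the programs of the typing rules -/

section
variable {α β γ δ ι : Type}

theorem List.product_map_left (f : α → γ) (l : List α) (l' : List β) :
    (l.map f) ×ˢ l' = (l ×ˢ l').map fun x => (f x.1, x.2) := by
  simpa using List.product_map_map f id l l'

theorem List.product_map_right (g : β → δ) (l : List α) (l' : List β) :
    l ×ˢ (l'.map g) = (l ×ˢ l').map fun x => (x.1, g x.2) := by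
  simpa using List.product_map_map id g l l'

end

section
variable {R : Type} [Encodable R] (val : R → ℝ)

open Classical in
theorem TL.amp_fam_map {ι : Type} {l : List ι} {tag : ι → ℕ} (hl : (l.map tag).Nodup) (P : ι → TL ℕ)
    {i : ι} (hi : i ∈ l) (k c a : ℕ) :
    amp val (fam (l.map fun i => (tag i, P i))) (Nat.pair k c) (Nat.pair (tag i) a) =
      if k = tag i then amp val (P i) c a else 0 := by
  have hl' : ((l.map fun i => (tag i, P i)).map Prod.fst).Nodup := by
    simpa [List.map_map, Function.comp_def] using hl
  split_ifs with h
  · subst h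
    exact amp_fam val hl' (List.mem_map.2 ⟨i, hi, rfl⟩) c a
  · exact amp_fam_ne val hl' h c a

/-- The amplitudes of a program from inputs to outputs with garbage labels in `G`: the valuation of
the classical context is kept, and they are given by `E`. -/
def TL.Acts {Γ Δ : Ctx} {T : Ty} (p : TL ℕ) (G : List ℕ)
    (E : Env Γ → Env Δ → Val T → ℕ → ℂ) : Prop :=
  ∀ (σ : Env Γ) (τ : Env Δ) (σ' : Env Γ) (v : Val T), ∀ g ∈ G,
    amp val p (outL σ'.bits v.enc g) (inL σ.bits τ.bits) = if σ' = σ then E σ τ v g else 0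

namespace Rule
open TL

theorem acts_unit (Γ : Ctx) :
    Acts val (Γ := Γ) (Δ := []) (T := .unit) (unit ((Env.all Γ).map Env.bits)) [0]
      fun _ _ _ _ => 1 := by
  rintro σ τ σ' v g hg
  obtain rfl := List.mem_singleton.1 hg
  simp only [unit, List.map_map, Function.comp_def]
  rw [outL, inL, amp_wrap val (k := encode σ.bits) (k' := encode σ'.bits)]
  · rw [amp_nil, ket]
    simp
  · exact table_map (Env.nodup_all Γ) (fun i j h => by simpa using h) fun i j h => by simpa using h
  · exact table_map (Env.nodup_all Γ) (fun i j h => by simpa using h) fun i j h => by simpa using h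
  · exact List.mem_map.2 ⟨σ, Env.mem_all _ _, rfl⟩
  · exact List.mem_map.2 ⟨σ', Env.mem_all _ _, rfl⟩

theorem acts_cvar (Γ : Ctx) (x : Var) (T : Ty) (Γ' : Ctx) :
    Acts val (Γ := Γ ++ (x, T) :: Γ') (Δ := []) (T := T)
      (cvar ((Env.all Γ).map Env.bits) ((Val.all T).map Val.enc) ((Env.all Γ').map Env.bits)) [0]
      fun σ _ v _ => if v = (Env.snd (Γ := Γ) (Δ := (x, T) :: Γ') σ).1 then 1 else 0 := by
  rintro σ τ σ' v g hg
  obtain rfl := List.mem_singleton.1 hg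
  obtain ⟨σ, ρ, rfl⟩ := Env.exists_append σ
  obtain ⟨σ', ρ', rfl⟩ := Env.exists_append σ'
  obtain ⟨w, ρ, rfl⟩ := Env.exists_cons ρ
  obtain ⟨w', ρ', rfl⟩ := Env.exists_cons ρ'
  simp only [cvar, List.map_map, Function.comp_def, List.product_map_left, List.product_map_right]
  have hn := (Env.nodup_all Γ).product ((Val.nodup_all T).product (Env.nodup_all Γ'))
  have h₁ : Table ((Env.all Γ ×ˢ Val.all T ×ˢ Env.all Γ').map fun i =>
      (inCode (i.1.bits ++ i.2.1.enc :: i.2.2.bits) [], encode (i.1.bits, i.2.1.enc, i.2.2.bits))) :=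
    table_map hn (fun i j h => by simpa [Prod.ext_iff] using h)
      fun i j h => by simpa [Prod.ext_iff] using h
  have h₂ : Table ((Env.all Γ ×ˢ Val.all T ×ˢ Env.all Γ').map fun i =>
      (encode (i.1.bits, i.2.1.enc, i.2.2.bits),
        outCode (i.1.bits ++ i.2.1.enc :: i.2.2.bits) i.2.1.enc 0)) :=
    table_map hn (fun i j h => by simpa [Prod.ext_iff] using h) fun i j h => by
      simp only [outCode_inj, Env.bits_append_cons_inj, Prod.ext_iff] at h ⊢
      exact h.1
  rw [Env.snd_append, Env.bits_append, Env.bits_append, Env.bits_cons, Env.bits_cons, Env.fst_cons,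
    outL, inL]
  have hin : (inCode (σ.bits ++ w.enc :: ρ.bits) τ.bits, encode (σ.bits, w.enc, ρ.bits)) ∈
      (Env.all Γ ×ˢ Val.all T ×ˢ Env.all Γ').map fun i =>
      (inCode (i.1.bits ++ i.2.1.enc :: i.2.2.bits) [], encode (i.1.bits, i.2.1.enc, i.2.2.bits)) :=
    List.mem_map.2 ⟨(σ, w, ρ), by simp [Env.mem_all, Val.mem_all], rfl⟩
  by_cases hv : v = w'
  · subst hv
    rw [amp_wrap val h₁ h₂ _ (k' := encode (σ'.bits, v.enc, ρ'.bits)) hin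
      (List.mem_map.2 ⟨(σ', v, ρ'), by simp [Env.mem_all, Val.mem_all], rfl⟩),
      amp_nil, ket]
    simp only [Encodable.encode_inj, Prod.mk.injEq, Env.bits_inj, Val.enc_inj, Env.append_inj,
      Env.cons_inj]
    by_cases h : σ' = σ ∧ v = w ∧ ρ' = ρ
    · rw [if_pos h, if_pos h, if_pos h.2.1]
    · rw [if_neg h, if_neg h]
  · rw [amp_wrap_of_notMem val h₁ h₂ _ (Or.inr _)]
    · rw [eq_comm]
      simp only [ite_eq_right_iff, one_ne_zero, imp_false, Env.append_inj, Env.cons_inj]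
      rintro ⟨-, h, -⟩ h'
      exact hv (h'.trans h.symm)
    · simp only [List.map_map, List.mem_map, Function.comp_apply, outCode_inj, not_exists, not_and,
        Env.bits_append_cons_inj, Val.enc_inj]
      exact fun i _ h h' => (hv (h'.symm.trans h.2.1)).elim

theorem acts_qvar (Γ : Ctx) (x : Var) (T : Ty) :
    Acts val (Γ := Γ) (Δ := [(x, T)]) (T := T)
      (qvar ((Env.all Γ).map Env.bits) ((Val.all T).map Val.enc)) [0]
      fun _ τ v _ => if v = τ.1 then 1 else 0 := by
  rintro σ ⟨w, τ⟩ σ' v g hg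
  obtain rfl := List.mem_singleton.1 hg
  simp only [qvar, List.map_map, Function.comp_def, List.product_map_left, List.product_map_right]
  have hn := (Env.nodup_all Γ).product (Val.nodup_all T)
  rw [outL, inL, amp_wrap val (k := encode (σ.bits, w.enc)) (k' := encode (σ'.bits, v.enc))]
  · rw [amp_nil, ket]
    simp only [Encodable.encode_inj, Prod.mk.injEq, Env.bits_inj, Val.enc_inj]
    rw [ite_and]
  · exact table_map hn (fun i j h => by simpa [Prod.ext_iff] using h)
      fun i j h => by simpa [Prod.ext_iff] using h
  · exact table_map hn (fun i j h => by simpa [Prod.ext_iff] using h)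
      fun i j h => by simpa [Prod.ext_iff] using h
  · exact List.mem_map.2 ⟨(σ, w), by simp [Env.mem_all, Val.mem_all], rfl⟩
  · exact List.mem_map.2 ⟨(σ', v), by simp [Env.mem_all, Val.mem_all], rfl⟩

theorem acts_pair {Γ Δ Δ₀ Δ₁ : Ctx} {T₀ T₁ : Ty} {p₀ p₁ : TL ℕ} {G₀ G₁ : List ℕ}
    (hG₀ : G₀.Nodup) (hG₁ : G₁.Nodup)
    {E₀ : Env Γ → Env (Δ ++ Δ₀) → Val T₀ → ℕ → ℂ} {E₁ : Env Γ → Env (Δ ++ Δ₁) → Val T₁ → ℕ → ℂ}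
    (h₀ : Acts val p₀ G₀ E₀) (h₁ : Acts val p₁ G₁ E₁) :
    Acts val (Γ := Γ) (Δ := Δ ++ Δ₀ ++ Δ₁) (T := .prod T₀ T₁)
      (pair ((Env.all Γ).map Env.bits) ((Env.all Δ).map Env.bits) ((Env.all Δ₀).map Env.bits)
        ((Env.all Δ₁).map Env.bits) ((Val.all T₀).map Val.enc) ((Val.all T₁).map Val.enc)
        p₀ G₀ p₁ G₁) ((G₀ ×ˢ G₁).map fun i => Nat.pair i.1 i.2)
      fun σ t v g =>
        E₀ σ (Env.append (Env.fst (Γ := Δ ++ Δ₀) (Δ := Δ₁) t).fst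
          (Env.fst (Γ := Δ ++ Δ₀) (Δ := Δ₁) t).snd) v.1 g.unpair.1 *
        E₁ σ (Env.append (Env.fst (Γ := Δ ++ Δ₀) (Δ := Δ₁) t).fst
          (Env.snd (Γ := Δ ++ Δ₀) (Δ := Δ₁) t)) v.2 g.unpair.2 := by
  rintro σ t σ' ⟨v₀, v₁⟩ g hg
  obtain ⟨⟨g₀, g₁⟩, hg', rfl⟩ := List.mem_map.1 hg
  replace hg := List.mem_product.1 hg'
  obtain ⟨t, τ₁, rfl⟩ := Env.exists_append t
  obtain ⟨τ, τ₀, rfl⟩ := Env.exists_append t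
  simp only [Env.fst_append, Env.snd_append, Nat.unpair_pair]
  simp only [pair, List.map_map, Function.comp_def, List.product_map_left, List.product_map_right]
  have nS := Env.nodup_all Γ
  have nD := Env.nodup_all Δ
  have nD₀ := Env.nodup_all Δ₀
  have nD₁ := Env.nodup_all Δ₁
  have nV₀ := Val.nodup_all T₀
  have nV₁ := Val.nodup_all T₁
  rw [outL, inL, amp_wrap val
    (k := Nat.pair 0 (Nat.pair (encode (τ.bits, τ₁.bits)) (inL σ.bits (τ.bits ++ τ₀.bits))))
    (k' := Nat.pair 1 (Nat.pair (encode (v₀.enc, g₀)) (outL σ'.bits v₁.enc g₁))),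
    amp_join, List.map_map]
  · simp only [Function.comp_def]
    rw [List.sum_map_single (i := (σ, τ, τ₁, v₀, g₀))]
    · rw [amp_fam_map val (l := Val.all T₀ ×ˢ G₀) (tag := fun i => encode (i.1.enc, i.2))
        (i := (v₀, g₀)), amp_fam_map val (l := Env.all Δ ×ˢ Env.all Δ₁)
        (tag := fun i => encode (i.1.bits, i.2.bits)) (i := (τ, τ₁))]
      · simp only [if_true, ← Env.bits_append]
        rw [h₀ _ _ _ _ _ hg.1, h₁ _ _ _ _ _ hg.2, if_pos rfl, mul_comm]
        split_ifs <;> simp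
      · exact (nD.product nD₁).map fun i j h => by simpa [Prod.ext_iff] using h
      · simp [Env.mem_all]
      · exact (nV₀.product hG₀).map fun i j h => by simpa [Prod.ext_iff] using h
      · simp [Val.mem_all, hg.1]
    · exact nS.product (nD.product (nD₁.product (nV₀.product hG₀)))
    · simp [Env.mem_all, Val.mem_all, hg.1]
    · rintro ⟨σ₂, τ₂, τ₃, w, g⟩ hm hne
      simp only [List.mem_product] at hm
      rw [amp_fam_map val (l := Val.all T₀ ×ˢ G₀) (tag := fun i => encode (i.1.enc, i.2))
        (i := (w, g)), amp_fam_map val (l := Env.all Δ ×ˢ Env.all Δ₁)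
        (tag := fun i => encode (i.1.bits, i.2.bits)) (i := (τ, τ₁))]
      · simp only [Encodable.encode_inj, Prod.mk.injEq, Env.bits_inj, Val.enc_inj]
        by_cases e₁ : v₀ = w ∧ g₀ = g
        · by_cases e₂ : τ₂ = τ ∧ τ₃ = τ₁
          · rw [← Env.bits_append τ τ₀, h₀ _ _ _ _ _ hm.2.2.2.2, if_neg (c := σ₂ = σ), ite_self,
              mul_zero]
            rintro rfl
            exact hne (by rw [e₁.1, e₁.2, e₂.1, e₂.2])
          · rw [if_neg e₂, mul_zero]
        · rw [if_neg e₁, zero_mul]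
      · exact (nD.product nD₁).map fun i j h => by simpa [Prod.ext_iff] using h
      · simp [Env.mem_all]
      · exact (nV₀.product hG₀).map fun i j h => by simpa [Prod.ext_iff] using h
      · simp [Val.mem_all, hm.2.2.2.2]
  · refine table_map (nS.product (nD.product (nD₁.product (nV₀.product hG₀)))) ?_ ?_
    · rintro ⟨a, b, c, d, e⟩ ⟨a', b', c', d', e'⟩ h
      simp only [Nat.pair_eq_pair, Encodable.encode_inj, Prod.mk.injEq, Env.bits_inj, outL_inj,
        Val.enc_inj] at h ⊢
      tauto
    · rintro ⟨a, b, c, d, e⟩ ⟨a', b', c', d', e'⟩ h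
      simp only [Nat.pair_eq_pair, Encodable.encode_inj, Prod.mk.injEq, Env.bits_inj, inL_inj,
        Val.enc_inj, Env.bits_append_inj] at h ⊢
      tauto
  · refine table_map (nS.product (nD.product (nD₀.product nD₁))) ?_ ?_
    · rintro ⟨a, b, c, d⟩ ⟨a', b', c', d'⟩ h
      simp only [inCode_inj, ← Env.bits_append, Env.bits_inj, Env.append_inj, Prod.mk.injEq] at h ⊢
      tauto
    · rintro ⟨a, b, c, d⟩ ⟨a', b', c', d'⟩ h
      simp only [Nat.pair_eq_pair, Encodable.encode_inj, Prod.mk.injEq, Env.bits_inj, inL_inj,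
        Env.bits_append_inj] at h ⊢
      tauto
  · refine table_map (nS.product ((nV₀.product hG₀).product (nV₁.product hG₁))) ?_ ?_
    · rintro ⟨a, ⟨b, c⟩, d, e⟩ ⟨a', ⟨b', c'⟩, d', e'⟩ h
      simp only [Nat.pair_eq_pair, Encodable.encode_inj, Prod.mk.injEq, Env.bits_inj, outL_inj,
        Val.enc_inj] at h ⊢
      tauto
    · rintro ⟨a, ⟨b, c⟩, d, e⟩ ⟨a', ⟨b', c'⟩, d', e'⟩ h
      simp only [outCode_inj, Nat.pair_eq_pair, Val.enc_append_inj, Prod.mk.injEq, Env.bits_inj]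
        at h ⊢
      tauto
  · exact List.mem_map.2 ⟨(σ, τ, τ₀, τ₁), by simp [Env.mem_all], by simp [Env.bits_append]⟩
  · exact List.mem_map.2 ⟨(σ', (v₀, g₀), v₁, g₁), by simp [Env.mem_all, Val.mem_all, hg], by
      simp [Val.enc]⟩

end Rule
end

section
variable {R : Type} [Encodable R] (val : R → ℝ)

namespace Rule
open TL

theorem acts_app {Γ Δ : Ctx} {T T' : Ty} {x : Var} {p q : TL ℕ} {G G' : List ℕ}
    (hG : G.Nodup) (hG' : G'.Nodup) {E : Env Γ → Env Δ → Val T → ℕ → ℂ}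
    {F : Env [] → Env [(x, T)] → Val T' → ℕ → ℂ} (h : Acts val p G E) (h' : Acts val q G' F) :
    Acts val (Γ := Γ) (Δ := Δ) (T := T')
      (app ((Env.all Γ).map Env.bits) ((Env.all Δ).map Env.bits) ((Val.all T).map Val.enc)
        ((Val.all T').map Val.enc) p G q G') ((G ×ˢ G').map fun i => Nat.pair i.1 i.2)
      fun σ τ v' g => ∑ v : Val T, F Env.empty (Env.cons v Env.empty) v' g.unpair.2 *
        E σ τ v g.unpair.1 := by
  rintro σ τ σ' v' g hg
  obtain ⟨⟨g, g'⟩, hg₁, rfl⟩ := List.mem_map.1 hg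
  replace hg := List.mem_product.1 hg₁
  simp only [Nat.unpair_pair]
  simp only [app, List.map_map, Function.comp_def, List.product_map_left, List.product_map_right]
  have nS := Env.nodup_all Γ
  have nD := Env.nodup_all Δ
  have nV := Val.nodup_all T
  have nV' := Val.nodup_all T'
  rw [outL, inL, amp_wrap val
    (k := Nat.pair 0 (inL σ.bits τ.bits))
    (k' := Nat.pair 1 (Nat.pair (encode (σ'.bits, g)) (outL [] v'.enc g'))),
    amp_join, List.map_map]
  · simp only [Function.comp_def]
    have key (i : Env Γ × Val T × ℕ) (hi : i.2.2 ∈ G) :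
        amp val (fam ((Env.all Γ ×ˢ G).map fun x => (encode (x.1.bits, x.2), q)))
          (Nat.pair (encode (σ'.bits, g)) (outL [] v'.enc g'))
          (Nat.pair (encode (i.1.bits, i.2.2)) (inL [] [i.2.1.enc])) =
        if σ' = i.1 ∧ g = i.2.2 then F Env.empty (Env.cons i.2.1 Env.empty) v' g' else 0 := by
      rw [amp_fam_map val (l := Env.all Γ ×ˢ G) (tag := fun i => encode (i.1.bits, i.2))
        (i := (i.1, i.2.2))]
      · simp only [Encodable.encode_inj, Prod.mk.injEq, Env.bits_inj]
        congr 1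
        exact (h' Env.empty (Env.cons i.2.1 Env.empty) Env.empty v' g' hg.2).trans (if_pos rfl)
      · exact (nS.product hG).map fun i j h => by simpa [Prod.ext_iff] using h
      · simp [Env.mem_all, hi]
    rw [List.sum_map_reindex (l' := Val.all T) (e := fun v => (σ', v, g))]
    · rw [List.sum_map_eq_sum_univ nV (Val.mem_all T)]
      have key' (w : Val T) := (key (σ', w, g) hg.1).trans (if_pos ⟨rfl, rfl⟩)
      simp only [key', h _ _ _ _ _ hg.1]
      split_ifs <;> simp
    · exact nS.product (nV.product hG)
    · exact nV
    · exact fun v w h => by simpa using h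
    · exact fun v _ => by simp [Env.mem_all, Val.mem_all, hg.1]
    · rintro ⟨σ₂, w, g₂⟩ hi hne
      simp only [List.mem_product] at hi
      rw [key (σ₂, w, g₂) hi.2.2, if_neg, zero_mul]
      rintro ⟨e, e'⟩
      exact hne w (Val.mem_all _ _) (by rw [e, e'])
  · refine table_map (nS.product (nV.product hG)) ?_ ?_
    · rintro ⟨a, b, c⟩ ⟨a', b', c'⟩ h
      simpa using h
    · rintro ⟨a, b, c⟩ ⟨a', b', c'⟩ h
      simp only [Nat.pair_eq_pair, Encodable.encode_inj, Prod.mk.injEq, Env.bits_inj, inL_inj,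
        List.cons.injEq, Val.enc_inj] at h ⊢
      tauto
  · exact table_map (nS.product nD) (fun i j h => by simpa [Prod.ext_iff] using h)
      fun i j h => by simpa [Nat.pair_eq_pair, Prod.ext_iff] using h
  · refine table_map (nS.product (hG.product (nV'.product hG'))) ?_ ?_
    · rintro ⟨a, b, c, d⟩ ⟨a', b', c', d'⟩ h
      simp only [Nat.pair_eq_pair, Encodable.encode_inj, Prod.mk.injEq, Env.bits_inj, outL_inj,
        Val.enc_inj] at h ⊢
      tauto
    · rintro ⟨a, b, c, d⟩ ⟨a', b', c', d'⟩ h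
      simp only [outCode_inj, Nat.pair_eq_pair, Val.enc_inj, Prod.mk.injEq, Env.bits_inj] at h ⊢
      tauto
  · exact List.mem_map.2 ⟨(σ, τ), by simp [Env.mem_all], rfl⟩
  · exact List.mem_map.2 ⟨(σ', g, v', g'), by simp [Env.mem_all, Val.mem_all, hg], rfl⟩

theorem acts_perm {Γ Γ' Δ Δ' : Ctx} {T : Ty} {p : TL ℕ} {G : List ℕ} (hG : G.Nodup)
    {E : Env Γ → Env Δ → Val T → ℕ → ℂ} (h : Acts val p G E) {lg ld : List ℕ}
    {fg : Env Γ' → Env Γ} {fd : Env Δ' → Env Δ} (hfg : Function.Injective fg)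
    (hfd : Function.Injective fd) (eg : ∀ σ, (fg σ).bits = swapsAt lg σ.bits)
    (ed : ∀ τ, (fd τ).bits = swapsAt ld τ.bits) :
    Acts val (Γ := Γ') (Δ := Δ') (T := T)
      (perm ((Env.all Γ').map Env.bits) ((Env.all Δ').map Env.bits) ((Val.all T).map Val.enc) G
        lg ld p) G fun σ τ v g => E (fg σ) (fd τ) v g := by
  rintro σ τ σ' v g hg
  simp only [perm, List.map_map, Function.comp_def, List.product_map_left, List.product_map_right,
    ← eg, ← ed]
  have nS := Env.nodup_all Γ'
  have nD := Env.nodup_all Δ'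
  have nV := Val.nodup_all T
  rw [outL, inL, amp_wrap val (k := inL (fg σ).bits (fd τ).bits)
    (k' := outL (fg σ').bits v.enc g), h _ _ _ _ _ hg]
  · simp only [hfg.eq_iff]
  · exact table_map (nS.product nD) (fun i j h => by simpa [Prod.ext_iff] using h)
      fun i j h => by simpa [Prod.ext_iff, hfg.eq_iff, hfd.eq_iff] using h
  · exact table_map (nS.product (nV.product hG))
      (fun i j h => by simpa [Prod.ext_iff, hfg.eq_iff] using h)
      fun i j h => by simpa [Prod.ext_iff] using h
  · exact List.mem_map.2 ⟨(σ, τ), by simp [Env.mem_all], rfl⟩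
  · exact List.mem_map.2 ⟨(σ', v, g), by simp [Env.mem_all, Val.mem_all, hg], rfl⟩

theorem amp_abs {Δ Δ₀ : Ctx} {T T' : Ty} {p q : TL ℕ} {G : List ℕ} (hG : G.Nodup)
    {P : Env Δ → Env Δ₀ → Val T → ℂ} {Q : Env Δ → Val T' → ℕ → ℂ}
    (hp : ∀ τ τ₀ v, amp val p (outL [] v.enc 0) (inL [] (τ.bits ++ τ₀.bits)) = P τ τ₀ v)
    (hq : ∀ τ v, ∀ g ∈ G, amp val q (outL [] v.enc g) (inL [] τ.bits) = Q τ v g)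
    (v : Val T) (v' : Val T') (τ₀ : Env Δ₀) {g : ℕ} (hg : g ∈ G) :
    amp val (abs ((Env.all Δ).map Env.bits) ((Env.all Δ₀).map Env.bits) ((Val.all T).map Val.enc)
      ((Val.all T').map Val.enc) p q G) (outL [] v'.enc (Nat.pair (encode τ₀.bits) g))
      (inL [] [v.enc]) = ∑ τ : Env Δ, Q τ v' g * (starRingEnd ℂ) (P τ τ₀ v) := by
  simp only [abs, List.map_map, Function.comp_def, List.product_map_left, List.product_map_right]
  have nD := Env.nodup_all Δ
  have nD₀ := Env.nodup_all Δ₀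
  have nV := Val.nodup_all T
  have nV' := Val.nodup_all T'
  rw [outL, inL, amp_wrap val (k := Nat.pair 0 (outL [] v.enc 0))
    (k' := Nat.pair 1 (Nat.pair (encode τ₀.bits) (outL [] v'.enc g))), amp_join, List.map_map]
  · simp only [Function.comp_def]
    have key (i : Env Δ × Env Δ₀) :
        amp val (fam ((Env.all Δ₀).map fun x => (encode x.bits, q)))
          (Nat.pair (encode τ₀.bits) (outL [] v'.enc g))
          (Nat.pair (encode i.2.bits) (inL [] i.1.bits)) =
        if τ₀ = i.2 then Q i.1 v' g else 0 := by
      rw [amp_fam_map val (tag := fun i : Env Δ₀ => encode i.bits), hq _ _ _ hg]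
      · simp
      · exact nD₀.map fun i j h => by simpa using h
      · exact Env.mem_all _ _
    simp only [key]
    rw [List.sum_map_reindex (l' := Env.all Δ) (e := fun τ => (τ, τ₀))]
    · rw [List.sum_map_eq_sum_univ nD (Env.mem_all Δ)]
      simp [amp_inv, hp]
    · exact nD.product nD₀
    · exact nD
    · exact fun v w h => by simpa using h
    · exact fun v _ => by simp [Env.mem_all]
    · intro i hi hne
      rw [if_neg, zero_mul]
      rintro rfl
      exact hne i.1 (Env.mem_all _ _) rfl
  · refine table_map (nD.product nD₀) ?_ ?_
    · rintro ⟨a, b⟩ ⟨a', b'⟩ h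
      simpa using h
    · rintro ⟨a, b⟩ ⟨a', b'⟩ h
      simp only [Nat.pair_eq_pair, Encodable.encode_inj, Prod.mk.injEq, Env.bits_inj, inL_inj] at h ⊢
      tauto
  · exact table_map nV (fun i j h => by simpa using h)
      fun i j h => by simpa [Nat.pair_eq_pair] using h
  · refine table_map (nD₀.product (nV'.product hG)) ?_ ?_
    · rintro ⟨a, b, c⟩ ⟨a', b', c'⟩ h
      simp only [Nat.pair_eq_pair, Encodable.encode_inj, Prod.mk.injEq, Env.bits_inj, outL_inj,
        Val.enc_inj] at h ⊢
      tauto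
    · rintro ⟨a, b, c⟩ ⟨a', b', c'⟩ h
      simp only [outCode_inj, Nat.pair_eq_pair, Val.enc_inj, Prod.mk.injEq, Env.bits_inj,
        Encodable.encode_inj] at h ⊢
      tauto
  · exact List.mem_map.2 ⟨v, Val.mem_all _ _, rfl⟩
  · exact List.mem_map.2 ⟨(τ₀, v', g), by simp [Env.mem_all, Val.mem_all, hg], rfl⟩

theorem amp_inj {T T' : Ty} {b : Bool} {pad : ℕ} {f : Val T → Val T'} (hf : Function.Injective f)
    (he : ∀ v, (f v).enc = tagged b pad v.enc) (v : Val T) (v' : Val T') :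
    amp val (inj ((Val.all T).map Val.enc) b pad) (outL [] v'.enc 0) (inL [] [v.enc]) =
      if v' = f v then 1 else 0 := by
  simp only [inj, List.map_map, Function.comp_def, ← he]
  have nV := Val.nodup_all T
  have h₁ : Table ((Val.all T).map fun v => (inCode [] [v.enc], encode v.enc)) :=
    table_map nV (fun i j h => by simpa using h) fun i j h => by simpa using h
  have h₂ : Table ((Val.all T).map fun v => (encode v.enc, outCode [] (f v).enc 0)) :=
    table_map nV (fun i j h => by simpa using h) fun i j h => by simpa [hf.eq_iff] using h
  rw [outL, inL]
  by_cases h : ∃ w, f w = v'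
  · obtain ⟨w, rfl⟩ := h
    rw [amp_wrap val h₁ h₂ _ (List.mem_map.2 ⟨v, Val.mem_all _ _, rfl⟩)
      (List.mem_map.2 ⟨w, Val.mem_all _ _, rfl⟩), amp_nil, ket]
    simp [hf.eq_iff]
  · rw [amp_wrap_of_notMem val h₁ h₂ _ (Or.inr _), if_neg fun e => h ⟨v, e.symm⟩]
    simp only [List.map_map, List.mem_map, Function.comp_apply, outCode_inj, Val.enc_inj]
    rintro ⟨w, -, -, e, -⟩
    exact h ⟨w, e⟩

theorem amp_gate (θ φ l : ℕ) (b b' : Bool) :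
    amp val (gate θ φ l) (outL [] [b'] 0) (inL [] [[b]]) =
      u3Mat (angleVal val θ) (angleVal val φ) (angleVal val l) b' b := by
  have hn : [false, true].Nodup := by decide
  rw [gate, outL, inL, amp_wrap val (k := encode b) (k' := encode b')]
  · have h (c c' : Bool) : ((encode c : ℕ) = encode c') = (c = c') := by simp
    rw [amp_cons]
    simp only [h, amp_nil, ket, Params.mat, angleVal_zero]
    cases b <;> cases b' <;> simp
  · exact table_map hn (fun i j h => by simpa using h) fun i j h => by simpa using h
  · exact table_map hn (fun i j h => by simpa using h) fun i j h => by simpa using h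
  · exact List.mem_map.2 ⟨b, by simp, rfl⟩
  · exact List.mem_map.2 ⟨b', by simp, rfl⟩

/-- With `P` the operator of the pattern, the conjugated phase acts as `1 + (exp(i (r - r')) - 1) P P†`
on outputs, and the final phase multiplies this by `exp(i r')`. -/
theorem amp_rphase {Δ : Ctx} {T : Ty} {p : TL ℕ} {P : Env Δ → Val T → ℂ}
    (hp : ∀ τ v, amp val p (outL [] v.enc 0) (inL [] τ.bits) = P τ v) (r r' : ℕ) (v v' : Val T) :
    amp val (rphase ((Env.all Δ).map Env.bits) ((Val.all T).map Val.enc) p r r')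
      (outL [] v'.enc 0) (inL [] [v.enc]) =
      Complex.exp (Complex.I * angleVal val r) * (∑ τ, P τ v' * (starRingEnd ℂ) (P τ v)) +
        Complex.exp (Complex.I * angleVal val r') *
          ((if v' = v then 1 else 0) - ∑ τ, P τ v' * (starRingEnd ℂ) (P τ v)) := by
  classical
  simp only [rphase, List.map_map, Function.comp_def]
  have nD := Env.nodup_all Δ
  have nV := Val.nodup_all T
  set a := Complex.exp (Complex.I * angleVal val r) with ha
  set a' := Complex.exp (Complex.I * angleVal val r') with ha'
  have haa : a' * Complex.exp (Complex.I * angleVal val (negCode r')) = 1 := by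
    rw [ha', ← Complex.exp_add]; simp
  have nI : ((Env.all Δ).map fun τ => inL [] τ.bits).Nodup := nD.map fun i j h => by simpa using h
  have nO : ((Val.all T).map fun v => outL [] v.enc 0).Nodup := nV.map fun i j h => by simpa using h
  rw [outL, inL, amp_wrap val (k := outL [] v.enc 0) (k' := outL [] v'.enc 0), amp, run_append,
    run_append, run_append, run_append, run_phase val _ nO,
    if_pos (List.mem_map.2 ⟨v', Val.mem_all _ _, rfl⟩), ← ha']
  · set ψ := run val p.inv (ket (outL [] v.enc 0)) with hψ
    -- the two phases change the amplitudes on the inputs only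
    have key : run val (phase (negCode r') ((Env.all Δ).map fun τ => inL [] τ.bits))
        (run val (phase r ((Env.all Δ).map fun τ => inL [] τ.bits)) ψ) = ψ +
        ∑ τ : Env Δ, ((Complex.exp (Complex.I * angleVal val (negCode r')) * a - 1) *
          ψ (inL [] τ.bits)) • ket (inL [] τ.bits) := by
      funext c
      rw [run_phase val _ nI, run_phase val _ nI, Pi.add_apply, Finset.sum_apply]
      simp only [Pi.smul_apply, smul_eq_mul]
      split_ifs with hc
      · obtain ⟨τ, -, rfl⟩ := List.mem_map.1 hc
        rw [Finset.sum_eq_single τ]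
        · rw [ket_self, ha]; ring
        · intro τ' _ hne
          rw [ket_ne (by simpa using hne.symm), mul_zero]
        · simp
      · rw [Finset.sum_eq_zero, add_zero]
        intro τ _
        rw [ket_ne, mul_zero]
        rintro rfl
        exact hc (List.mem_map.2 ⟨τ, Env.mem_all _ _, rfl⟩)
    have hin (τ : Env Δ) : ψ (inL [] τ.bits) = (starRingEnd ℂ) (P τ v) := by
      rw [hψ, ← amp, amp_inv, hp]
    rw [key, map_add, map_sum, hψ, run_run_inv, ← hψ, Pi.add_apply, Finset.sum_apply]
    have hp' (τ : Env Δ) : run val p (ket (inL [] τ.bits)) (outL [] v'.enc 0) = P τ v' := hp τ v'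
    simp only [map_smul, Pi.smul_apply, smul_eq_mul, hin, hp']
    have hk : (ket (outL [] v.enc 0) : ℕ → ℂ) (outL [] v'.enc 0) = if v' = v then 1 else 0 := by
      simp [ket]
    rw [hk, mul_add, Finset.mul_sum]
    have : ∑ τ, a' * ((Complex.exp (Complex.I * angleVal val (negCode r')) * a - 1) *
        (starRingEnd ℂ) (P τ v) * P τ v') = (a - a') * ∑ τ, P τ v' * (starRingEnd ℂ) (P τ v) := by
      rw [Finset.mul_sum]
      refine Finset.sum_congr rfl fun τ _ => ?_
      linear_combination a * (starRingEnd ℂ) (P τ v) * P τ v' * haa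
    rw [this]; ring
  · exact table_map nV (fun i j h => by simpa using h) fun i j h => by simpa using h
  · exact table_map nV (fun i j h => by simpa using h) fun i j h => by simpa using h
  · exact List.mem_map.2 ⟨v, Val.mem_all _ _, rfl⟩
  · exact List.mem_map.2 ⟨v', Val.mem_all _ _, rfl⟩

/-! #### Error recovery -/

theorem mem_minus {l l' : List ℕ} {m : ℕ} : m ∈ minus l l' ↔ m ∈ l ∧ m ∉ l' := by
  simp only [minus, List.mem_flatMap]
  constructor
  · rintro ⟨x, hx, h⟩
    split_ifs at h with h'
    · simp at h
    · obtain rfl := List.mem_singleton.1 h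
      exact ⟨hx, fun hm => h' (List.idxOf_lt_length_iff.2 hm)⟩
  · rintro ⟨h, h'⟩
    exact ⟨m, h, by rw [if_neg fun e => h' (List.idxOf_lt_length_iff.1 e)]; simp⟩

theorem nodup_minus {l : List ℕ} (hl : l.Nodup) (l' : List ℕ) : (minus l l').Nodup := by
  have : minus l l' = l.filter fun x => ¬ l'.idxOf x < l'.length := by
    induction l with
    | nil => rfl
    | cons a l ih =>
      rw [minus, List.flatMap_cons, ← minus, ih (List.nodup_cons.1 hl).2, List.filter_cons]
      by_cases h : l'.idxOf a < l'.length <;> simp [h]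
  rw [this]
  exact hl.filter _

theorem lt_bound_of_mem {p : TL ℕ} {l : List ℕ} {m : ℕ} (h : m ∈ l) : m < bound p l := by
  induction p with
  | nil =>
    change m < l.foldr (fun x n => x + n) 1
    induction l with
    | nil => simp at h
    | cons a l ih =>
      have hpos (l : List ℕ) : 0 < l.foldr (fun x n => x + n) 1 := by
        induction l with
        | nil => simp
        | cons a l ih => rw [List.foldr_cons]; omega
      rw [List.foldr_cons]
      rcases List.mem_cons.1 h with rfl | h
      · have := hpos l; omega
      · have := ih h; omega
  | cons x p ih => rw [bound, List.foldr_cons, ← bound]; omega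

theorem lt_bound_of_mem_program {p : TL ℕ} (l : List ℕ) {x : ℕ × ℕ × Params} (h : x ∈ p) :
    x.1 < bound p l ∧ x.2.1 < bound p l := by
  have hpos (p : TL ℕ) : 0 < bound p l := by
    induction p with
    | nil =>
      change 0 < l.foldr (fun x n => x + n) 1
      induction l with
      | nil => simp
      | cons a l ih => rw [List.foldr_cons]; omega
    | cons x p ih => rw [bound, List.foldr_cons, ← bound]; omega
  induction p with
  | nil => simp at h
  | cons y p ih =>
    rw [bound, List.foldr_cons, ← bound]
    rcases List.mem_cons.1 h with rfl | h
    · have := hpos p; constructor <;> omega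
    · have := ih h; constructor <;> omega

theorem amp_eq_zero_of_bound_le {p : TL ℕ} {l : List ℕ} {a m : ℕ} (ha : a ∈ l)
    (hm : bound p l ≤ m) : amp val p m a = 0 := by
  rw [amp, run_untouched, ket_ne]
  · rintro rfl
    exact absurd (lt_bound_of_mem (p := p) ha) (not_lt.2 hm)
  · intro x hx
    have := lt_bound_of_mem_program l hx
    constructor <;> omega

section tryCatch
variable {Δ₀ Δ₁ : Ctx} {T : Ty} {p₀ p₁ : TL ℕ} {G₀ G₁ : List ℕ}

theorem nodup_leftover (D : List EnvBits) (V : List Bits) (p : TL ℕ) (G : List ℕ) :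
    (leftover D V p G).Nodup := nodup_minus List.nodup_range _

theorem outL_notMem_leftover (D : List EnvBits) (p : TL ℕ) {G : List ℕ} (v : Val T) {g : ℕ}
    (hg : g ∈ G) : outL [] v.enc g ∉ leftover D ((Val.all T).map Val.enc) p G := by
  rw [leftover, mem_minus, not_and, not_not]
  intro _
  exact List.mem_map.2 ⟨(v.enc, g), by simp [Val.mem_all, hg], rfl⟩

theorem amp_eq_zero_of_notMem_leftover {p : TL ℕ} {G : List ℕ} (τ : Env Δ₀) {m : ℕ}
    (hm : m ∉ leftover ((Env.all Δ₀).map Env.bits) ((Val.all T).map Val.enc) p G)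
    (hm' : ∀ v : Val T, ∀ g ∈ G, m ≠ outL [] v.enc g) : amp val p m (inL [] τ.bits) = 0 := by
  refine amp_eq_zero_of_bound_le val (l := ((Env.all Δ₀).map Env.bits).map (inL []))
    (List.mem_map_of_mem (List.mem_map_of_mem (Env.mem_all _ _))) (not_lt.1 fun h => hm ?_)
  rw [leftover, mem_minus, List.mem_range]
  refine ⟨h, fun h' => ?_⟩
  obtain ⟨⟨v, g⟩, hvg, e⟩ := List.mem_map.1 h'
  obtain ⟨hv, hg⟩ := List.mem_product.1 hvg
  obtain ⟨v, -, rfl⟩ := List.mem_map.1 hv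
  exact hm' v g hg e.symm

/-- The amplitudes of error recovery: those of success and those of failure. -/
theorem amp_tryCatch (hG₀ : G₀.Nodup) (hG₁ : G₁.Nodup) (τ₀ : Env Δ₀) (τ₁ : Env Δ₁) (v : Val T) :
    (∀ τ : Env Δ₁, ∀ g ∈ G₀,
      amp val (tryCatch ((Env.all Δ₀).map Env.bits) ((Env.all Δ₁).map Env.bits)
        ((Val.all T).map Val.enc) p₀ G₀ p₁ G₁)
        (outL [] v.enc (Nat.pair 0 (encode (τ.bits, g)))) (inL [] (τ₀.bits ++ τ₁.bits)) =
        if τ = τ₁ then amp val p₀ (outL [] v.enc g) (inL [] τ₀.bits) else 0) ∧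
    (∀ m ∈ leftover ((Env.all Δ₀).map Env.bits) ((Val.all T).map Val.enc) p₀ G₀, ∀ g ∈ G₁,
      amp val (tryCatch ((Env.all Δ₀).map Env.bits) ((Env.all Δ₁).map Env.bits)
        ((Val.all T).map Val.enc) p₀ G₀ p₁ G₁)
        (outL [] v.enc (Nat.pair 1 (encode (m, g)))) (inL [] (τ₀.bits ++ τ₁.bits)) =
        amp val p₁ (outL [] v.enc g) (inL [] τ₁.bits) * amp val p₀ m (inL [] τ₀.bits)) := by
  simp only [tryCatch]
  have hL := outL_notMem_leftover (T := T) ((Env.all Δ₀).map Env.bits) p₀ (G := G₀)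
  have nL := nodup_leftover ((Env.all Δ₀).map Env.bits) ((Val.all T).map Val.enc) p₀ G₀
  generalize leftover ((Env.all Δ₀).map Env.bits) ((Val.all T).map Val.enc) p₀ G₀ = L at hL nL ⊢
  simp only [List.map_map, Function.comp_def, List.product_map_left, List.product_map_right]
  have nD₀ := Env.nodup_all Δ₀
  have nD₁ := Env.nodup_all Δ₁
  have nV := Val.nodup_all T
  have h₁ : Table ((Env.all Δ₀ ×ˢ Env.all Δ₁).map fun i => (inCode [] (i.1.bits ++ i.2.bits),
      Nat.pair 0 (Nat.pair (encode i.2.bits) (inL [] i.1.bits)))) := by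
    refine table_map (nD₀.product nD₁) ?_ ?_
    · rintro ⟨a, b⟩ ⟨a', b'⟩ h
      simpa using h
    · rintro ⟨a, b⟩ ⟨a', b'⟩ h
      simp only [Nat.pair_eq_pair, Encodable.encode_inj, Prod.mk.injEq, Env.bits_inj, inL_inj] at h ⊢
      tauto
  have h₂ : Table ((Env.all Δ₁ ×ˢ L).map fun i => (Nat.pair (encode i.1.bits) i.2,
      Nat.pair i.2 (inL [] i.1.bits))) := by
    refine table_map (nD₁.product nL) ?_ ?_
    · rintro ⟨a, b⟩ ⟨a', b'⟩ h
      simpa [Nat.pair_eq_pair] using h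
    · rintro ⟨a, b⟩ ⟨a', b'⟩ h
      simp only [Nat.pair_eq_pair, Prod.mk.injEq, Env.bits_inj, inL_inj] at h ⊢
      tauto
  have h₃ : Table (((Val.all T ×ˢ Env.all Δ₁ ×ˢ G₀).map fun i =>
        (Nat.pair 0 (Nat.pair (encode i.2.1.bits) (outL [] i.1.enc i.2.2)),
          outCode [] i.1.enc (Nat.pair 0 (encode (i.2.1.bits, i.2.2))))) ++
      ((Val.all T ×ˢ L ×ˢ G₁).map fun i => (Nat.pair 1 (Nat.pair i.2.1 (outL [] i.1.enc i.2.2)),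
          outCode [] i.1.enc (Nat.pair 1 (encode i.2))))) := by
    have n₁ := nV.product (nD₁.product hG₀)
    have n₂ := nV.product (nL.product hG₁)
    have t₁ : Table ((Val.all T ×ˢ Env.all Δ₁ ×ˢ G₀).map fun i =>
        (Nat.pair 0 (Nat.pair (encode i.2.1.bits) (outL [] i.1.enc i.2.2)),
          outCode [] i.1.enc (Nat.pair 0 (encode (i.2.1.bits, i.2.2))))) := by
      refine table_map n₁ ?_ ?_
      · rintro ⟨a, b, c⟩ ⟨a', b', c'⟩ h
        simp only [Nat.pair_eq_pair, Prod.mk.injEq, Env.bits_inj, outL_inj, Encodable.encode_inj,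
          Val.enc_inj] at h ⊢
        tauto
      · rintro ⟨a, b, c⟩ ⟨a', b', c'⟩ h
        simp only [Nat.pair_eq_pair, Prod.mk.injEq, Env.bits_inj, outCode_inj, Encodable.encode_inj,
          Val.enc_inj] at h ⊢
        tauto
    have t₂ : Table ((Val.all T ×ˢ L ×ˢ G₁).map fun i =>
        (Nat.pair 1 (Nat.pair i.2.1 (outL [] i.1.enc i.2.2)),
          outCode [] i.1.enc (Nat.pair 1 (encode i.2)))) := by
      refine table_map n₂ ?_ ?_
      · rintro ⟨a, b, c⟩ ⟨a', b', c'⟩ h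
        simp only [Nat.pair_eq_pair, Prod.mk.injEq, outL_inj, Val.enc_inj] at h ⊢
        tauto
      · rintro ⟨a, b, c⟩ ⟨a', b', c'⟩ h
        simp only [Nat.pair_eq_pair, Prod.mk.injEq, outCode_inj, Encodable.encode_inj,
          Val.enc_inj] at h ⊢
        tauto
    rw [Table, List.map_append, List.map_append]
    refine ⟨t₁.1.append t₂.1 ?_, t₁.2.append t₂.2 ?_⟩
    · intro x hx hx'
      simp only [List.map_map, List.mem_map, Function.comp_apply] at hx hx'
      obtain ⟨i, -, rfl⟩ := hx
      obtain ⟨j, -, hj⟩ := hx'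
      simp [Nat.pair_eq_pair] at hj
    · intro x hx hx'
      simp only [List.map_map, List.mem_map, Function.comp_apply] at hx hx'
      obtain ⟨i, -, rfl⟩ := hx
      obtain ⟨j, -, hj⟩ := hx'
      simp [Nat.pair_eq_pair] at hj
  have hin : (inCode [] (τ₀.bits ++ τ₁.bits),
      Nat.pair 0 (Nat.pair (encode τ₁.bits) (inL [] τ₀.bits))) ∈
      (Env.all Δ₀ ×ˢ Env.all Δ₁).map fun i => (inCode [] (i.1.bits ++ i.2.bits),
      Nat.pair 0 (Nat.pair (encode i.2.bits) (inL [] i.1.bits))) :=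
    List.mem_map.2 ⟨(τ₀, τ₁), by simp [Env.mem_all], rfl⟩
  have hfam (τ : ℕ) (m a : ℕ) :
      amp val (fam ((Env.all Δ₁).map fun x => (encode x.bits, p₀))) (Nat.pair τ m)
        (Nat.pair (encode τ₁.bits) a) = if τ = encode τ₁.bits then amp val p₀ m a else 0 := by
    rw [amp_fam_map val (tag := fun i : Env Δ₁ => encode i.bits)]
    · exact nD₁.map fun i j h => by simpa using h
    · exact Env.mem_all _ _
  rw [inL]
  refine ⟨fun τ g hg => ?_, fun m hm g hg => ?_⟩
  · rw [outL, amp_wrap val h₁ h₃ _ hin (List.mem_append_left _ (List.mem_map.2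
      ⟨(v, τ, g), by simp [Env.mem_all, Val.mem_all, hg], rfl⟩)), amp_join_left val h₂, hfam]
    · simp
    · simp only [List.map_map, List.mem_map, Function.comp_apply, Nat.pair_eq_pair, not_exists,
        not_and]
      rintro ⟨τ', m⟩ hi - rfl
      exact hL v hg (List.mem_product.1 hi).2
  · rw [outL, amp_wrap val h₁ h₃ _ hin (List.mem_append_right _ (List.mem_map.2
      ⟨(v, m, g), by simp [Val.mem_all, hg, hm], rfl⟩)), amp_join val h₂, List.map_map]
    have hfam' (i : Env Δ₁ × ℕ) (hi : i.2 ∈ L) :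
        amp val (fam (L.map fun x => (x, p₁))) (Nat.pair m (outL [] v.enc g))
          (Nat.pair i.2 (inL [] i.1.bits)) =
        if m = i.2 then amp val p₁ (outL [] v.enc g) (inL [] i.1.bits) else 0 := by
      rw [amp_fam_map val (tag := fun i : ℕ => i) (by simpa using nL) _ hi]
    simp only [Function.comp_def]
    rw [List.sum_map_single (nD₁.product nL) (i := (τ₁, m))]
    · rw [hfam' (τ₁, m) hm, hfam, if_pos rfl, if_pos rfl]
    · simp [Env.mem_all, hm]
    · rintro ⟨τ', m'⟩ hi hne
      rw [hfam' (τ', m') (List.mem_product.1 hi).2, hfam]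
      by_cases e : m = m'
      · rw [if_neg (c := encode τ'.bits = encode τ₁.bits), mul_zero]
        intro e'
        exact hne (by rw [← e, Env.bits_inj.1 (Encodable.encode_injective e')])
      · rw [if_neg e, zero_mul]

/-- The amplitude that is left over accounts for the missing part of the trace. -/
theorem sum_leftover (hG₀ : G₀.Nodup) (τ τ' : Env Δ₀) :
    ((leftover ((Env.all Δ₀).map Env.bits) ((Val.all T).map Val.enc) p₀ G₀).map fun m =>
      amp val p₀ m (inL [] τ.bits) * (starRingEnd ℂ) (amp val p₀ m (inL [] τ'.bits))).sum =
    (if τ = τ' then 1 else 0) - ∑ v : Val T, (G₀.map fun g =>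
      amp val p₀ (outL [] v.enc g) (inL [] τ.bits) *
        (starRingEnd ℂ) (amp val p₀ (outL [] v.enc g) (inL [] τ'.bits))).sum := by
  classical
  have nL := nodup_leftover ((Env.all Δ₀).map Env.bits) ((Val.all T).map Val.enc) p₀ G₀
  have nO : ((Val.all T ×ˢ G₀).map fun i => outL [] i.1.enc i.2).Nodup :=
    ((Val.nodup_all T).product hG₀).map fun i j h => by simpa [Prod.ext_iff] using h
  have hdisj : List.Disjoint
      (leftover ((Env.all Δ₀).map Env.bits) ((Val.all T).map Val.enc) p₀ G₀)
      ((Val.all T ×ˢ G₀).map fun i => outL [] i.1.enc i.2) := by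
    intro m hm hm'
    obtain ⟨i, hi, rfl⟩ := List.mem_map.1 hm'
    exact outL_notMem_leftover _ p₀ i.1 (List.mem_product.1 hi).2 hm
  have key := sum_conj_amp_mul_amp val p₀
    (leftover ((Env.all Δ₀).map Env.bits) ((Val.all T).map Val.enc) p₀ G₀ ++
      (Val.all T ×ˢ G₀).map fun i => outL [] i.1.enc i.2).toFinset (inL [] τ.bits) (inL [] τ'.bits)
    (fun m hm => by
      simp only [List.mem_toFinset, List.mem_append, not_or] at hm
      refine amp_eq_zero_of_notMem_leftover val τ hm.1 fun v g hg e => hm.2 ?_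
      exact List.mem_map.2 ⟨(v, g), by simp [Val.mem_all, hg], e.symm⟩)
  rw [List.sum_toFinset _ (nL.append nO hdisj), List.map_append, List.sum_append, List.map_map] at key
  rw [← List.sum_map_eq_sum_univ (Val.nodup_all T) (Val.mem_all T), ← List.sum_map_product
    (Val.all T) G₀ (fun i => amp val p₀ (outL [] i.1.enc i.2) (inL [] τ.bits) *
        (starRingEnd ℂ) (amp val p₀ (outL [] i.1.enc i.2) (inL [] τ'.bits))), eq_sub_iff_add_eq]
  simp only [mul_comm (amp val p₀ _ (inL [] τ.bits))]
  refine key.trans ?_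
  simp [ket, eq_comm]

end tryCatch

end Rule
end

/-! ### Amplitudes of coherent control -/

section
variable {R : Type} [Encodable R] (val : R → ℝ)

theorem List.range_eq_map_finRange (n : ℕ) : List.range n = (List.finRange n).map Fin.val := by
  simp

namespace Rule
open TL

theorem branches_ofFn {n : ℕ} {Γs : Fin n → Ctx} {T : Ty} (g : ∀ j, Env (Γs j) → Val T) :
    branches n (List.ofFn fun j => (Env.all (Γs j)).map fun σ => (σ.bits, (g j σ).enc)) =
      ((List.finRange n).sigma fun j => Env.all (Γs j)).map fun x =>
        (x.1.val, x.2.bits, (g x.1 x.2).enc) := by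
  rw [branches, List.range_eq_map_finRange, List.flatMap_map, List.sigma, List.map_flatMap]
  refine List.flatMap_congr fun j _ => ?_
  simp [List.getD_eq_getElem?_getD, Function.comp_def]

variable {Γ Γ' Δ Δ' : Ctx} {T T' : Ty} {n : ℕ} {Γs : Fin n → Ctx}
  {g : ∀ j, Env (Γs j) → Val T} {p : TL ℕ} {G : List ℕ} {q : Fin n → TL ℕ}
  {E : ∀ j, Env (Γ ++ Γ' ++ Γs j) → Env (Δ ++ Δ') → Val T' → ℂ}

/-- The amplitudes of coherent control. As different valuations of patterns denote different values,
the value that the controlling program computes determines the branch. Undoing that program from the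
same value and garbage label multiplies its amplitude by the complex conjugate, and the sum over the
garbage labels is the probability of the value. -/
theorem amp_ctrl (hG : G.Nodup)
    (hg : ∀ j j' σ σ', g j σ = g j' σ' → (⟨j, σ⟩ : Σ j, Env (Γs j)) = ⟨j', σ'⟩)
    (hq : ∀ j σ τ σ' v, amp val (q j) (outL σ'.bits v.enc 0) (inL σ.bits τ.bits) =
      if σ' = σ then E j σ τ v else 0)
    (rd : List (ℕ × ℕ)) (σ : Env Γ) (σ' : Env Γ') (τ : Env Δ) (τ' : Env Δ') (ρ : Env Γ)
    (ρ' : Env Γ') (v : Val T') :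
    amp val (ctrl ((Env.all Γ).map Env.bits) ((Env.all Γ').map Env.bits) ((Env.all Δ).map Env.bits)
      ((Env.all Δ').map Env.bits) ((Val.all T).map Val.enc) ((Val.all T').map Val.enc) n
      (List.ofFn fun j => (Env.all (Γs j)).map fun σ => (σ.bits, (g j σ).enc)) rd p G (List.ofFn q))
      (outL (ρ.bits ++ ρ'.bits) v.enc 0) (inL (σ.bits ++ σ'.bits) (τ.bits ++ τ'.bits)) =
    if ρ = σ ∧ ρ' = σ' ∧ readBits rd v.enc = τ.bits then
      ∑ j, ∑ σj : Env (Γs j), (G.map fun k =>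
        amp val p (outL [] (g j σj).enc k) (inL [] (σ.bits ++ τ.bits)) *
        (starRingEnd ℂ) (amp val p (outL [] (g j σj).enc k) (inL [] (σ.bits ++ τ.bits)))).sum *
        E j ((σ.append σ').append σj) (τ.append τ') v
    else 0 := by
  classical
  have nS := (Env.nodup_all Γ).product (Env.nodup_all Γ')
  have nD := Env.nodup_all Δ
  have nD' := Env.nodup_all Δ'
  have nV := Val.nodup_all T
  have nV' := Val.nodup_all T'
  have nB : ((List.finRange n).sigma fun j => Env.all (Γs j)).Nodup :=
    (List.nodup_finRange n).sigma fun j => Env.nodup_all _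
  have nN : (List.finRange n).Nodup := List.nodup_finRange n
  have mB (x : Σ j, Env (Γs j)) : x ∈ (List.finRange n).sigma fun j => Env.all (Γs j) :=
    List.mem_sigma.2 ⟨List.mem_finRange _, Env.mem_all _ _⟩
  have hg' (x y : Σ j, Env (Γs j)) : g x.1 x.2 = g y.1 y.2 ↔ x = y :=
    ⟨fun h => hg _ _ _ _ h, fun h => by rw [h]⟩
  simp only [ctrl, branches_ofFn, List.range_eq_map_finRange, List.map_map, Function.comp_def,
    List.product_map_left, List.product_map_right]
  simp only [List.getD_eq_getElem?_getD, List.getElem?_ofFn, Fin.is_lt, dite_true, Fin.eta,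
    Option.getD_some]
  generalize (List.finRange n).sigma (fun j => Env.all (Γs j)) = B at nB mB
  rw [outL, inL, amp_wrap val
    (k := Nat.pair 0 (Nat.pair 0 (Nat.pair (encode ((σ.bits, σ'.bits), τ.bits, τ'.bits))
      (inL [] (σ.bits ++ τ.bits)))))
    (k' := Nat.pair 1 (Nat.pair (encode ((ρ.bits, ρ'.bits), readBits rd v.enc, v.enc))
        (inL [] (ρ.bits ++ readBits rd v.enc)))),
    amp_join, List.map_map]
  · simp only [Function.comp_def]
    -- the three stages: undoing `p` (`keyC`), the branches (`keyB`), and running `p` (`keyA`)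
    have keyC (s : Env Γ) (s' : Env Γ') (t : Env Δ) (w : Val T') (x : Σ j, Env (Γs j)) (k : ℕ) :
        amp val (fam (((Env.all Γ ×ˢ Env.all Γ') ×ˢ Env.all Δ ×ˢ Val.all T').map fun x =>
            (encode ((x.1.1.bits, x.1.2.bits), x.2.1.bits, x.2.2.enc), p.inv)))
          (Nat.pair (encode ((ρ.bits, ρ'.bits), readBits rd v.enc, v.enc))
            (inL [] (ρ.bits ++ readBits rd v.enc)))
          (Nat.pair (encode ((s.bits, s'.bits), t.bits, w.enc)) (outL [] (g x.1 x.2).enc k)) =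
        if ρ = s ∧ ρ' = s' ∧ readBits rd v.enc = t.bits ∧ v = w then
          (starRingEnd ℂ) (amp val p (outL [] (g x.1 x.2).enc k)
            (inL [] (ρ.bits ++ readBits rd v.enc))) else 0 := by
      rw [amp_fam_map val (tag := fun i : (Env Γ × Env Γ') × Env Δ × Val T' =>
        encode ((i.1.1.bits, i.1.2.bits), i.2.1.bits, i.2.2.enc)) (i := ((s, s'), t, w)), amp_inv]
      · simp only [Encodable.encode_inj, Prod.mk.injEq, Env.bits_inj, Val.enc_inj, and_assoc]
      · exact (nS.product (nD.product nV')).map fun i j h => by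
          simpa [Prod.ext_iff, and_assoc] using h
      · simp [Env.mem_all, Val.mem_all]
    have keyB (j : Fin n) (t : Env Δ) (u : Val T) (k : ℕ) (hk : k ∈ G) (m a y : ℕ) :
        amp val (fam ((List.finRange n ×ˢ Env.all Δ ×ˢ Val.all T ×ˢ G).map fun x =>
            (encode (x.1.val, x.2.1.bits, x.2.2.1.enc, x.2.2.2), q x.1)))
          (Nat.pair y m) (Nat.pair (encode (j.val, t.bits, u.enc, k)) a) =
        if y = encode (j.val, t.bits, u.enc, k) then amp val (q j) m a else 0 := by
      rw [amp_fam_map val (tag := fun i : Fin n × Env Δ × Val T × ℕ =>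
        encode (i.1.val, i.2.1.bits, i.2.2.1.enc, i.2.2.2)) (i := (j, t, u, k))]
      · exact (nN.product (nD.product (nV.product hG))).map fun i j h => by
          simpa [Prod.ext_iff, Fin.ext_iff] using h
      · simp [Env.mem_all, Val.mem_all, hk]
    have keyA (i : (Env Γ × Env Γ') × Env Δ × Env Δ') (m a : ℕ) :
        amp val (fam (((Env.all Γ ×ˢ Env.all Γ') ×ˢ Env.all Δ ×ˢ Env.all Δ').map fun x =>
            (encode ((x.1.1.bits, x.1.2.bits), x.2.1.bits, x.2.2.bits), p)))
          (Nat.pair (encode ((i.1.1.bits, i.1.2.bits), i.2.1.bits, i.2.2.bits)) m)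
          (Nat.pair (encode ((σ.bits, σ'.bits), τ.bits, τ'.bits)) a) =
        if i = ((σ, σ'), τ, τ') then amp val p m a else 0 := by
      rw [amp_fam_map val (tag := fun i : (Env Γ × Env Γ') × Env Δ × Env Δ' =>
        encode ((i.1.1.bits, i.1.2.bits), i.2.1.bits, i.2.2.bits)) (i := ((σ, σ'), τ, τ'))]
      · simp [Prod.ext_iff]
      · exact (nS.product (nD.product nD')).map fun i j h => by
          simpa [Prod.ext_iff] using h
      · simp [Env.mem_all]
    have keyJ (s : Env Γ) (s' : Env Γ') (t : Env Δ) (w : Val T') (x : Σ j, Env (Γs j)) (k : ℕ)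
        (hk : k ∈ G) (t₁ : List (ℕ × ℕ)) (ht₁ : t₁ =
          ((((Env.all Γ ×ˢ Env.all Γ') ×ˢ Env.all Δ ×ˢ Env.all Δ') ×ˢ B ×ˢ G).map fun x =>
            (Nat.pair (encode ((x.1.1.1.bits, x.1.1.2.bits), x.1.2.1.bits, x.1.2.2.bits))
              (outL [] (g x.2.1.1 x.2.1.2).enc x.2.2),
            Nat.pair (encode (x.2.1.1.val, x.1.2.1.bits, (g x.2.1.1 x.2.1.2).enc, x.2.2))
              (inL (x.1.1.1.bits ++ x.1.1.2.bits ++ x.2.1.2.bits)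
                (x.1.2.1.bits ++ x.1.2.2.bits))))) :
        amp val (join (fam (((Env.all Γ ×ˢ Env.all Γ') ×ˢ Env.all Δ ×ˢ Env.all Δ').map fun x =>
            (encode ((x.1.1.bits, x.1.2.bits), x.2.1.bits, x.2.2.bits), p))) t₁
          (fam ((List.finRange n ×ˢ Env.all Δ ×ˢ Val.all T ×ˢ G).map fun x =>
            (encode (x.1.val, x.2.1.bits, x.2.2.1.enc, x.2.2.2), q x.1))))
          (Nat.pair 1 (Nat.pair (encode (x.1.val, t.bits, (g x.1 x.2).enc, k))
            (outL (s.bits ++ s'.bits ++ x.2.bits) w.enc 0)))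
          (Nat.pair 0 (Nat.pair (encode ((σ.bits, σ'.bits), τ.bits, τ'.bits))
            (inL [] (σ.bits ++ τ.bits)))) =
        if s = σ ∧ s' = σ' ∧ t = τ then E x.1 ((σ.append σ').append x.2) (τ.append τ') w *
          amp val p (outL [] (g x.1 x.2).enc k) (inL [] (σ.bits ++ τ.bits)) else 0 := by
      subst ht₁
      rw [amp_join, List.map_map]
      · simp only [Function.comp_def]
        rw [List.sum_map_single (i := (((σ, σ'), τ, τ'), x, k))]
        · rw [keyA ((σ, σ'), τ, τ'), if_pos rfl, keyB _ _ _ _ hk]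
          simp only [← Env.bits_append]
          rw [hq]
          simp only [Encodable.encode_inj, Prod.mk.injEq, Env.bits_inj, Env.append_inj,
            true_and, and_true]
          by_cases h₁ : t = τ
          · by_cases h₂ : s = σ ∧ s' = σ'
            · simp [h₁, h₂]
            · rw [if_neg h₂, ite_self, zero_mul, if_neg fun h => h₂ ⟨h.1, h.2.1⟩]
          · rw [if_neg h₁, zero_mul, if_neg fun h => h₁ h.2.2]
        · exact (nS.product (nD.product nD')).product (nB.product hG)
        · simp [Env.mem_all, hk, mB]
        · rintro ⟨i, y, k'⟩ hi hne
          simp only [List.mem_product] at hi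
          dsimp only
          rw [keyA i, keyB _ _ _ _ hi.2.2]
          by_cases h₁ : i = ((σ, σ'), τ, τ')
          · rw [if_neg, zero_mul]
            simp only [Encodable.encode_inj, Prod.mk.injEq, Val.enc_inj, hg']
            rintro ⟨-, -, rfl, rfl⟩
            exact hne (by rw [h₁])
          · rw [if_neg h₁, mul_zero]
      · refine table_map ((nS.product (nD.product nD')).product (nB.product hG)) ?_ ?_
        · rintro ⟨⟨⟨a, b⟩, c, d⟩, y, k⟩ ⟨⟨⟨a', b'⟩, c', d'⟩, y', k'⟩ h
          simp only [Nat.pair_eq_pair, Encodable.encode_inj, Prod.mk.injEq, Env.bits_inj, outL_inj,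
            Val.enc_inj, hg'] at h ⊢
          tauto
        · rintro ⟨⟨⟨a, b⟩, c, d⟩, y, k⟩ ⟨⟨⟨a', b'⟩, c', d'⟩, y', k'⟩ h
          simp only [Nat.pair_eq_pair, Encodable.encode_inj, Prod.mk.injEq, Env.bits_inj, inL_inj,
            Val.enc_inj, hg'] at h ⊢
          obtain ⟨⟨h₁, h₂, rfl, h₃⟩, h₄⟩ := h
          simp only [← Env.bits_append, Env.bits_inj, Env.append_inj] at h₄
          tauto
    rw [List.sum_map_reindex (l' := B ×ˢ G) (e := fun i => (((ρ, ρ'), τ, v), i))]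
    · have hs (i : (Σ j, Env (Γs j)) × ℕ) (hi : i ∈ B ×ˢ G) := congrArg₂ (· * ·)
        (keyC ρ ρ' τ v i.1 i.2) (keyJ ρ ρ' τ v i.1 i.2 (List.mem_product.1 hi).2 _ rfl)
      rw [List.map_congr_left hs]
      by_cases h : ρ = σ ∧ ρ' = σ' ∧ readBits rd v.enc = τ.bits
      · rw [if_pos h, List.sum_map_product, List.sum_map_eq_sum_univ nB mB, Fintype.sum_sigma]
        obtain ⟨rfl, rfl, h⟩ := h
        simp only [h, and_self, if_true]
        refine Finset.sum_congr rfl fun j _ => Finset.sum_congr rfl fun σj _ => ?_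
        rw [← List.sum_map_mul_right]
        refine congrArg List.sum (List.map_congr_left fun k _ => ?_)
        ring
      · rw [if_neg h]
        refine List.sum_eq_zero fun z hz => ?_
        obtain ⟨i, -, rfl⟩ := List.mem_map.1 hz
        by_cases h' : readBits rd v.enc = τ.bits
        · rw [if_neg (c := ρ = σ ∧ ρ' = σ' ∧ τ = τ) fun e => h ⟨e.1, e.2.1, h'⟩, mul_zero]
        · rw [if_neg fun e => h' e.2.2.1, zero_mul]
    · exact (nS.product (nD.product nV')).product (nB.product hG)
    · exact nB.product hG
    · exact fun i j h => (Prod.mk.injEq _ _ _ _ ▸ h).2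
    · rintro ⟨x, k⟩ hi
      simp only [List.mem_product] at hi ⊢
      exact ⟨⟨⟨Env.mem_all _ _, Env.mem_all _ _⟩, Env.mem_all _ _, Val.mem_all _ _⟩, hi⟩
    · rintro ⟨⟨⟨s, s'⟩, t, w⟩, x, k⟩ hi hne
      have hk : k ∈ G := (List.mem_product.1 (List.mem_product.1 hi).2).2
      refine (congrArg₂ (· * ·) (keyC s s' t w x k) (keyJ s s' t w x k hk _ rfl)).trans ?_
      by_cases h₁ : ρ = s ∧ ρ' = s' ∧ readBits rd v.enc = t.bits ∧ v = w
      · by_cases h₂ : s = σ ∧ s' = σ' ∧ t = τ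
        · refine (hne (x, k) (List.mem_product.1 hi).2 ?_).elim
          rw [h₁.1, h₁.2.1, h₁.2.2.2, h₂.2.2]
        · rw [if_neg h₂]; exact mul_zero _
      · rw [if_neg h₁]; exact zero_mul _
  · refine table_map ((nS.product (nD.product nV')).product (nB.product hG)) ?_ ?_
    · rintro ⟨⟨⟨a, b⟩, c, d⟩, y, k⟩ ⟨⟨⟨a', b'⟩, c', d'⟩, y', k'⟩ h
      simp only [Nat.pair_eq_pair, Encodable.encode_inj, Prod.mk.injEq, Env.bits_inj, outL_inj,
        Val.enc_inj, hg'] at h ⊢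
      obtain ⟨-, ⟨h₁, h₂, rfl, h₃⟩, h₄⟩ := h
      simp only [← Env.bits_append, Env.bits_inj, Env.append_inj] at h₄
      tauto
    · rintro ⟨⟨⟨a, b⟩, c, d⟩, y, k⟩ ⟨⟨⟨a', b'⟩, c', d'⟩, y', k'⟩ h
      simp only [Nat.pair_eq_pair, Encodable.encode_inj, Prod.mk.injEq, Env.bits_inj, outL_inj,
        Val.enc_inj, hg'] at h ⊢
      tauto
  · refine table_map (nS.product (nD.product nD')) ?_ ?_
    · rintro ⟨⟨a, b⟩, c, d⟩ ⟨⟨a', b'⟩, c', d'⟩ h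
      simp only [inCode_inj, Prod.mk.injEq, Env.bits_append_inj] at h ⊢
      tauto
    · rintro ⟨⟨a, b⟩, c, d⟩ ⟨⟨a', b'⟩, c', d'⟩ h
      simp only [Nat.pair_eq_pair, Encodable.encode_inj, Prod.mk.injEq, Env.bits_inj] at h ⊢
      tauto
  · refine table_map (nS.product nV') ?_ ?_
    · rintro ⟨⟨a, b⟩, c⟩ ⟨⟨a', b'⟩, c'⟩ h
      simp only [Nat.pair_eq_pair, Encodable.encode_inj, Prod.mk.injEq, Env.bits_inj,
        Val.enc_inj] at h ⊢
      tauto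
    · rintro ⟨⟨a, b⟩, c⟩ ⟨⟨a', b'⟩, c'⟩ h
      simp only [outCode_inj, Prod.mk.injEq, Env.bits_append_inj, Val.enc_inj] at h ⊢
      tauto
  · exact List.mem_map.2 ⟨((σ, σ'), τ, τ'), by simp [Env.mem_all], rfl⟩
  · exact List.mem_map.2 ⟨((ρ, ρ'), v), by simp [Env.mem_all, Val.mem_all], rfl⟩

end Rule
end

/-! ### Patterns -/

section
variable {R : Type}

/-- Patterns of a type: built from variables by the constructors of values. -/
inductive IsPattern : Ty → Expr R → Prop
  | unit : IsPattern .unit .unit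
  | var (T : Ty) (x : Var) : IsPattern T (.var x)
  | left {T₀ : Ty} (T₁ : Ty) {e : Expr R} (h : IsPattern T₀ e) :
      IsPattern (.sum T₀ T₁) (.app (.left T₀ T₁) e)
  | right (T₀ : Ty) {T₁ : Ty} {e : Expr R} (h : IsPattern T₁ e) :
      IsPattern (.sum T₀ T₁) (.app (.right T₀ T₁) e)
  | pair {T₀ T₁ : Ty} {e₀ e₁ : Expr R} (h₀ : IsPattern T₀ e₀) (h₁ : IsPattern T₁ e₁) :
      IsPattern (.prod T₀ T₁) (.pair e₀ e₁)

/-- The value has the shape prescribed by the pattern. -/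
inductive FitsPattern : (T : Ty) → Expr R → Val T → Prop
  | unit (v : Val .unit) : FitsPattern .unit .unit v
  | var (T : Ty) (x : Var) (v : Val T) : FitsPattern T (.var x) v
  | left {T₀ T₁ : Ty} {e : Expr R} {v : Val T₀} (h : FitsPattern T₀ e v) :
      FitsPattern (.sum T₀ T₁) (.app (.left T₀ T₁) e) (Val.mkLeft T₀ T₁ v)
  | right {T₀ T₁ : Ty} {e : Expr R} {v : Val T₁} (h : FitsPattern T₁ e v) :
      FitsPattern (.sum T₀ T₁) (.app (.right T₀ T₁) e) (Val.mkRight T₀ T₁ v)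
  | pair {T₀ T₁ : Ty} {e₀ e₁ : Expr R} {v : Val T₀} {w : Val T₁} (h₀ : FitsPattern T₀ e₀ v)
      (h₁ : FitsPattern T₁ e₁ w) : FitsPattern (.prod T₀ T₁) (.pair e₀ e₁) ((v, w) : Val T₀ × Val T₁)

theorem FitsPattern.of_left {T₀ T₁ : Ty} {e : Expr R} {u : Val (.sum T₀ T₁)}
    (h : FitsPattern (.sum T₀ T₁) (.app (.left T₀ T₁) e) u) :
    ∃ v, u = Val.mkLeft T₀ T₁ v ∧ FitsPattern T₀ e v := by
  cases h with
  | left h => exact ⟨_, rfl, h⟩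

theorem FitsPattern.of_right {T₀ T₁ : Ty} {e : Expr R} {u : Val (.sum T₀ T₁)}
    (h : FitsPattern (.sum T₀ T₁) (.app (.right T₀ T₁) e) u) :
    ∃ v, u = Val.mkRight T₀ T₁ v ∧ FitsPattern T₁ e v := by
  cases h with
  | right h => exact ⟨_, rfl, h⟩

theorem FitsPattern.of_pair {T₀ T₁ : Ty} {e₀ e₁ : Expr R} {u : Val T₀ × Val T₁}
    (h : FitsPattern (.prod T₀ T₁) (.pair e₀ e₁) u) :
    FitsPattern T₀ e₀ u.1 ∧ FitsPattern T₁ e₁ u.2 := by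
  cases h with
  | pair h₀ h₁ => exact ⟨h₀, h₁⟩

/-- No value fits both patterns. -/
def DisjointPatterns (T : Ty) (e e' : Expr R) : Prop :=
  ∀ v, FitsPattern T e v → ¬ FitsPattern T e' v

theorem LPerm.perm {α : Type} : {l l' : List α} → LPerm l l' → l.Perm l'
  | _, _, .nil => List.Perm.nil
  | _, _, .cons a p => p.perm.cons a
  | _, _, .swap a b l => List.Perm.swap b a l
  | _, _, .trans p q => p.perm.trans q.perm

theorem LSub.sublist {α : Type} : {l l' : List α} → LSub l l' → l.Sublist l'
  | _, _, .nil => List.Sublist.slnil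
  | _, _, .drop a s => s.sublist.cons a
  | _, _, .keep a s => s.sublist.cons_cons a

theorem Spanning.patterns : {T : Ty} → {es : List (Expr R)} → Spanning R T es →
    (∀ e ∈ es, IsPattern T e) ∧ es.Pairwise (DisjointPatterns T)
  | _, _, .void => by simp
  | _, _, .unit => by simp [IsPattern.unit]
  | _, _, .var T x => by simp [IsPattern.var]
  | _, _, .sum (T := T) (T' := T') s s' => by
    obtain ⟨h₁, h₂⟩ := s.patterns
    obtain ⟨h₁', h₂'⟩ := s'.patterns
    refine ⟨?_, ?_⟩
    · intro e he
      rcases List.mem_append.1 he with he | he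
      · obtain ⟨e', he', rfl⟩ := List.mem_map.1 he
        exact (h₁ e' he').left T'
      · obtain ⟨e', he', rfl⟩ := List.mem_map.1 he
        exact (h₁' e' he').right T
    · rw [List.pairwise_append, List.pairwise_map, List.pairwise_map]
      refine ⟨h₂.imp ?_, h₂'.imp ?_, ?_⟩
      · intro e e' h u hu hu'
        obtain ⟨v, rfl, hv⟩ := hu.of_left
        obtain ⟨w, hw, hv'⟩ := hu'.of_left
        exact h v hv (Sum.inl_injective hw ▸ hv')
      · intro e e' h u hu hu'
        obtain ⟨v, rfl, hv⟩ := hu.of_right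
        obtain ⟨w, hw, hv'⟩ := hu'.of_right
        exact h v hv (Sum.inr_injective hw ▸ hv')
      · intro e he e' he' u hu hu'
        obtain ⟨e, -, rfl⟩ := List.mem_map.1 he
        obtain ⟨e', -, rfl⟩ := List.mem_map.1 he'
        obtain ⟨v, rfl, hv⟩ := hu.of_left
        obtain ⟨w, hw, hv'⟩ := hu'.of_right
        exact Sum.inl_ne_inr hw
  | _, _, .pair (T := T) (T' := T') (m := m) e es' s s' h => by
    obtain ⟨h₁, h₂⟩ := s.patterns
    have h' := fun j => (s' j).patterns
    refine ⟨?_, ?_⟩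
    · intro u hu
      obtain ⟨l, hl, hu⟩ := List.mem_flatten.1 hu
      obtain ⟨j, rfl⟩ := List.mem_ofFn.1 hl
      obtain ⟨e', he', rfl⟩ := List.mem_map.1 hu
      exact .pair (h₁ _ (List.mem_ofFn.2 ⟨j, rfl⟩)) ((h' j).1 e' he')
    · rw [List.pairwise_flatten]
      refine ⟨?_, ?_⟩
      · intro l hl
        obtain ⟨j, rfl⟩ := List.mem_ofFn.1 hl
        rw [List.pairwise_map]
        exact (h' j).2.imp fun h u hu hu' => h u.2 hu.of_pair.2 hu'.of_pair.2
      · rw [List.pairwise_ofFn] at h₂ ⊢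
        intro i j hij x hx y hy u hu hu'
        obtain ⟨e', -, rfl⟩ := List.mem_map.1 hx
        obtain ⟨e'', -, rfl⟩ := List.mem_map.1 hy
        exact h₂ hij u.1 hu.of_pair.1 hu'.of_pair.1
  | _, _, .perm s π => by
    obtain ⟨h₁, h₂⟩ := s.patterns
    refine ⟨fun e he => h₁ e (π.perm.mem_iff.2 he), ?_⟩
    exact h₂.perm π.perm fun h v hv hv' => h v hv' hv

theorem Ortho.patterns {T : Ty} {es : List (Expr R)} : Ortho R T es →
    (∀ e ∈ es, IsPattern T e) ∧ es.Pairwise (DisjointPatterns T)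
  | .mk s u => ⟨fun e he => s.patterns.1 e (u.sublist.subset he), s.patterns.2.sublist u.sublist⟩

theorem ite_mul_ite_eq {α β : Type} [DecidableEq α] [DecidableEq β] (v a : α) (w b : β)
    [Decidable ((v, w) = (a, b))] : ((if v = a then 1 else 0) * if w = b then 1 else 0 : ℂ) =
      if (v, w) = (a, b) then 1 else 0 := by
  by_cases h₁ : v = a <;> by_cases h₂ : w = b <;> simp [h₁, h₂]

theorem look_map {ι : Type} {l : List ι} (hl : l.Nodup) {k : ι → EnvBits}
    (hk : Function.Injective k) (f : ι → Bits) {i : ι} (hi : i ∈ l) :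
    look (l.map fun i => (k i, f i)) (k i) = f i := by
  have h0 (l : List ι) (hi : i ∉ l) : look (l.map fun i => (k i, f i)) (k i) = [] := by
    rw [look, List.flatMap_eq_nil_iff]
    intro x hx
    obtain ⟨j, hj, rfl⟩ := List.mem_map.1 hx
    exact if_neg fun h => hi (by rwa [← hk h])
  induction l with
  | nil => simp at hi
  | cons j l ih =>
    rw [List.nodup_cons] at hl
    rw [List.map_cons, look, List.flatMap_cons, ← look]
    rcases List.mem_cons.1 hi with rfl | hi
    · rw [if_pos rfl, h0 l hl.1, List.append_nil]
    · rw [if_neg (fun h => hl.1 (by rwa [hk h])), ih hl.2 hi, List.nil_append]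

theorem mul_of_eq_ite {α β γ κ : Type} [Fintype β] [DecidableEq β] [DecidableEq γ]
    {f : β → γ} {g : α → β} {M : κ → Matrix β α ℂ}
    (hM : ∀ σ v τ, M σ v τ = if v = g τ then 1 else 0) {σ : κ} (v : γ) (τ : α) :
    ((Matrix.of fun v' v => if v' = f v then 1 else 0 : Matrix γ β ℂ) * M σ) v τ =
      if v = f (g τ) then 1 else 0 := by
  simp [Matrix.mul_apply, hM]

variable [Encodable R] (val : R → ℝ)

/-- A pattern denotes an injection of valuations into the values of its shape, which the compiler
tabulates. -/
theorem PureE.pattern : {Γ Δ : Ctx} → {e : Expr R} → {T : Ty} → (d : PureE R Γ Δ e T) → Γ = [] →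
    IsPattern T e → ∃ g : Env Δ → Val T, Function.Injective g ∧
      (∀ σ v τ, d.sem val σ v τ = if v = g τ then 1 else 0) ∧ (∀ τ, FitsPattern T e (g τ)) ∧
      (patData d.code).1 = ((Env.all Δ).map fun τ => (τ.bits, (g τ).enc)) ∧
      ∀ x ∈ Δ.map Prod.fst, x ∈ e.FV
  | _, _, _, _, .unit Γ h, _, _ => by
    refine ⟨fun _ => (), fun _ _ _ => rfl, fun σ v τ => (if_pos rfl).symm, fun τ => .unit _, ?_, by simp⟩
    rw [PureE.code, patData, foldNode_node]; rfl
  | _, _, _, _, .cvar Γ x T Γ' h, hΓ, _ => by simp at hΓ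
  | _, _, _, _, .qvar Γ x T h, _, _ => by
    refine ⟨fun τ => τ.1, ?_, fun σ v τ => rfl, fun τ => .var _ _ _, ?_, by simp [Expr.FV]⟩
    · rintro ⟨v, _⟩ ⟨w, _⟩ rfl; rfl
    · rw [PureE.code, patData, foldNode_node]
      simp only [patStep, List.getD_cons_zero, List.getD_cons_succ, tyData_code, Env.all]
      rw [List.map_map]
      induction Val.all T with
      | nil => rfl
      | cons v l ih => exact congrArg (List.cons _) ih
  | Γ, _, _, _, .pair (e₀ := e₀) (e₁ := e₁) (T₀ := T₀) (T₁ := T₁) Δ Δ₀ Δ₁ h d₀ d₁, hΓ, hp => by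
    cases hp with
    | pair hp₀ hp₁ =>
    obtain ⟨g₀, i₀, s₀, f₀, c₀, v₀⟩ := d₀.pattern hΓ hp₀
    obtain ⟨g₁, i₁, s₁, f₁, c₁, v₁⟩ := d₁.pattern hΓ hp₁
    refine ⟨fun t => (g₀ (Env.fst (Γ := Δ ++ Δ₀) (Δ := Δ₁) t),
      g₁ (Env.append (Env.fst (Γ := Δ ++ Δ₀) (Δ := Δ₁) t).fst
        (Env.snd (Γ := Δ ++ Δ₀) (Δ := Δ₁) t))), ?_, ?_, fun t => .pair (f₀ _) (f₁ _), ?_, ?_⟩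
    · intro t t' ht
      have h₁ := i₀ (congrArg Prod.fst ht)
      have h₂ := (Env.append_inj.1 (i₁ (congrArg Prod.snd ht))).2
      rw [← Env.append_fst_snd (Γ := Δ ++ Δ₀) (Δ := Δ₁) t, h₁, h₂, Env.append_fst_snd]
    · rintro σ ⟨v, w⟩ t
      change d₀.sem val σ v _ * d₁.sem val σ w _ = _
      rw [s₀, s₁, Env.append_fst_snd]
      exact ite_mul_ite_eq _ _ _ _
    · rw [PureE.code, patData, foldNode_node, ← patData]
      simp only [patStep, List.getD_cons_zero, List.getD_cons_succ, List.map_cons, List.map_nil,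
        c₀, c₁, pairTable, ctxTys_code, ← List.map_append, envs_map_code, List.map_map]
      refine List.map_congr_left fun t _ => ?_
      obtain ⟨t, τ₁, rfl⟩ := Env.exists_append t
      obtain ⟨τ, τ₀, rfl⟩ := Env.exists_append t
      have l₀ := look_map (Env.nodup_all (Δ ++ Δ₀)) Env.bits_injective (fun τ => (g₀ τ).enc)
        (Env.mem_all _ (τ.append τ₀))
      have l₁ := look_map (Env.nodup_all (Δ ++ Δ₁)) Env.bits_injective (fun τ => (g₁ τ).enc)
        (Env.mem_all _ (τ.append τ₁))
      simp only [Env.bits_append] at l₀ l₁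
      rw [Function.comp_apply, Env.fst_append, Env.fst_append, Env.snd_append]
      simp only [Env.bits_append, List.length_map]
      rw [List.take_left' (by simp [Env.length_bits]), l₀, List.append_assoc,
        List.take_left' (by simp [Env.length_bits]), ← List.append_assoc,
        List.drop_left' (by simp [Env.length_bits]), l₁]
      rfl
    · simp only [List.map_append, List.mem_append] at v₀ v₁ ⊢
      intro x hx
      rw [Expr.FV, Finset.mem_union]
      rcases hx with hx | hx
      · exact Or.inl (v₀ x hx)
      · exact Or.inr (v₁ x (Or.inr hx))
  | _, _, _, _, .app (T := T) (T' := T') df de, hΓ, hp => by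
    cases hp with
    | left T₁ hp =>
      cases df
      obtain ⟨g, i, s, f, c, v⟩ := de.pattern hΓ hp
      refine ⟨fun τ => Val.mkLeft _ _ (g τ), fun τ τ' h => i (Sum.inl_injective h), ?_,
        fun τ => .left (f τ), ?_, v⟩
      · exact fun σ v τ => mul_of_eq_ite s v τ
      · rw [PureE.code, patData, foldNode_node, ← patData]
        simp only [patStep, List.getD_cons_zero, List.getD_cons_succ, List.map_cons, List.map_nil, c,
          injTable, Prog.code, tagOf_node, kids_node, tyData_code, if_true, List.map_map]
        simp only [Function.comp_def, ← Val.enc_mkLeft]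
    | right T₀ hp =>
      cases df
      obtain ⟨g, i, s, f, c, v⟩ := de.pattern hΓ hp
      refine ⟨fun τ => Val.mkRight _ _ (g τ), fun τ τ' h => i (Sum.inr_injective h), ?_,
        fun τ => .right (f τ), ?_, v⟩
      · exact fun σ v τ => mul_of_eq_ite s v τ
      · rw [PureE.code, patData, foldNode_node, ← patData]
        simp only [patStep, List.getD_cons_zero, List.getD_cons_succ, List.map_cons, List.map_nil, c,
          injTable, Prog.code, tagOf_node, kids_node, tyData_code, List.map_map]
        simp [Function.comp_def, ← Val.enc_mkRight]
  | _, _, _, _, .perm πg πd d, hΓ, hp => by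
    obtain ⟨g, i, s, f, c, v⟩ := d.pattern (List.Perm.eq_nil (hΓ ▸ πg.perm)) hp
    refine ⟨fun τ => g (πd.pull τ), fun τ τ' h => πd.pull_injective (i h), fun σ v τ => s _ _ _,
      fun τ => f _, ?_, ?_⟩
    · rw [PureE.code, patData, foldNode_node, ← patData]
      simp only [patStep, List.getD_cons_zero, List.getD_cons_succ, List.map_cons, List.map_nil, c,
        ctxTys_code, envs_map_code, List.map_map]
      refine List.map_congr_left fun τ _ => ?_
      rw [Function.comp_apply, ← Rule.bits_pull,
        look_map (Env.nodup_all _) Env.bits_injective (fun τ => (g τ).enc) (Env.mem_all _ _)]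
    · exact fun x hx => v x ((πd.perm.map Prod.fst).mem_iff.2 hx)
end

/-! ### Erasure -/

section
variable {R : Type}

/-- The variables of a valuation with the encodings of their values. -/
def Env.named {Δ : Ctx} (τ : Env Δ) : List (Var × Bits) := (Δ.map Prod.fst).zip τ.bits

theorem Env.named_append {Γ Δ : Ctx} (σ : Env Γ) (τ : Env Δ) :
    (σ.append τ).named = σ.named ++ τ.named := by
  rw [Env.named, Env.bits_append, List.map_append, List.zip_append (by simp [Env.length_bits])]
  rfl

theorem LPerm.named_pull : {Δ Δ' : Ctx} → (π : LPerm Δ Δ') → (τ : Env Δ') →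
    (π.pull τ).named.Perm τ.named
  | _, _, .nil, _ => List.Perm.refl _
  | _, _, .cons b p, (v, σ) => (p.named_pull σ).cons (b.1, v.enc)
  | _, _, .swap a b l, (w, v, σ) => List.Perm.swap (b.1, w.enc) (a.1, v.enc) σ.named
  | _, _, .trans p q, τ => (p.named_pull (q.pull τ)).trans (q.named_pull τ)

theorem PureE.wfCtx : {Γ Δ : Ctx} → {e : Expr R} → {T : Ty} → PureE R Γ Δ e T → WFCtx Γ Δ
  | _, _, _, _, .unit _ h => h
  | _, _, _, _, .cvar _ _ _ _ h => h
  | _, _, _, _, .qvar _ _ _ h => h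
  | _, _, _, _, .pair _ _ _ h _ _ => h
  | _, _, _, _, .ctrl _ _ _ _ _ h _ _ _ _ _ => h
  | _, _, _, _, .app _ de => de.wfCtx
  | _, _, _, _, .perm πg πd d =>
    (((πg.perm.append πd.perm).map Prod.fst).nodup_iff).1 d.wfCtx

variable (val : R → ℝ)

/-- The operator of the derivation puts the value of the variable `x` at the place that begins at
the offset `o` and has length `l`. -/
def PureE.Carries {Γ Δ : Ctx} {e : Expr R} {T : Ty} (d : PureE R Γ Δ e T) (x : Var) (o l : ℕ) :
    Prop :=
  x ∉ Γ.map Prod.fst → ∀ σ v τ, d.sem val σ v τ ≠ 0 → (x, (v.enc.drop o).take l) ∈ τ.named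

theorem PureE.Carries.perm {Γ Γ' Δ Δ' : Ctx} {e : Expr R} {T : Ty} (πg : LPerm Γ Γ')
    (πd : LPerm Δ Δ') {d : PureE R Γ Δ e T} {x : Var} {o l : ℕ} (h : d.Carries val x o l) :
    (PureE.perm πg πd d).Carries val x o l := by
  intro hx σ v τ hv
  refine (πd.named_pull τ).mem_iff.1 (h ?_ (πg.pull σ) v (πd.pull τ) hv)
  rwa [(πg.perm.map Prod.fst).mem_iff]

theorem PureE.carries_var {x : Var} : {Γ Δ : Ctx} → {e : Expr R} → {T : Ty} →
    (d : PureE R Γ Δ e T) → e = .var x → d.Carries val x 0 T.size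
  | _, _, _, _, .unit _ _, he => by cases he
  | _, _, _, _, .cvar Γ y T Γ' _, he => by
    cases he
    exact fun hx => (hx (by simp)).elim
  | _, _, _, _, .qvar Γ y T _, he => by
    cases he
    rintro - σ v ⟨w, τ⟩ hv
    obtain rfl : v = w := by
      by_contra h
      exact hv (if_neg h)
    rw [List.drop_zero, List.take_of_length_le (Val.length_enc _ _).le]
    exact List.mem_singleton.2 rfl
  | _, _, _, _, .pair _ _ _ _ _ _, he => by cases he
  | _, _, _, _, .ctrl _ _ _ _ _ _ _ _ _ _ _, he => by cases he
  | _, _, _, _, .app _ _, he => by cases he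
  | _, _, _, _, .perm πg πd d, he => (d.carries_var he).perm val πg πd

theorem PureE.carries_gphase {x : Var} {o l : ℕ} {e' : Expr R} {T' : Ty} {y : Var} {r : R}
    (ih : ∀ {Γ Δ : Ctx} (d : PureE R Γ Δ e' T'), d.Carries val x o l) :
    {Γ Δ : Ctx} → {e : Expr R} → {T : Ty} → (d : PureE R Γ Δ e T) →
    e = .app (.rphase T' (.var y) r r) e' → d.Carries val x o l
  | _, _, _, _, .unit _ _, he => by cases he
  | _, _, _, _, .cvar _ _ _ _ _, he => by cases he
  | _, _, _, _, .qvar _ _ _ _, he => by cases he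
  | _, _, _, _, .pair _ _ _ _ _ _, he => by cases he
  | _, _, _, _, .ctrl _ _ _ _ _ _ _ _ _ _ _, he => by cases he
  | _, _, _, _, .app df de, he => by
    cases he
    cases df with
    | rphase _ _ d =>
    intro hx σ v τ hv
    refine ih de hx σ v τ fun h0 => hv ?_
    have h : (PureP.rphase r r d).sem val =
        Complex.exp (Complex.I * val r) • (1 : Matrix (Val T') (Val T') ℂ) := by
      simp only [PureP.sem]
      rw [← smul_add, add_sub_cancel]
    change ((PureP.rphase r r d).sem val * de.sem val σ) v τ = 0
    rw [h, Matrix.smul_mul, Matrix.one_mul, Matrix.smul_apply, h0, smul_zero]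
  | _, _, _, _, .perm πg πd d, he => (d.carries_gphase ih he).perm val πg πd

theorem PureE.carries_ctrl {x : Var} {o l : ℕ} {e' : Expr R} {T₀ T' : Ty} {n : ℕ}
    {p b : Fin n → Expr R} (hx : ∀ k, x ∉ (p k).FV)
    (ih : ∀ j, ∀ {Γ Δ : Ctx} (d : PureE R Γ Δ (b j) T'), d.Carries val x o l) [Encodable R] :
    {Γ Δ : Ctx} → {e : Expr R} → {T : Ty} → (d : PureE R Γ Δ e T) →
    e = .ctrl e' T₀ n p b T' → d.Carries val x o l
  | _, _, _, _, .unit _ _, he => by cases he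
  | _, _, _, _, .cvar _ _ _ _ _, he => by cases he
  | _, _, _, _, .qvar _ _ _ _, he => by cases he
  | _, _, _, _, .pair _ _ _ _ _ _, he => by cases he
  | _, _, _, _, .ctrl Γ Γ' Δ Δ' Γs h de ho dp er db, he => by
    cases he
    intro hx' s v t hv
    by_contra h0
    refine hv (Finset.sum_eq_zero fun u _ => ?_)
    refine mul_eq_zero_of_right _ (Finset.sum_eq_zero fun j _ => Finset.sum_eq_zero fun σj _ =>
      mul_eq_zero_of_right _ (by_contra fun h1 => h0 (ih j (db j) ?_ _ _ _ h1)))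
    -- the variables of the pattern occur in it, and so `x` is not among them
    obtain ⟨-, -, -, -, -, hFV⟩ := (dp j).pattern val rfl (ho.patterns.1 _ (List.mem_ofFn.2 ⟨j, rfl⟩))
    rw [List.map_append, List.mem_append, not_or]
    exact ⟨hx', fun hm => hx j (hFV x hm)⟩
  | _, _, _, _, .app _ _, he => by cases he
  | _, _, _, _, .perm πg πd d, he => (d.carries_ctrl hx ih he).perm val πg πd

theorem Val.drop_take_left {T₀ T₁ : Ty} (v : Val (.prod T₀ T₁)) {o l : ℕ} (h : o + l ≤ T₀.size) :
    (v.enc.drop o).take l = ((Val.enc (T := T₀) v.1).drop o).take l := by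
  have e : v.enc = Val.enc (T := T₀) v.1 ++ Val.enc (T := T₁) v.2 := rfl
  rw [e, List.drop_append_of_le_length (by rw [Val.length_enc]; omega),
    List.take_append_of_le_length (by rw [List.length_drop, Val.length_enc]; omega)]

theorem Val.drop_take_right {T₀ T₁ : Ty} (v : Val (.prod T₀ T₁)) (o l : ℕ) :
    (v.enc.drop (T₀.size + o)).take l = ((Val.enc (T := T₁) v.2).drop o).take l := by
  have e : v.enc = Val.enc (T := T₀) v.1 ++ Val.enc (T := T₁) v.2 := rfl
  rw [e, ← Val.length_enc T₀ v.1, List.drop_append, List.drop_of_length_le (Nat.le_add_right _ _),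
    List.nil_append, Nat.add_sub_cancel_left]

theorem PureE.carries_pair₀ {x : Var} {o l : ℕ} {e₀ e₁ : Expr R} {T₀ T₁ : Ty}
    (hl : o + l ≤ T₀.size) (ih : ∀ {Γ Δ : Ctx} (d : PureE R Γ Δ e₀ T₀), d.Carries val x o l) :
    {Γ Δ : Ctx} → {e : Expr R} → {T : Ty} → (d : PureE R Γ Δ e T) →
    e = .pair e₀ e₁ → T = .prod T₀ T₁ → d.Carries val x o l
  | _, _, _, _, .unit _ _, he, _ => by cases he
  | _, _, _, _, .cvar _ _ _ _ _, he, _ => by cases he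
  | _, _, _, _, .qvar _ _ _ _, he, _ => by cases he
  | _, _, _, _, .pair Δ Δ₀ Δ₁ _ d₀ d₁, he, hT => by
    cases he
    cases hT
    intro hx σ v t hv
    obtain ⟨t, τ₁, rfl⟩ := Env.exists_append t
    rw [Val.drop_take_left v hl, Env.named_append, List.mem_append]
    refine Or.inl (ih d₀ hx σ v.1 t fun h0 => hv ?_)
    change d₀.sem val σ v.1 _ * _ = 0
    rw [Env.append_fst_snd, Env.fst_append, h0, zero_mul]
  | _, _, _, _, .ctrl _ _ _ _ _ _ _ _ _ _ _, he, _ => by cases he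
  | _, _, _, _, .app _ _, he, _ => by cases he
  | _, _, _, _, .perm πg πd d, he, hT => (d.carries_pair₀ hl ih he hT).perm val πg πd

theorem PureE.carries_pair₁ {x : Var} {o l : ℕ} {e₀ e₁ : Expr R} {T₀ T₁ : Ty}
    (ih : ∀ {Γ Δ : Ctx} (d : PureE R Γ Δ e₁ T₁), d.Carries val x o l) :
    {Γ Δ : Ctx} → {e : Expr R} → {T : Ty} → (d : PureE R Γ Δ e T) →
    e = .pair e₀ e₁ → T = .prod T₀ T₁ → d.Carries val x (T₀.size + o) l
  | _, _, _, _, .unit _ _, he, _ => by cases he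
  | _, _, _, _, .cvar _ _ _ _ _, he, _ => by cases he
  | _, _, _, _, .qvar _ _ _ _, he, _ => by cases he
  | _, _, _, _, .pair Δ Δ₀ Δ₁ _ d₀ d₁, he, hT => by
    cases he
    cases hT
    intro hx σ v t hv
    obtain ⟨t, τ₁, rfl⟩ := Env.exists_append t
    obtain ⟨τ, τ₀, rfl⟩ := Env.exists_append t
    have key := ih d₁ hx σ v.2 (τ.append τ₁) fun h0 => hv (by
      change _ * d₁.sem val σ v.2 _ = 0
      simp only [Env.fst_append, Env.snd_append]
      rw [h0, mul_zero])
    rw [Val.drop_take_right]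
    simp only [Env.named_append, List.mem_append] at key ⊢
    tauto
  | _, _, _, _, .ctrl _ _ _ _ _ _ _ _ _ _ _, he, _ => by cases he
  | _, _, _, _, .app _ _, he, _ => by cases he
  | _, _, _, _, .perm πg πd d, he, hT => (d.carries_pair₁ ih he hT).perm val πg πd

variable [Encodable R]

theorem Erases.carries : {x : Var} → {T : Ty} → {es : List (Expr R)} → (er : Erases R x T es) →
    (eraseData er.code).1.1 + (eraseData er.code).1.2 ≤ T.size ∧
    ∀ e ∈ es, ∀ {Γ Δ : Ctx} (d : PureE R Γ Δ e T),
      d.Carries val x (eraseData er.code).1.1 (eraseData er.code).1.2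
  | _, _, _, .var x T n => by
    rw [Erases.code, eraseData, foldNode_node]
    simp only [List.getD_cons_zero, List.getD_cons_succ, tyData_code]
    exact ⟨by omega, fun e he Γ Δ d => d.carries_var val (List.eq_of_mem_replicate he)⟩
  | _, _, _, .gphase l₁ e l₂ y r er => by
    obtain ⟨h₁, h₂⟩ := er.carries
    rw [Erases.code, eraseData, foldNode_node, ← eraseData]
    simp only [List.getD_cons_zero, List.getD_cons_succ, List.map_cons]
    refine ⟨h₁, fun e' he' Γ Δ d => ?_⟩
    simp only [List.mem_append, List.mem_cons] at he' h₂
    rcases he' with he' | rfl | he'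
    · exact h₂ e' (Or.inl he') d
    · exact d.carries_gphase val (fun d => h₂ e (Or.inr (Or.inl rfl)) d) rfl
    · exact h₂ e' (Or.inr (Or.inr he')) d
  | _, _, _, .ctrl l₁ e T' n p b l₂ h er => by
    obtain ⟨h₁, h₂⟩ := er.carries
    rw [Erases.code, eraseData, foldNode_node, ← eraseData]
    simp only [List.getD_cons_zero, List.getD_cons_succ, List.map_cons]
    refine ⟨h₁, fun e' he' Γ Δ d => ?_⟩
    simp only [List.mem_append, List.mem_cons] at he' h₂
    rcases he' with he' | rfl | he'
    · exact h₂ e' (Or.inl he') d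
    · exact d.carries_ctrl val h
        (fun j _ _ d => h₂ (b j) (Or.inr (Or.inl (List.mem_ofFn.2 ⟨j, rfl⟩))) d) rfl
    · exact h₂ e' (Or.inr (Or.inr he')) d
  | _, _, _, .pair₀ T₁ l er => by
    obtain ⟨h₁, h₂⟩ := er.carries
    rw [Erases.code, eraseData, foldNode_node, ← eraseData]
    simp only [List.getD_cons_zero, List.getD_cons_succ, List.map_cons]
    refine ⟨h₁.trans (Nat.le_add_right _ _), fun e he Γ Δ d => ?_⟩
    obtain ⟨q, hq, rfl⟩ := List.mem_map.1 he
    exact d.carries_pair₀ val h₁ (fun d => h₂ q.1 (List.mem_map_of_mem hq) d) rfl rfl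
  | _, _, _, .pair₁ T₀ l er => by
    obtain ⟨h₁, h₂⟩ := er.carries
    rw [Erases.code, eraseData, foldNode_node, ← eraseData]
    simp only [List.getD_cons_zero, List.getD_cons_succ, List.map_cons, tyData_code]
    refine ⟨by rw [Ty.size]; omega, fun e he Γ Δ d => ?_⟩
    obtain ⟨q, hq, rfl⟩ := List.mem_map.1 he
    exact d.carries_pair₁ val (fun d => h₂ q.2 (List.mem_map_of_mem hq) d) rfl rfl

/-- The erased part of the quantum context can be read off from the values on which the amplitude
of a branch does not vanish. -/
theorem readBits_eq {Γ Δ Δ' : Ctx} {T : Ty} {es : List (Expr R)} {e : Expr R}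
    (er : ∀ i : Fin Δ.length, Erases R (Δ.get i).1 T es) (he : e ∈ es)
    (d : PureE R Γ (Δ ++ Δ') e T) {σ : Env Γ} {v : Val T} {τ : Env Δ} {τ' : Env Δ'}
    (h : d.sem val σ v (τ.append τ') ≠ 0) :
    Rule.readBits (eraseData (node 0 (List.ofFn fun i => (er i).code))).2 v.enc = τ.bits := by
  rw [eraseData, foldNode_node, ← eraseData]
  have hwf := d.wfCtx
  rw [WFCtx, List.map_append, List.nodup_append'] at hwf
  refine List.ext_getElem (by simp [Rule.readBits, Env.length_bits]) fun i hi hi' => ?_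
  rw [Env.length_bits] at hi'
  have key := ((er ⟨i, hi'⟩).carries val).2 e he d (fun hm => hwf.2.2 hm (by
    simpa using Or.inl ⟨_, List.getElem_mem hi'⟩)) σ v _ h
  simp only [Rule.readBits, List.getElem_map, List.getElem_ofFn]
  -- the names of the variables are distinct
  have hn : (((τ.append τ').named).map Prod.fst).Nodup := by
    rw [Env.named, List.map_fst_zip (by simp [Env.length_bits])]
    exact hwf.2.1
  have hmem : ((Δ.get ⟨i, hi'⟩).1, τ.bits[i]'(by rwa [Env.length_bits])) ∈ (τ.append τ').named := by
    rw [Env.named_append, List.mem_append, Env.named]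
    refine Or.inl (List.mem_iff_getElem.2 ⟨i, by simpa [Env.length_bits] using hi', ?_⟩)
    simp
  exact congrArg Prod.snd (List.inj_on_of_nodup_map hn key hmem rfl)
end

/-! ### Correctness of the programs of derivations -/

section
variable {R : Type} [Encodable R]

namespace Rule
open TL

variable {S S' D D' D₀ D₁ : List EnvBits} {V V' V₀ V₁ : List Bits} {p q p₀ p₁ : TL ℕ}
  {G G' G₀ G₁ : List ℕ}

theorem valid_unit : (unit S).Valid R := valid_nil.wrap _ _

theorem valid_cvar : (cvar S V S').Valid R := valid_nil.wrap _ _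

theorem valid_qvar : (qvar S V).Valid R := valid_nil.wrap _ _

theorem valid_fam_map {ι : Type} {l : List ι} {f : ι → ℕ × TL ℕ}
    (h : ∀ i ∈ l, (f i).2.Valid R) : (fam (l.map f)).Valid R := by
  refine valid_fam fun x hx => ?_
  obtain ⟨i, hi, rfl⟩ := List.mem_map.1 hx
  exact h i hi

theorem valid_pair (h₀ : p₀.Valid R) (h₁ : p₁.Valid R) :
    (pair S D D₀ D₁ V₀ V₁ p₀ G₀ p₁ G₁).Valid R :=
  ((valid_fam_map fun _ _ => h₀).join (valid_fam_map fun _ _ => h₁) _).wrap _ _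

theorem valid_app (h : p.Valid R) (h' : q.Valid R) : (app S D V V' p G q G').Valid R :=
  (h.join (valid_fam_map fun _ _ => h') _).wrap _ _

theorem valid_perm {lg ld : List ℕ} (h : p.Valid R) : (perm S D V G lg ld p).Valid R := h.wrap _ _

theorem valid_abs (h : p.Valid R) (h' : q.Valid R) : (abs D D₀ V V' p q G).Valid R :=
  (h.inv.join (valid_fam_map fun _ _ => h') _).wrap _ _

theorem valid_inj {b : Bool} {pad : ℕ} : (inj V b pad).Valid R := valid_nil.wrap _ _

theorem valid_gate (rθ rφ rl : R) :
    (gate (node 0 [encode rθ]) (node 0 [encode rφ]) (node 0 [encode rl])).Valid R := by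
  refine Valid.wrap (fun x hx => ?_) _ _
  obtain rfl := List.mem_singleton.1 hx
  exact ⟨⟨.zero, rfl⟩, ⟨.const rθ, rfl⟩, ⟨.const rφ, rfl⟩, ⟨.const rl, rfl⟩⟩

theorem valid_rphase (h : p.Valid R) (r r' : R) :
    (rphase D V p (node 0 [encode r]) (node 0 [encode r'])).Valid R :=
  ((((h.inv.append (valid_phase ⟨.const r, rfl⟩ _)).append
    (valid_phase ⟨.neg (.const r'), rfl⟩ _)).append h).append
      (valid_phase ⟨.const r', rfl⟩ _)).wrap _ _

theorem valid_tryCatch (h₀ : p₀.Valid R) (h₁ : p₁.Valid R) :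
    (tryCatch D₀ D₁ V p₀ G₀ p₁ G₁).Valid R :=
  ((valid_fam_map fun _ _ => h₀).join (valid_fam_map fun _ _ => h₁) _).wrap _ _

theorem valid_ctrl {n : ℕ} {m : List (List (EnvBits × Bits))} {rd : List (ℕ × ℕ)}
    {qs : List (TL ℕ)} (h : p.Valid R) (h' : ∀ q ∈ qs, q.Valid R) :
    (ctrl S S' D D' V V' n m rd p G qs).Valid R := by
  refine ((((valid_fam_map fun _ _ => h).join (valid_fam_map fun i _ => ?_) _).join
    (valid_fam_map fun _ _ => h.inv)) _).wrap _ _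
  rw [List.getD_eq_getElem?_getD]
  by_cases hi : i.1 < qs.length
  · rw [List.getElem?_eq_getElem hi]
    exact h' _ (List.getElem_mem hi)
  · rw [List.getElem?_eq_none (not_lt.1 hi)]
    exact valid_nil

end Rule

variable (val : R → ℝ)
open TL

theorem superop_ketbra {α β : Type} [Fintype α] [DecidableEq α] (φ : α → α → Matrix β β ℂ)
    (a a' : α) : superop φ (ketbra a a') = φ a a' := by
  change ∑ b, ∑ b', Matrix.single a a' (1 : ℂ) b b' • φ b b' = φ a a'
  rw [Finset.sum_eq_single a, Finset.sum_eq_single a']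
  · simp
  · intro b _ h
    rw [Matrix.single_apply_of_ne _ _ _ _ _ (by tauto), zero_smul]
  · simp
  · intro b _ h
    refine Finset.sum_eq_zero fun b' _ => ?_
    rw [Matrix.single_apply_of_ne _ _ _ _ _ (by tauto), zero_smul]
  · simp

theorem mul_ketbra_mul {α β : Type} [Fintype α] [DecidableEq α] (M : Matrix β α ℂ) (a a' : α)
    (b b' : β) : (M * ketbra a a' * M.conjTranspose) b b' = M b a * (starRingEnd ℂ) (M b' a') := by
  rw [Matrix.mul_apply, Finset.sum_eq_single a']
  · simp [Matrix.mul_apply, Matrix.single_apply]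
  · intro c _ hc
    simp [Matrix.mul_apply, hc.symm]
  · simp

theorem map_eq_sum_ketbra {α β : Type} [Fintype α] [DecidableEq α]
    (F : Matrix α α ℂ →ₗ[ℂ] Matrix β β ℂ) (M : Matrix α α ℂ) (b b' : β) :
    F M b b' = ∑ a, ∑ a', M a a' * F (ketbra a a') b b' := by
  conv_lhs => rw [Matrix.matrix_eq_sum_single M]
  simp only [map_sum, Matrix.sum_apply]
  refine Finset.sum_congr rfl fun a _ => Finset.sum_congr rfl fun a' _ => ?_
  rw [show Matrix.single a a' (M a a') = M a a' • ketbra a a' by simp, map_smul, Matrix.smul_apply,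
    smul_eq_mul]

/-- A program realizes a superoperator, with the given labels as garbage: this is the condition on
the images of the operators `|i⟩⟨i'|`, where `b i` represents the basis state `i`. -/
def TL.Dilates {ι : Type} [DecidableEq ι] {T : Ty} (p : TL ℕ) (G : List ℕ) (b : ι → EnvBits)
    (E : Matrix ι ι ℂ →ₗ[ℂ] Matrix (Val T) (Val T) ℂ) : Prop :=
  ∀ i i' v v', E (ketbra i i') v v' = (G.map fun g => amp val p (outL [] v.enc g) (inL [] (b i)) *
    (starRingEnd ℂ) (amp val p (outL [] v'.enc g) (inL [] (b i')))).sum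

/-- The program that the compiler assigns to the derivation has the right amplitudes. -/
def PureE.Correct {Γ Δ : Ctx} {e : Expr R} {T : Ty} (d : PureE R Γ Δ e T) : Prop :=
  (compileCode d.code).1.Valid R ∧
    Acts val (compileCode d.code).1 [0] fun σ τ v _ => d.sem val σ v τ

/-- The program compiled from a derivation of a mixed expression realizes its superoperator, with
distinct garbage labels. -/
def MixedE.Correct {Δ : Ctx} {e : Expr R} {T : Ty} (d : MixedE R Δ e T) : Prop :=
  (compileCode d.code).2.1.1.Valid R ∧ (compileCode d.code).2.1.2.Nodup ∧
    Dilates val (compileCode d.code).2.1.1 (compileCode d.code).2.1.2 Env.bits (d.sem val)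

/-- The amplitudes of the program compiled from a derivation of a pure program are the matrix
entries of its operator. -/
def PureP.Correct {f : Prog R} {T T' : Ty} (d : PureP R f T T') : Prop :=
  (compileCode d.code).2.2.1.Valid R ∧ ∀ (v : Val T) (v' : Val T'),
    amp val (compileCode d.code).2.2.1 (outL [] v'.enc 0) (inL [] [v.enc]) = d.sem val v' v

/-- The program compiled from a derivation of a mixed program realizes its superoperator, with
distinct garbage labels. -/
def MixedP.Correct {f : Prog R} {T T' : Ty} (d : MixedP R f T T') : Prop :=
  (compileCode d.code).2.2.2.1.1.Valid R ∧ (compileCode d.code).2.2.2.1.2.Nodup ∧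
    Dilates val (compileCode d.code).2.2.2.1.1 (compileCode d.code).2.2.2.1.2
      (fun v : Val T => [v.enc]) (d.sem val)

theorem acts_self {Δ : Ctx} {T : Ty} (p : TL ℕ) (G : List ℕ) :
    Acts val (Γ := []) (Δ := Δ) (T := T) p G
      fun _ τ v g => amp val p (outL [] v.enc g) (inL [] τ.bits) :=
  fun _ _ _ _ _ _ => (if_pos rfl).symm

theorem nodup_pair {G G' : List ℕ} (h : G.Nodup) (h' : G'.Nodup) :
    ((G ×ˢ G').map fun i => Nat.pair i.1 i.2).Nodup :=
  (h.product h').map fun _ _ h => Prod.ext_iff.2 (Nat.pair_eq_pair.1 h)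

/-- The induction hypothesis for a pure expression without classical variables. -/
theorem PureE.Correct.amp {Δ : Ctx} {e : Expr R} {T : Ty} {d : PureE R [] Δ e T}
    (h : d.Correct val) (τ : Env Δ) (v : Val T) :
    TL.amp val (compileCode d.code).1 (outL [] v.enc 0) (inL [] τ.bits) =
      d.sem val Env.empty v τ :=
  (h.2 Env.empty τ Env.empty v 0 (by simp)).trans (if_pos rfl)

section pure
variable {Γ Γ' Δ Δ' Δ₀ Δ₁ : Ctx} {T T' T₀ T₁ : Ty} {e e₀ e₁ : Expr R} {f : Prog R}

theorem PureE.correct_unit (h : WFCtx Γ []) : (PureE.unit (R := R) Γ h).Correct val := by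
  rw [PureE.Correct, PureE.code, compileCode, foldNode_node, ← compileCode]
  simp only [compileStep, pureECase, List.getD_cons_zero, ctxEnvs_code]
  exact ⟨Rule.valid_unit, Rule.acts_unit val Γ⟩

theorem PureE.correct_cvar {x : Var} (h : WFCtx (Γ ++ (x, T) :: Γ') []) :
    (PureE.cvar (R := R) Γ x T Γ' h).Correct val := by
  rw [PureE.Correct, PureE.code, compileCode, foldNode_node, ← compileCode]
  simp only [compileStep, pureECase, List.getD_cons_zero, List.getD_cons_succ, ctxEnvs_code,
    tyVals_code]
  exact ⟨Rule.valid_cvar, Rule.acts_cvar val Γ x T Γ'⟩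

theorem PureE.correct_qvar {x : Var} (h : WFCtx Γ [(x, T)]) :
    (PureE.qvar (R := R) Γ x T h).Correct val := by
  rw [PureE.Correct, PureE.code, compileCode, foldNode_node, ← compileCode]
  simp only [compileStep, pureECase, List.getD_cons_zero, List.getD_cons_succ, ctxEnvs_code,
    tyVals_code]
  exact ⟨Rule.valid_qvar, Rule.acts_qvar val Γ x T⟩

theorem PureE.Correct.pair {d₀ : PureE R Γ (Δ ++ Δ₀) e₀ T₀} {d₁ : PureE R Γ (Δ ++ Δ₁) e₁ T₁}
    (h₀ : d₀.Correct val) (h₁ : d₁.Correct val) (h : WFCtx Γ (Δ ++ Δ₀ ++ Δ₁)) :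
    (PureE.pair Δ Δ₀ Δ₁ h d₀ d₁).Correct val := by
  rw [PureE.Correct, PureE.code, compileCode, foldNode_node, ← compileCode]
  simp only [compileStep, pureECase, Compiled.at, List.map_cons, List.map_nil, List.getD_cons_zero,
    List.getD_cons_succ, ctxEnvs_code, tyVals_code]
  exact ⟨Rule.valid_pair h₀.1 h₁.1, Rule.acts_pair val (by simp) (by simp) h₀.2 h₁.2⟩

theorem PureE.Correct.app {df : PureP R f T T'} {de : PureE R Γ Δ e T} (hf : df.Correct val)
    (he : de.Correct val) : (PureE.app df de).Correct val := by
  rw [PureE.Correct, PureE.code, compileCode, foldNode_node, ← compileCode]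
  simp only [compileStep, pureECase, Compiled.at, List.map_cons, List.map_nil, List.getD_cons_zero,
    List.getD_cons_succ, ctxEnvs_code, tyVals_code]
  refine ⟨Rule.valid_app he.1 hf.1, ?_⟩
  have hf' : Acts val (Γ := []) (Δ := [(0, T)]) (T := T') (compileCode df.code).2.2.1 [0]
      fun _ τ v' _ => df.sem val v' τ.1 := by
    rintro - ⟨v, -⟩ - v' g hg
    obtain rfl := List.mem_singleton.1 hg
    exact (hf.2 v v').trans (if_pos rfl).symm
  exact Rule.acts_app val (by simp) (by simp) he.2 hf'

theorem PureE.Correct.perm {d : PureE R Γ Δ e T} (h : d.Correct val) (πg : LPerm Γ Γ')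
    (πd : LPerm Δ Δ') : (PureE.perm πg πd d).Correct val := by
  rw [PureE.Correct, PureE.code, compileCode, foldNode_node, ← compileCode]
  simp only [compileStep, pureECase, Compiled.at, List.map_cons, List.map_nil, List.getD_cons_zero,
    List.getD_cons_succ, ctxEnvs_code, tyVals_code]
  exact ⟨Rule.valid_perm h.1, Rule.acts_perm val (by simp) h.2 πg.pull_injective πd.pull_injective
    (Rule.bits_pull πg) (Rule.bits_pull πd)⟩

/-- By `Rule.amp_ctrl` the program of the control has the amplitudes of the semantics, except that it
loses those at values from which a wrong erased valuation is read off; these vanish by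
`readBits_eq`. -/
theorem PureE.Correct.ctrl {n : ℕ} {p b : Fin n → Expr R} {Γs : Fin n → Ctx}
    {de : MixedE R (Γ ++ Δ) e T} {dp : ∀ j, PureE R [] (Γs j) (p j) T}
    {db : ∀ j, PureE R (Γ ++ Γ' ++ Γs j) (Δ ++ Δ') (b j) T'} (he : de.Correct val)
    (hb : ∀ j, (db j).Correct val) (h : WFCtx (Γ ++ Γ') (Δ ++ Δ')) (o : Ortho R T (List.ofFn p))
    (er : ∀ i : Fin Δ.length, Erases R (Δ.get i).1 T' (List.ofFn b)) :
    (PureE.ctrl Γ Γ' Δ Δ' Γs h de o dp er db).Correct val := by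
  obtain ⟨hpat, hdis⟩ := o.patterns
  choose g hg hsem hfit hdata hFV using fun j =>
    (dp j).pattern val rfl (hpat _ (List.mem_ofFn.2 ⟨j, rfl⟩))
  rw [PureE.Correct, PureE.code, compileCode, foldNode_node, ← compileCode]
  simp only [compileStep, pureECase, ctrlCase, Compiled.at, List.map_cons, List.map_nil,
    List.getD_cons_zero, List.getD_cons_succ, ctxEnvs_code, tyVals_code, kids_node,
    List.length_ofFn]
  have h₁ : (patData (node 0 (List.ofFn fun j => (dp j).code))).2 =
      List.ofFn fun j => (Env.all (Γs j)).map fun σ => (σ.bits, (g j σ).enc) := by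
    rw [patData, foldNode_node, ← patData]
    simp only [patStep, List.map_ofFn]
    exact congrArg List.ofFn (funext hdata)
  have h₂ : (compileCode (node 0 (List.ofFn fun j => (db j).code))).2.2.2.2 =
      List.ofFn fun j => (compileCode (db j).code).1 := by
    rw [compileCode, foldNode_node, ← compileCode]
    simp only [compileStep, List.map_ofFn]
    rfl
  rw [h₁, h₂]
  refine ⟨Rule.valid_ctrl he.1 fun q hq => ?_, ?_⟩
  · obtain ⟨j, rfl⟩ := List.mem_ofFn.1 hq
    exact (hb j).1
  intro s t s' v k hk
  obtain rfl := List.mem_singleton.1 hk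
  obtain ⟨σ, σ', rfl⟩ := Env.exists_append s
  obtain ⟨τ, τ', rfl⟩ := Env.exists_append t
  obtain ⟨ρ, ρ', rfl⟩ := Env.exists_append s'
  simp only [Env.bits_append]
  rw [Rule.amp_ctrl val (E := fun j s t v => (db j).sem val s v t) he.2.1]
  · simp only [Env.append_inj]
    by_cases hρ : ρ = σ ∧ ρ' = σ'
    · rw [if_pos hρ]
      have hS (j : Fin n) (σj : Env (Γs j)) := he.2.2 (σ.append τ) (σ.append τ) (g j σj) (g j σj)
      simp only [Env.bits_append] at hS
      have hsum : (PureE.ctrl Γ Γ' Δ Δ' Γs h de o dp er db).sem val (σ.append σ') v (τ.append τ') =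
          ∑ j, ∑ σj, de.sem val (ketbra (σ.append τ) (σ.append τ)) (g j σj) (g j σj) *
            (db j).sem val ((σ.append σ').append σj) v (τ.append τ') := by
        simp only [PureE.sem, Env.fst_append, Matrix.conjTranspose_apply, hsem, Finset.mul_sum]
        rw [Finset.sum_comm]
        refine Finset.sum_congr rfl fun j _ => ?_
        rw [Finset.sum_comm]
        refine Finset.sum_congr rfl fun σj _ => ?_
        rw [Finset.sum_eq_single (g j σj)]
        · simp
        · intro u _ hu
          simp [hu]
        · simp
      rw [hsum]
      by_cases hr : Rule.readBits (eraseData (node 0 (List.ofFn fun i => (er i).code))).2 v.enc =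
          τ.bits
      · rw [if_pos ⟨hρ.1, hρ.2, hr⟩]
        simp only [hS]
      · rw [if_neg fun h => hr h.2.2]
        refine (Finset.sum_eq_zero fun j _ => Finset.sum_eq_zero fun σj _ => ?_).symm
        refine mul_eq_zero_of_right _ (by_contra fun hne => hr ?_)
        exact readBits_eq val er (List.mem_ofFn.2 ⟨j, rfl⟩) (db j) hne
    · rw [if_neg fun h => hρ ⟨h.1, h.2.1⟩, if_neg hρ]
  · intro j j' σj σj' heq
    by_cases hj : j = j'
    · subst hj
      rw [hg j heq]
    · exfalso
      rw [List.pairwise_ofFn] at hdis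
      rcases lt_or_gt_of_ne hj with hlt | hlt
      · exact hdis hlt _ (hfit j σj) (heq ▸ hfit j' σj')
      · exact hdis hlt _ (hfit j' σj') (heq ▸ hfit j σj)
  · exact fun j s t s' v => (hb j).2 s t s' v 0 (by simp)

theorem PureP.correct_gate (rθ rφ rl : R) : (PureP.gate rθ rφ rl).Correct val := by
  rw [PureP.Correct, PureP.code, compileCode, foldNode_node, ← compileCode]
  simp only [compileStep, purePCase, List.getD_cons_zero, List.getD_cons_succ]
  refine ⟨Rule.valid_gate _ _ _, fun v v' => ?_⟩
  have henc (v : Val .bit) : v.enc = [v.toBool] := by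
    rcases v with _ | _ <;> rfl
  rw [henc, henc, Rule.amp_gate]
  simp [PureP.sem]

theorem PureP.correct_left (T₀ T₁ : Ty) : (PureP.left (R := R) T₀ T₁).Correct val := by
  rw [PureP.Correct, PureP.code, compileCode, foldNode_node, ← compileCode]
  simp only [compileStep, purePCase, List.getD_cons_zero, List.getD_cons_succ, tyVals_code,
    tyData_code]
  exact ⟨Rule.valid_inj, Rule.amp_inj val (fun _ _ h => Sum.inl_injective h) (Val.enc_mkLeft T₀ T₁)⟩

theorem PureP.correct_right (T₀ T₁ : Ty) : (PureP.right (R := R) T₀ T₁).Correct val := by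
  rw [PureP.Correct, PureP.code, compileCode, foldNode_node, ← compileCode]
  simp only [compileStep, purePCase, List.getD_cons_zero, List.getD_cons_succ, tyVals_code,
    tyData_code]
  exact ⟨Rule.valid_inj, Rule.amp_inj val (fun _ _ h => Sum.inr_injective h) (Val.enc_mkRight T₀ T₁)⟩

theorem PureP.Correct.abs {d : PureE R [] Δ e T} {d' : PureE R [] Δ e₁ T'} (h : d.Correct val)
    (h' : d'.Correct val) : (PureP.abs d d').Correct val := by
  rw [PureP.Correct, PureP.code, compileCode, foldNode_node, ← compileCode]
  simp only [compileStep, purePCase, Compiled.at, List.map_cons, List.map_nil, List.getD_cons_zero,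
    List.getD_cons_succ, ctxEnvs_code, tyVals_code]
  refine ⟨Rule.valid_abs h.1 h'.1, fun v v' => ?_⟩
  refine (Rule.amp_abs val (Δ₀ := []) (P := fun τ _ v => d.sem val Env.empty v τ)
    (Q := fun τ v _ => d'.sem val Env.empty v τ) (G := [0]) (by simp) (fun τ τ₀ v => ?_)
    (fun τ v g hg => ?_) v v' Env.empty (g := 0) (by simp)).trans ?_
  · rw [show (τ₀.bits : EnvBits) = [] from rfl, List.append_nil]
    exact h.amp val τ v
  · obtain rfl := List.mem_singleton.1 hg
    exact h'.amp val τ v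
  · simp [PureP.sem, Matrix.mul_apply]

theorem PureP.Correct.rphase {d : PureE R [] Δ e T} (h : d.Correct val) (r r' : R) :
    (PureP.rphase r r' d).Correct val := by
  rw [PureP.Correct, PureP.code, compileCode, foldNode_node, ← compileCode]
  simp only [compileStep, purePCase, Compiled.at, List.map_cons, List.map_nil, List.getD_cons_zero,
    List.getD_cons_succ, ctxEnvs_code, tyVals_code]
  refine ⟨Rule.valid_rphase h.1 r r', fun v v' => ?_⟩
  rw [Rule.amp_rphase val (P := fun τ v => d.sem val Env.empty v τ) (h.amp val)]
  simp [PureP.sem, Matrix.mul_apply, Matrix.one_apply]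

end pure
end

section
variable {R : Type} [Encodable R] (val : R → ℝ)
open TL

theorem trace_ketbra {α : Type} [Fintype α] [DecidableEq α] (a a' : α) :
    (ketbra a a').trace = if a = a' then 1 else 0 := by
  split_ifs with h
  · rw [h, Matrix.trace_single_eq_same]
  · exact Matrix.trace_single_eq_of_ne _ _ _ h

theorem sum_sum_map {ι κ : Type} [Fintype ι] (l : List κ) (f : ι → κ → ℂ) :
    ∑ i, (l.map (f i)).sum = (l.map fun k => ∑ i, f i k).sum := by
  induction l with
  | nil => simp
  | cons k l ih => simp [Finset.sum_add_distrib, ih]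

theorem sum_map_mul_sum_map {ι κ : Type} (l : List ι) (l' : List κ) (f : ι → ℂ) (g : κ → ℂ) :
    (l.map f).sum * (l'.map g).sum = (l.map fun i => (l'.map fun k => f i * g k).sum).sum := by
  simp only [List.sum_map_mul_left, List.sum_map_mul_right]

section mixed
variable {Δ Δ' Δ₀ Δ₁ : Ctx} {T T' T₀ T₁ : Ty} {e e₀ e₁ : Expr R} {f : Prog R}

theorem PureE.Correct.mix {d : PureE R [] Δ e T} (h : d.Correct val) :
    (MixedE.mix d).Correct val := by
  rw [MixedE.Correct, MixedE.code, compileCode, foldNode_node, ← compileCode]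
  simp only [compileStep, mixedECase, Compiled.at, List.map_cons, List.map_nil,
    List.getD_cons_zero, List.getD_cons_succ]
  refine ⟨h.1, by simp, fun τ τ' v v' => ?_⟩
  rw [MixedE.sem, superop_ketbra, mul_ketbra_mul]
  simp [h.amp]

theorem MixedE.Correct.perm {d : MixedE R Δ e T} (h : d.Correct val) (π : LPerm Δ Δ') :
    (MixedE.perm π d).Correct val := by
  rw [MixedE.Correct, MixedE.code, compileCode, foldNode_node, ← compileCode]
  simp only [compileStep, mixedECase, Compiled.at, List.map_cons, List.map_nil,
    List.getD_cons_zero, List.getD_cons_succ, ctxEnvs_code, tyVals_code]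
  refine ⟨Rule.valid_perm h.1, h.2.1, fun τ τ' v v' => ?_⟩
  rw [MixedE.sem, superop_ketbra, h.2.2 _ _ _ _]
  have key := Rule.acts_perm val (Γ := []) (Γ' := []) h.2.1
    (acts_self val (Δ := Δ) (T := T) (compileCode d.code).2.1.1 _) (lg := []) (fg := id) Function.injective_id
    π.pull_injective (fun _ => rfl) (Rule.bits_pull π)
  refine congrArg List.sum (List.map_congr_left fun g hg => ?_)
  have k₁ := key Env.empty τ Env.empty v g hg
  have k₂ := key Env.empty τ' Env.empty v' g hg
  rw [if_pos rfl] at k₁ k₂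
  exact (congrArg₂ (fun x y => x * (starRingEnd ℂ) y) k₁ k₂).symm

theorem MixedE.Correct.pair {d₀ : MixedE R (Δ ++ Δ₀) e₀ T₀} {d₁ : MixedE R (Δ ++ Δ₁) e₁ T₁}
    (h₀ : d₀.Correct val) (h₁ : d₁.Correct val) (h : WFCtx [] (Δ ++ Δ₀ ++ Δ₁)) :
    (MixedE.pair Δ Δ₀ Δ₁ h d₀ d₁).Correct val := by
  rw [MixedE.Correct, MixedE.code, compileCode, foldNode_node, ← compileCode]
  simp only [compileStep, mixedECase, Compiled.at, List.map_cons, List.map_nil,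
    List.getD_cons_zero, List.getD_cons_succ, ctxEnvs_code, tyVals_code]
  refine ⟨Rule.valid_pair h₀.1 h₁.1, nodup_pair h₀.2.1 h₁.2.1, fun τ τ' v v' => ?_⟩
  have key := Rule.acts_pair val (Γ := []) h₀.2.1 h₁.2.1
    (acts_self val (Δ := Δ ++ Δ₀) (T := T₀) (compileCode d₀.code).2.1.1 _)
    (acts_self val (Δ := Δ ++ Δ₁) (T := T₁) (compileCode d₁.code).2.1.1 _)
  refine (congrFun (congrFun (superop_ketbra _ _ _) v) v').trans ?_
  refine (congrArg₂ (· * ·) (h₀.2.2 _ _ _ _) (h₁.2.2 _ _ _ _)).trans ?_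
  rw [List.map_map, List.sum_map_product]
  rw [← List.sum_map_mul_right]
  refine congrArg List.sum (List.map_congr_left fun g hg => ?_)
  rw [← List.sum_map_mul_left]
  refine congrArg List.sum (List.map_congr_left fun g' hg' => ?_)
  have hm : Nat.pair g g' ∈ ((compileCode d₀.code).2.1.2 ×ˢ (compileCode d₁.code).2.1.2).map
      fun i => Nat.pair i.1 i.2 :=
    List.mem_map.2 ⟨(g, g'), List.mem_product.2 ⟨hg, hg'⟩, rfl⟩
  have k₁ := key Env.empty τ Env.empty v _ hm
  have k₂ := key Env.empty τ' Env.empty v' _ hm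
  rw [if_pos rfl] at k₁ k₂
  simp only [Nat.unpair_pair] at k₁ k₂
  refine Eq.trans ?_ (congrArg₂ (fun x y => x * (starRingEnd ℂ) y) k₁ k₂).symm
  simp only [map_mul]
  ring

theorem MixedE.Correct.app {df : MixedP R f T T'} {de : MixedE R Δ e T} (hf : df.Correct val)
    (he : de.Correct val) : (MixedE.app df de).Correct val := by
  rw [MixedE.Correct, MixedE.code, compileCode, foldNode_node, ← compileCode]
  simp only [compileStep, mixedECase, Compiled.at, List.map_cons, List.map_nil,
    List.getD_cons_zero, List.getD_cons_succ, ctxEnvs_code, tyVals_code]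
  refine ⟨Rule.valid_app he.1 hf.1, nodup_pair he.2.1 hf.2.1, fun τ τ' v v' => ?_⟩
  have key := Rule.acts_app val (Γ := []) (x := 0) he.2.1 hf.2.1
    (acts_self val (Δ := Δ) (T := T) (compileCode de.code).2.1.1 _)
    (acts_self val (Δ := [(0, T)]) (T := T') (compileCode df.code).2.2.2.1.1 _)
  have key' (τ : Env Δ) (v : Val T') {g g' : ℕ} (hg : g ∈ (compileCode de.code).2.1.2)
      (hg' : g' ∈ (compileCode df.code).2.2.2.1.2) :
      TL.amp val (Rule.app [[]] ((Env.all Δ).map Env.bits) ((Val.all T).map Val.enc)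
        ((Val.all T').map Val.enc) (compileCode de.code).2.1.1 (compileCode de.code).2.1.2
        (compileCode df.code).2.2.2.1.1 (compileCode df.code).2.2.2.1.2)
        (outL [] v.enc (Nat.pair g g')) (inL [] τ.bits) = ∑ a : Val T,
        TL.amp val (compileCode df.code).2.2.2.1.1 (outL [] v.enc g') (inL [] [a.enc]) *
          TL.amp val (compileCode de.code).2.1.1 (outL [] a.enc g) (inL [] τ.bits) := by
    have k := key Env.empty τ Env.empty v _
      (List.mem_map.2 ⟨(g, g'), List.mem_product.2 ⟨hg, hg'⟩, rfl⟩)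
    rw [if_pos rfl] at k
    simp only [Nat.unpair_pair] at k
    exact k
  rw [MixedE.sem, LinearMap.comp_apply, map_eq_sum_ketbra]
  simp only [he.2.2 _ _ _ _, hf.2.2 _ _ _ _]
  rw [List.map_map, List.sum_map_product]
  have hL : ∀ g ∈ (compileCode de.code).2.1.2, ∀ g' ∈ (compileCode df.code).2.2.2.1.2,
      _ * _ = _ := fun g hg g' hg' =>
    congrArg₂ (fun x y => x * (starRingEnd ℂ) y) (key' τ v hg hg') (key' τ' v' hg hg')
  simp only [Function.comp_def]
  rw [List.map_congr_left fun g hg => congrArg List.sum (List.map_congr_left (hL g hg))]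
  simp only [sum_map_mul_sum_map, sum_sum_map, map_sum, Finset.sum_mul_sum, map_mul]
  refine congrArg List.sum (List.map_congr_left fun g _ => congrArg List.sum
    (List.map_congr_left fun g' _ => Finset.sum_congr rfl fun a _ =>
      Finset.sum_congr rfl fun a' _ => ?_))
  ring

theorem MixedE.Correct.tryCatch {d₀ : MixedE R Δ₀ e₀ T} {d₁ : MixedE R Δ₁ e₁ T}
    (h₀ : d₀.Correct val) (h₁ : d₁.Correct val) (h : WFCtx [] (Δ₀ ++ Δ₁)) :
    (MixedE.tryCatch Δ₀ Δ₁ h d₀ d₁).Correct val := by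
  rw [MixedE.Correct, MixedE.code, compileCode, foldNode_node, ← compileCode]
  simp only [compileStep, mixedECase, Compiled.at, List.map_cons, List.map_nil,
    List.getD_cons_zero, List.getD_cons_succ, ctxEnvs_code, tyVals_code]
  have nL := Rule.nodup_leftover ((Env.all Δ₀).map Env.bits) ((Val.all T).map Val.enc)
    (compileCode d₀.code).2.1.1 (compileCode d₀.code).2.1.2
  have nD : ((Env.all Δ₁).map Env.bits).Nodup :=
    (Env.nodup_all Δ₁).map Env.bits_injective
  refine ⟨Rule.valid_tryCatch h₀.1 h₁.1, ?_, fun t t' v v' => ?_⟩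
  · refine List.Nodup.append ((nD.product h₀.2.1).map fun i j h => ?_)
      ((nL.product h₁.2.1).map fun i j h => ?_) ?_
    · exact Encodable.encode_injective (Nat.pair_eq_pair.1 h).2
    · exact Encodable.encode_injective (Nat.pair_eq_pair.1 h).2
    · intro m hm hm'
      obtain ⟨i, -, rfl⟩ := List.mem_map.1 hm
      obtain ⟨j, -, h⟩ := List.mem_map.1 hm'
      exact one_ne_zero (Nat.pair_eq_pair.1 h).1
  obtain ⟨τ₀, τ₁, rfl⟩ := Env.exists_append t
  obtain ⟨τ₀', τ₁', rfl⟩ := Env.exists_append t'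
  obtain ⟨hs, hf⟩ := Rule.amp_tryCatch val (p₀ := (compileCode d₀.code).2.1.1)
    (p₁ := (compileCode d₁.code).2.1.1) h₀.2.1 h₁.2.1 τ₀ τ₁ v
  obtain ⟨hs', hf'⟩ := Rule.amp_tryCatch val (p₀ := (compileCode d₀.code).2.1.1)
    (p₁ := (compileCode d₁.code).2.1.1) h₀.2.1 h₁.2.1 τ₀' τ₁' v'
  rw [MixedE.sem, superop_ketbra]
  simp only [Env.fst_append, Env.snd_append, Env.bits_append, Matrix.add_apply, Matrix.smul_apply,
    smul_eq_mul, trace_ketbra]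
  have htr : (if τ₀ = τ₀' then (1 : ℂ) else 0) - (d₀.sem val (ketbra τ₀ τ₀')).trace =
      ((Rule.leftover ((Env.all Δ₀).map Env.bits) ((Val.all T).map Val.enc)
        (compileCode d₀.code).2.1.1 (compileCode d₀.code).2.1.2).map fun m =>
          TL.amp val (compileCode d₀.code).2.1.1 m (inL [] τ₀.bits) *
            (starRingEnd ℂ) (TL.amp val (compileCode d₀.code).2.1.1 m (inL [] τ₀'.bits))).sum := by
    rw [Rule.sum_leftover val h₀.2.1]
    simp only [Matrix.trace, Matrix.diag_apply, h₀.2.2 _ _ _ _]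
  rw [htr, Rule.tryGarbage, List.map_append, List.sum_append]
  congr 1
  · rw [h₀.2.2 _ _ _ _, List.map_map, List.product_map_left, List.map_map, List.sum_map_product]
    simp only [Function.comp_def]
    rw [List.sum_map_eq_sum_univ (Env.nodup_all Δ₁) (Env.mem_all Δ₁)]
    have hL : ∀ (τ : Env Δ₁), ∀ g ∈ (compileCode d₀.code).2.1.2, _ * _ = _ := fun τ g hg =>
      congrArg₂ (fun x y => x * (starRingEnd ℂ) y) (hs τ g hg) (hs' τ g hg)
    simp only [List.map_congr_left (hL _)]
    rw [Finset.sum_eq_single τ₁]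
    · by_cases hτ : τ₁ = τ₁' <;> simp [hτ]
    · intro τ _ hτ
      simp [hτ]
    · simp
  · rw [h₁.2.2 _ _ _ _, sum_map_mul_sum_map, List.map_map, List.sum_map_product]
    refine congrArg List.sum (List.map_congr_left fun m hm => congrArg List.sum
      (List.map_congr_left fun g hg => ?_))
    simp only [Function.comp_apply, hf m hm g hg, hf' m hm g hg, map_mul]
    ring

theorem PureP.Correct.channel {d : PureP R f T T'} (h : d.Correct val) :
    (MixedP.channel d).Correct val := by
  rw [MixedP.Correct, MixedP.code, compileCode, foldNode_node, ← compileCode]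
  simp only [compileStep, mixedPCase, Compiled.at, List.map_cons, List.map_nil,
    List.getD_cons_zero, List.getD_cons_succ]
  refine ⟨h.1, by simp, fun τ τ' v v' => ?_⟩
  rw [MixedP.sem, superop_ketbra, mul_ketbra_mul]
  simp [h.2]

theorem MixedP.correct_abs {d : PureE R [] (Δ ++ Δ₀) e T} {d' : MixedE R Δ e₁ T'}
    (h : d.Correct val) (h' : d'.Correct val) : (MixedP.abs Δ Δ₀ d d').Correct val := by
  rw [MixedP.Correct, MixedP.code, compileCode, foldNode_node, ← compileCode]
  simp only [compileStep, mixedPCase, Compiled.at, List.map_cons, List.map_nil,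
    List.getD_cons_zero, List.getD_cons_succ, ctxEnvs_code, tyVals_code]
  refine ⟨Rule.valid_abs h.1 h'.1, ?_, fun w w' v v' => ?_⟩
  · refine (((Env.nodup_all Δ₀).map Env.bits_injective).product h'.2.1).map fun i j h => ?_
    obtain ⟨h₁, h₂⟩ := Nat.pair_eq_pair.1 h
    exact Prod.ext (Encodable.encode_injective h₁) h₂
  have key := Rule.amp_abs val (T := T) (q := (compileCode d'.code).2.1.1) h'.2.1
    (P := fun τ τ₀ v => d.sem val Env.empty v (τ.append τ₀))
    (fun τ τ₀ v => by rw [← Env.bits_append]; exact h.amp val _ v)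
    (fun (τ : Env Δ) (v : Val T') g _ => rfl)
  rw [MixedP.sem, superop_ketbra, map_eq_sum_ketbra, List.product_map_left, List.map_map,
    List.map_map, List.sum_map_product]
  simp only [Function.comp_def]
  rw [List.sum_map_eq_sum_univ (Env.nodup_all Δ₀) (Env.mem_all Δ₀)]
  have hP (τ τ' : Env Δ) : ptrace (Δ := Δ) (Δ₀ := Δ₀)
      ((d.sem val Env.empty).conjTranspose * ketbra w w' * d.sem val Env.empty) τ τ' =
      ∑ τ₀ : Env Δ₀, (starRingEnd ℂ) (d.sem val Env.empty w (τ.append τ₀)) *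
        d.sem val Env.empty w' (τ'.append τ₀) := by
    refine Finset.sum_congr rfl fun τ₀ _ => ?_
    have := mul_ketbra_mul (d.sem val Env.empty).conjTranspose w w' (τ.append τ₀) (τ'.append τ₀)
    rw [Matrix.conjTranspose_conjTranspose] at this
    rw [this]
    simp
  simp only [hP, h'.2.2 _ _ _ _, Finset.sum_mul]
  simp only [← List.sum_map_mul_left]
  have hL : ∀ (τ₀ : Env Δ₀), ∀ g ∈ (compileCode d'.code).2.1.2,
      TL.amp val _ (outL [] v.enc (Nat.pair (encode τ₀.bits) g)) (inL [] [w.enc]) *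
        (starRingEnd ℂ) (TL.amp val _ (outL [] v'.enc (Nat.pair (encode τ₀.bits) g))
          (inL [] [w'.enc])) = _ := fun τ₀ g hg =>
    congrArg₂ (fun x y => x * (starRingEnd ℂ) y) (key w v τ₀ hg) (key w' v' τ₀ hg)
  simp only [List.map_congr_left (hL _)]
  simp only [map_sum, Finset.sum_mul_sum, ← sum_sum_map]
  symm
  rw [Finset.sum_comm]
  refine Finset.sum_congr rfl fun τ _ => ?_
  rw [Finset.sum_comm]
  refine Finset.sum_congr rfl fun τ' _ => Finset.sum_congr rfl fun τ₀ _ =>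
    congrArg List.sum (List.map_congr_left fun g _ => ?_)
  simp only [map_mul, Complex.conj_conj]
  ring

end mixed

/-! #### The induction over derivations -/

mutual
theorem PureE.correct : {Γ Δ : Ctx} → {e : Expr R} → {T : Ty} → (d : PureE R Γ Δ e T) →
    d.Correct val
  | _, _, _, _, .unit _ h => PureE.correct_unit val h
  | _, _, _, _, .cvar _ _ _ _ h => PureE.correct_cvar val h
  | _, _, _, _, .qvar _ _ _ h => PureE.correct_qvar val h
  | _, _, _, _, .pair _ _ _ h d₀ d₁ => d₀.correct.pair val d₁.correct h
  | _, _, _, _, .ctrl _ _ _ _ _ h de o _ er db =>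
    PureE.Correct.ctrl val de.correct (fun j => (db j).correct) h o er
  | _, _, _, _, .app df de => PureE.Correct.app val df.correct de.correct
  | _, _, _, _, .perm πg πd d => d.correct.perm val πg πd

theorem MixedE.correct : {Δ : Ctx} → {e : Expr R} → {T : Ty} → (d : MixedE R Δ e T) →
    d.Correct val
  | _, _, _, .mix d => d.correct.mix val
  | _, _, _, .perm π d => d.correct.perm val π
  | _, _, _, .pair _ _ _ h d₀ d₁ => d₀.correct.pair val d₁.correct h
  | _, _, _, .tryCatch _ _ h d₀ d₁ => d₀.correct.tryCatch val d₁.correct h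
  | _, _, _, .app df de => MixedE.Correct.app val df.correct de.correct

theorem PureP.correct : {f : Prog R} → {T T' : Ty} → (d : PureP R f T T') → d.Correct val
  | _, _, _, .gate rθ rφ rl => PureP.correct_gate val rθ rφ rl
  | _, _, _, .left T₀ T₁ => PureP.correct_left val T₀ T₁
  | _, _, _, .right T₀ T₁ => PureP.correct_right val T₀ T₁
  | _, _, _, .abs d d' => PureP.Correct.abs val d.correct d'.correct
  | _, _, _, .rphase r r' d => PureP.Correct.rphase val d.correct r r'

theorem MixedP.correct : {f : Prog R} → {T T' : Ty} → (d : MixedP R f T T') → d.Correct val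
  | _, _, _, .channel d => d.correct.channel val
  | _, _, _, .abs _ _ d d' => MixedP.correct_abs val d.correct d'.correct
end

end

/-! ### Synthesis of two-level unitaries -/

section
variable {R : Type} [Encodable R] (val : R → ℝ)

theorem bitAt_of_lt {n : ℕ} (b : Fin n → Bool) {i : ℕ} (h : i < n) : bitAt b i = b ⟨i, h⟩ := dif_pos h

@[simp] theorem bitAt_val {n : ℕ} (b : Fin n → Bool) (i : Fin n) : bitAt b i.val = b i :=
  dif_pos i.2

namespace Synth
variable {n : ℕ}

/-- The operator of a gate given by codes of parameters. -/
noncomputable def RawGate.mat (n : ℕ) (g : RawGate) : Matrix (Fin n → Bool) (Fin n → Bool) ℂ :=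
  fun b' b =>
    if ∀ i ∈ g.1, bitAt b i = true then
      if ∀ i : Fin n, i.val ≠ g.2.1 → b' i = b i then
        g.2.2.mat val (bitAt b' g.2.1) (bitAt b g.2.1)
      else 0
    else if b' = b then 1 else 0

/-- The gate fits on `n` wires, and its target is not one of its controls. -/
def RawGate.Fits (n : ℕ) (g : RawGate) : Prop :=
  g.2.1 < n ∧ (∀ i ∈ g.1, i < n) ∧ g.2.1 ∉ g.1

/-- The action of a list of gates on vectors. -/
noncomputable def runGates (n : ℕ) : List RawGate → ((Fin n → Bool) → ℂ) → (Fin n → Bool) → ℂ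
  | [], ψ => ψ
  | g :: l, ψ => runGates n l ((g.mat val n).mulVec ψ)

theorem runGates_append (l l' : List RawGate) (ψ : (Fin n → Bool) → ℂ) :
    runGates val n (l ++ l') ψ = runGates val n l' (runGates val n l ψ) := by
  induction l generalizing ψ with
  | nil => rfl
  | cons g l ih => exact ih _

theorem exists_gates (l : List RawGate) (h : ∀ g ∈ l, g.2.2.Valid R) (hn : ∀ g ∈ l, g.Fits n) :
    ∃ gs : List (Gate R), gs.map Gate.code = l.map RawGate.code ∧ (∀ g ∈ gs, g.Fits n) ∧
      ∀ ψ, (circuitMat val n gs).mulVec ψ = runGates val n l ψ := by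
  induction l with
  | nil => exact ⟨[], rfl, by simp, fun ψ => Matrix.one_mulVec ψ⟩
  | cons g l ih =>
    obtain ⟨gs, h₁, h₂, h₃⟩ := ih (fun g hg => h g (by simp [hg])) fun g hg => hn g (by simp [hg])
    obtain ⟨⟨a, ha⟩, ⟨b, hb⟩, ⟨c, hc⟩, ⟨d, hd⟩⟩ := h g (by simp)
    refine ⟨⟨g.1, g.2.1, a, b, c, d⟩ :: gs, ?_, ?_, fun ψ => ?_⟩
    · rw [List.map_cons, List.map_cons, h₁]
      simp only [Gate.code, RawGate.code, ha, hb, hc, hd]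
    · rintro g' hg'
      rcases List.mem_cons.1 hg' with rfl | hg'
      exacts [hn g (by simp), h₂ g' hg']
    · rw [circuitMat, ← Matrix.mulVec_mulVec, h₃]
      refine congrArg (fun M : Matrix _ _ ℂ => runGates val n l (M.mulVec ψ)) ?_
      funext b' b''
      simp only [Gate.mat, RawGate.mat, Gate.local, Params.mat, ← ha, ← hb, ← hc, ← hd,
        angleVal_code]

/-- The action of a controlled `X` gate on bit strings. -/
def RawGate.flip (g : RawGate) (b : Fin n → Bool) : Fin n → Bool := fun i =>
  if i.val = g.2.1 ∧ ∀ j ∈ g.1, bitAt b j = true then !b i else b i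

/-- The action of a sequence of controlled `X` gates on bit strings. -/
def flips (l : List RawGate) (b : Fin n → Bool) : Fin n → Bool := l.foldl (fun b g => g.flip b) b

theorem RawGate.bitAt_flip {g : RawGate} (hg : g.Fits n) (b : Fin n → Bool) {j : ℕ} (hj : j ∈ g.1) :
    bitAt (g.flip b) j = bitAt b j := by
  rw [bitAt_of_lt _ (hg.2.1 j hj), bitAt_of_lt _ (hg.2.1 j hj), RawGate.flip, if_neg]
  rintro ⟨rfl, -⟩
  exact hg.2.2 hj

theorem RawGate.flip_flip {g : RawGate} (hg : g.Fits n) (b : Fin n → Bool) :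
    g.flip (g.flip b) = b := by
  have h : (∀ j ∈ g.1, bitAt (g.flip b) j = true) ↔ ∀ j ∈ g.1, bitAt b j = true :=
    forall₂_congr fun j hj => by rw [RawGate.bitAt_flip hg b hj]
  funext i
  simp only [RawGate.flip] at h ⊢
  simp only [h]
  split_ifs <;> simp

theorem RawGate.mat_x {g : RawGate} (hg : g.Fits n) (hx : g.2.2 = xParams)
    (ψ : (Fin n → Bool) → ℂ) : (g.mat val n).mulVec ψ = ψ ∘ g.flip := by
  funext b
  change ∑ c, g.mat val n b c * ψ c = ψ (g.flip b)
  have hc (c : Fin n → Bool) : g.mat val n b c = if c = g.flip b then 1 else 0 := by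
    rw [RawGate.mat, hx, Params.mat_xParams]
    by_cases h : ∀ i ∈ g.1, bitAt c i = true
    · rw [if_pos h]
      by_cases h' : ∀ i : Fin n, i.val ≠ g.2.1 → b i = c i
      · have hb : ∀ i ∈ g.1, bitAt b i = true := by
          intro i hi
          have hin := hg.2.1 i hi
          rw [bitAt_of_lt _ hin, h' ⟨i, hin⟩ (fun e => hg.2.2 (e ▸ hi)), ← bitAt_of_lt c hin]
          exact h i hi
        have ht : g.2.1 < n := hg.1
        rw [if_pos h', bitAt_of_lt _ ht, bitAt_of_lt _ ht]
        beta_reduce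
        by_cases e : b ⟨g.2.1, ht⟩ = c ⟨g.2.1, ht⟩
        · rw [if_pos e, if_neg]
          rintro rfl
          simp [RawGate.flip] at e
          obtain ⟨x, hx, hx'⟩ := e
          exact absurd (hb x hx) (by simp [hx'])
        · rw [if_neg e, if_pos]
          funext i
          by_cases hi : i.val = g.2.1
          · obtain rfl : i = ⟨g.2.1, ht⟩ := Fin.ext hi
            rw [RawGate.flip, if_pos ⟨hi, hb⟩]
            exact Bool.eq_not.2 (Ne.symm e)
          · rw [RawGate.flip, if_neg (fun h => hi h.1), h' i hi]
      · rw [if_neg h', if_neg]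
        rintro rfl
        exact h' fun i hi => by rw [RawGate.flip, if_neg (fun h => hi h.1)]
    · rw [if_neg h]
      by_cases e : b = c
      · subst e
        rw [if_pos rfl, if_pos]
        funext i
        rw [RawGate.flip, if_neg (fun h' => h h'.2)]
      · rw [if_neg e, if_neg]
        rintro rfl
        refine e (funext fun i => ?_)
        rw [RawGate.flip, if_neg]
        exact fun h' => h fun j hj => (RawGate.bitAt_flip hg b hj).trans (h'.2 j hj)
  simp only [hc]
  simp

theorem runGates_x {l : List RawGate} (hl : ∀ g ∈ l, g.Fits n ∧ g.2.2 = xParams)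
    (ψ : (Fin n → Bool) → ℂ) : runGates val n l ψ = ψ ∘ flips l.reverse := by
  induction l generalizing ψ with
  | nil => rfl
  | cons g l ih =>
    have hg := hl g (by simp)
    rw [runGates, RawGate.mat_x val hg.1 hg.2, ih fun g hg => hl g (by simp [hg])]
    funext b
    simp [flips]

theorem flips_reverse {l : List RawGate} (hl : ∀ g ∈ l, g.Fits n) (b : Fin n → Bool) :
    flips l.reverse (flips l b) = b := by
  induction l generalizing b with
  | nil => rfl
  | cons g l ih =>
    have : flips (g :: l).reverse (flips (g :: l) b) =
        g.flip (flips l.reverse (flips l (g.flip b))) := by simp [flips]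
    rw [this, ih fun g hg => hl g (by simp [hg]), RawGate.flip_flip (hl g (by simp))]

/-- A gate that is controlled on all wires other than its target is a two-level unitary. -/
theorem RawGate.mat_full {g : RawGate} (ht : g.2.1 < n) (hg : ∀ i, i ∈ g.1 ↔ i < n ∧ i ≠ g.2.1)
    (ψ : (Fin n → Bool) → ℂ) : (g.mat val n).mulVec ψ =
      TL.step val ((fun i => decide (i.val ≠ g.2.1)), (fun _ => true), g.2.2) ψ := by
  classical
  obtain ⟨cs, t, p⟩ := g
  replace ht : t < n := ht
  replace hg : ∀ i, i ∈ cs ↔ i < n ∧ i ≠ t := hg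
  set s : Bool → Fin n → Bool := fun x i => if i.val = t then x else true with hs
  have hs₀ : (fun i : Fin n => decide (i.val ≠ t)) = s false := by
    funext i; by_cases h : i.val = t <;> simp [hs, h]
  have hs₁ : (fun _ : Fin n => true) = s true := by funext i; simp [hs]
  have hst (x : Bool) : s x ⟨t, ht⟩ = x := by simp [hs]
  have hinj {x y : Bool} : s x = s y ↔ x = y :=
    ⟨fun h => by rw [← hst x, h, hst], fun h => by rw [h]⟩
  have hctl (c : Fin n → Bool) : (∀ i ∈ cs, bitAt c i = true) ↔ ∃ x, c = s x := by
    refine ⟨fun h => ⟨c ⟨t, ht⟩, funext fun i => ?_⟩, ?_⟩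
    · by_cases hi : i.val = t
      · obtain rfl : i = ⟨t, ht⟩ := Fin.ext hi
        exact (hst _).symm
      · rw [← bitAt_val c, h i ((hg i).2 ⟨i.2, hi⟩)]
        simp [hs, hi]
    · rintro ⟨x, rfl⟩ i hi
      obtain ⟨hi, hit⟩ := (hg i).1 hi
      rw [bitAt_of_lt _ hi]
      simp [hs, hit]
  have hoff (b : Fin n → Bool) (y : Bool) :
      (∀ i : Fin n, i.val ≠ t → b i = s y i) ↔ ∃ x, b = s x := by
    rw [← hctl]
    refine ⟨fun h i hi => ?_, fun h i hi => ?_⟩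
    · obtain ⟨hi, hit⟩ := (hg i).1 hi
      rw [bitAt_of_lt _ hi, h _ hit]
      simp [hs, hit]
    · rw [← bitAt_val b, h i ((hg i).2 ⟨i.2, hi⟩)]
      simp [hs, hi]
  have hmat (x y : Bool) : RawGate.mat val n (cs, t, p) (s x) (s y) = p.mat val x y := by
    rw [RawGate.mat, if_pos ((hctl _).2 ⟨y, rfl⟩), if_pos ((hoff _ _).2 ⟨x, rfl⟩),
      bitAt_of_lt _ ht, bitAt_of_lt _ ht, hst, hst]
  have hmat₀ (b c : Fin n → Bool) (h : ¬ ∃ x, b = s x) :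
      RawGate.mat val n (cs, t, p) b c = if b = c then 1 else 0 := by
    rw [RawGate.mat]
    by_cases hc : ∃ y, c = s y
    · obtain ⟨y, rfl⟩ := hc
      rw [if_pos ((hctl _).2 ⟨y, rfl⟩), if_neg (fun h' => h ((hoff _ _).1 h')),
        if_neg fun e => h ⟨y, e⟩]
    · rw [if_neg (fun h' => hc ((hctl _).1 h'))]
  have hmat₁ (x : Bool) (c : Fin n → Bool) (h : ¬ ∃ y, c = s y) :
      RawGate.mat val n (cs, t, p) (s x) c = 0 := by
    rw [RawGate.mat, if_neg (fun h' => h ((hctl _).1 h')), if_neg fun e => h ⟨x, e.symm⟩]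
  funext b
  change ∑ c, RawGate.mat val n (cs, t, p) b c * ψ c = _
  rw [hs₀, hs₁]
  simp only [TL.step, LinearMap.coe_mk, AddHom.coe_mk]
  rw [if_neg (by simp [hinj])]
  by_cases hb : ∃ x, b = s x
  · obtain ⟨x, rfl⟩ := hb
    rw [Finset.sum_eq_add (s false) (s true) (by simp [hinj]) (fun c _ hc => by
      rw [hmat₁ x c, zero_mul]
      rintro ⟨y, rfl⟩
      cases y <;> simp [hinj] at hc) (by simp) (by simp), hmat, hmat]
    cases x <;> simp [hinj]
  · rw [Finset.sum_eq_single b (fun c _ hc => by rw [hmat₀ b c hb, if_neg hc.symm, zero_mul])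
      (by simp), hmat₀ b b hb, if_neg fun h => hb ⟨_, h⟩, if_neg fun h => hb ⟨_, h⟩]
    simp

/-! #### Moving two strings to strings that differ on the target wire only -/

section align
variable {t : ℕ} {a b : Bits}

theorem getD_diff (h : diff n a b < n) : a.getD (diff n a b) false ≠ b.getD (diff n a b) false := by
  have hlen : diff n a b < (List.range n).length := by simpa using h
  have heq := List.findIdx_getElem (w := hlen)
  intro e
  have hget : (List.range n)[diff n a b] = diff n a b := List.getElem_range hlen
  change (if a.getD (List.range n)[diff n a b] false = b.getD (List.range n)[diff n a b] false
    then false else true) = true at heq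
  rw [hget, if_pos e] at heq
  exact Bool.false_ne_true heq

theorem toBits_eq_of_diff (h : ¬ diff n a b < n) : toBits n a = toBits n b := by
  funext i
  by_contra hne
  refine h ?_
  have := List.findIdx_lt_length_of_exists (xs := List.range n)
    (p := fun i => if a.getD i false = b.getD i false then false else true)
    ⟨i.val, List.mem_range.2 i.2, if_neg hne⟩
  exact this.trans_eq List.length_range

theorem align_fits (ht : t < n) : ∀ g ∈ align n t a b, g.Fits n ∧ g.2.2 = xParams := by
  intro g hg
  rw [align, List.mem_append, List.mem_flatMap] at hg
  rcases hg with hg | ⟨i, hi, hg⟩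
  · split_ifs at hg
    · obtain rfl := List.mem_singleton.1 hg
      exact ⟨⟨ht, by simp, by simp⟩, rfl⟩
    · simp at hg
  · rw [List.mem_range] at hi
    by_cases h : i = t
    · simp [h] at hg
    rw [if_neg h, List.mem_append] at hg
    rcases hg with hg | hg <;> split_ifs at hg
    · simp at hg
    · obtain rfl := List.mem_singleton.1 hg
      exact ⟨⟨hi, by simp, by simp⟩, rfl⟩
    · simp at hg
    · obtain rfl := List.mem_singleton.1 hg
      exact ⟨⟨hi, by simpa using ht, by simpa using h⟩, rfl⟩

theorem flips_append (l l' : List RawGate) (s : Fin n → Bool) :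
    flips (l ++ l') s = flips l' (flips l s) := List.foldl_append

theorem flips_align_block (ht : t < n) (j : ℕ) (s : Fin n → Bool) (i : Fin n) :
    flips (if j = t then [] else
      (if a.getD j false = true then [] else [([], j, xParams)]) ++
      (if a.getD j false = b.getD j false then [] else [([t], j, xParams)])) s i =
    if i.val = j ∧ j ≠ t then
      (s i ^^ !a.getD j false) ^^ (s ⟨t, ht⟩ && (a.getD j false != b.getD j false))
    else s i := by
  by_cases hj : j = t
  · simp [hj, flips]
  rw [if_neg hj, flips_append]
  have hti : t ≠ j := Ne.symm hj
  by_cases hi : i.val = j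
  · cases ha : a.getD j false <;> cases hb : b.getD j false <;>
      simp [flips, RawGate.flip, hi, hj, bitAt_of_lt _ ht, hti]
    all_goals cases s ⟨t, ht⟩ <;> cases s i <;> rfl
  · rw [if_neg (c := i.val = j ∧ j ≠ t) fun h => hi h.1]
    split_ifs <;> simp [flips, RawGate.flip, hi]

theorem flips_align_blocks (ht : t < n) (l : List ℕ) (hl : l.Nodup) (s : Fin n → Bool) (i : Fin n) :
    flips (l.flatMap fun j => if j = t then [] else
      (if a.getD j false = true then [] else [([], j, xParams)]) ++
      (if a.getD j false = b.getD j false then [] else [([t], j, xParams)])) s i =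
    if i.val ∈ l ∧ i.val ≠ t then
      (s i ^^ !a.getD i.val false) ^^
        (s ⟨t, ht⟩ && (a.getD i.val false != b.getD i.val false))
    else s i := by
  induction l generalizing s with
  | nil => simp [flips]
  | cons j l ih =>
    rw [List.nodup_cons] at hl
    rw [List.flatMap_cons, flips_append, ih hl.2, flips_align_block ht, flips_align_block ht]
    have hti : ¬ (t = j ∧ j ≠ t) := fun h => h.2 h.1.symm
    rw [if_neg hti]
    by_cases hij : i.val = j
    · subst hij
      simp [hl.1]
    · simp [hij]

theorem flips_align (ht : t < n) (hab : a.getD t false ≠ b.getD t false) :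
    flips (align n t a b) (toBits n a) = (fun i => decide (i.val ≠ t)) ∧
      flips (align n t a b) (toBits n b) = fun _ => true := by
  have hstart (s : Fin n → Bool) (i : Fin n) :
      flips (if a.getD t false = true then [([], t, xParams)] else []) s i =
        if i.val = t then (s i ^^ a.getD t false) else s i := by
    by_cases hi : i.val = t <;> cases a.getD t false <;> simp [flips, RawGate.flip, hi]
  constructor <;> funext i <;>
    rw [align, flips_append, flips_align_blocks ht _ List.nodup_range, hstart, hstart] <;>
    by_cases hi : i.val = t
  · simp [hi, toBits]
  · cases ha : a.getD t false <;> cases hb : b.getD t false <;>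
      cases ha' : a.getD i.val false <;> simp_all [toBits]
  · cases ha : a.getD t false <;> cases hb : b.getD t false <;> simp_all [toBits]
  · cases ha : a.getD t false <;> cases hb : b.getD t false <;>
      cases ha' : a.getD i.val false <;> cases hb' : b.getD i.val false <;> simp_all [toBits]

/-- The gates of a two-level unitary conjugate a fully controlled gate by a permutation of the basis
states. -/
theorem runGates_twoLevel (a b : Bits) (g : Params) (ψ : (Fin n → Bool) → ℂ) :
    runGates val n (twoLevel n a b g) ψ = TL.step val (toBits n a, toBits n b, g) ψ := by
  rw [twoLevel]
  split_ifs with ht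
  · have hfit := align_fits (a := a) (b := b) ht
    set t := diff n a b with htd
    obtain ⟨ha, hb⟩ := flips_align ht (getD_diff ht)
    have hrev (s : Fin n → Bool) :
        flips (align n t a b) (flips (align n t a b).reverse s) = s := by
      have := flips_reverse (l := (align n t a b).reverse)
        (fun g hg => (hfit g (List.mem_reverse.1 hg)).1) s
      rwa [List.reverse_reverse] at this
    have hinj : Function.Injective (flips (n := n) (align n t a b).reverse) :=
      Function.LeftInverse.injective hrev
    rw [runGates_append, runGates_x val hfit, runGates, RawGate.mat_full val ht, runGates_x val,
      List.reverse_reverse, ← ha, ← hb]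
    · have := TL.step_comp val hinj (flips (align n t a b) (toBits n a),
        flips (align n t a b) (toBits n b), g) ψ
      rw [flips_reverse fun g hg => (hfit g hg).1, flips_reverse fun g hg => (hfit g hg).1] at this
      rw [← this]
      funext s
      simp only [Function.comp_apply]
      rw [flips_reverse fun g hg => (hfit g hg).1]
    · exact fun g hg => hfit g (List.mem_reverse.1 hg)
    · intro i
      simp only [List.mem_flatMap, List.mem_range]
      constructor
      · rintro ⟨j, hj, h⟩
        split_ifs at h with hjt
        · simp at h
        · obtain rfl := List.mem_singleton.1 h
          exact ⟨hj, hjt⟩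
      · rintro ⟨hi, hit⟩
        exact ⟨i, hi, by rw [if_neg hit]; simp⟩
  · funext s
    simp [runGates, TL.step, toBits_eq_of_diff ht]

theorem runGates_gates (p : TL Bits) (ψ : (Fin n → Bool) → ℂ) :
    runGates val n (gates n p) ψ = TL.run val (p.relabel (toBits n)) ψ := by
  induction p generalizing ψ with
  | nil => rfl
  | cons x p ih =>
    rw [gates, List.flatMap_cons, ← gates, runGates_append, runGates_twoLevel, ih]
    rfl

theorem gates_fits {p : TL Bits} : ∀ g ∈ gates n p, g.Fits n := by
  intro g hg
  obtain ⟨x, -, hg⟩ := List.mem_flatMap.1 hg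
  rw [twoLevel] at hg
  split_ifs at hg with ht
  · rcases List.mem_append.1 hg with hg | hg
    · exact (align_fits ht g hg).1
    rcases List.mem_cons.1 hg with rfl | hg
    · refine ⟨ht, fun i hi => ?_, fun hi => ?_⟩
      all_goals
        obtain ⟨j, hj, hi⟩ := List.mem_flatMap.1 hi
        split_ifs at hi with hjt
      · simp at hi
      · obtain rfl := List.mem_singleton.1 hi
        exact List.mem_range.1 hj
      · simp at hi
      · exact hjt (List.mem_singleton.1 hi).symm
    · exact (align_fits ht g (List.mem_reverse.1 hg)).1
  · simp at hg

theorem gates_valid {p : TL Bits} (hp : p.Valid R) : ∀ g ∈ gates n p, g.2.2.Valid R := by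
  intro g hg
  obtain ⟨x, hx, hg⟩ := List.mem_flatMap.1 hg
  rw [twoLevel] at hg
  split_ifs at hg with ht
  · rcases List.mem_append.1 hg with hg | hg
    · rw [(align_fits ht g hg).2]
      exact Params.valid_xParams
    rcases List.mem_cons.1 hg with rfl | hg
    · exact hp x hx
    · rw [(align_fits ht g (List.mem_reverse.1 hg)).2]
      exact Params.valid_xParams
  · simp at hg

/-- A circuit for a two-level program on bit strings. -/
theorem exists_circuit_gates {p : TL Bits} (hp : p.Valid R) :
    ∃ gs : List (Gate R), gs.map Gate.code = (gates n p).map RawGate.code ∧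
      (∀ g ∈ gs, g.Fits n) ∧ circuitMat val n gs ∈ Matrix.unitaryGroup (Fin n → Bool) ℂ ∧
      ∀ b a, circuitMat val n gs b a = TL.amp val (p.relabel (toBits n)) b a := by
  obtain ⟨gs, h₁, h₂, h₃⟩ := exists_gates val (gates n p) (gates_valid hp) gates_fits
  have h (b a) : circuitMat val n gs b a = TL.amp val (p.relabel (toBits n)) b a := by
    rw [TL.amp, ← runGates_gates, ← h₃, Matrix.mulVec, dotProduct, Finset.sum_eq_single a]
    · simp
    · intro c _ hc
      rw [TL.ket_ne hc, mul_zero]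
    · simp
  refine ⟨gs, h₁, h₂, ?_, h⟩
  rw [Matrix.mem_unitaryGroup_iff']
  ext a' a
  have := TL.sum_conj_amp_mul_amp val (p.relabel (toBits n)) Finset.univ a a' (by simp)
  rw [Matrix.mul_apply, Matrix.one_apply]
  simp only [Matrix.star_apply, h]
  exact this.trans (by rw [TL.ket]; congr)

end align

end Synth
end

/-! ### Circuits from programs -/

section
variable {R : Type} [Encodable R] (val : R → ℝ)

namespace Synth
variable {n : ℕ}

/-- A bit string, continued by zeros. -/
def padded (l : Bits) : ℕ → Bool := fun i => l.getD i false

theorem padded_append (l r : Bits) (i : ℕ) :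
    padded (l ++ r) i = if i < l.length then padded l i else padded r (i - l.length) := by
  simp only [padded]
  split_ifs with h
  · rw [List.getD_append _ _ _ _ h]
  · rw [List.getD_append_right _ _ _ _ (not_lt.1 h)]

theorem padded_cons (x : Bool) (l : Bits) (i : ℕ) :
    padded (x :: l) i = if i = 0 then x else padded l (i - 1) := by
  cases i <;> simp [padded]

@[simp] theorem padded_nil : padded [] = fun _ => false := by funext i; simp [padded]

@[simp] theorem padded_zeros (k : ℕ) : padded (zeros k) = fun _ => false := by
  funext i
  by_cases h : i < k <;> simp [padded, h]

theorem padded_append_zeros (l : Bits) (k : ℕ) : padded (l ++ zeros k) = padded l := by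
  funext i
  rw [padded_append]
  split_ifs with h
  · rfl
  · simp [padded, not_lt.1 h]

theorem padded_append_inj {l l' r r' : Bits} (h : l.length = l'.length) :
    padded (l ++ r) = padded (l' ++ r') ↔ l = l' ∧ padded r = padded r' := by
  constructor
  · intro e
    constructor
    · refine List.ext_getElem h fun i hi hi' => ?_
      have := congrFun e i
      rw [padded_append, padded_append, if_pos hi, if_pos hi'] at this
      simpa [padded, hi, hi'] using this
    · funext i
      have := congrFun e (l.length + i)
      rw [padded_append, padded_append, if_neg (by omega), if_neg (by omega), ← h] at this
      simpa using this
  · rintro ⟨rfl, e⟩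
    funext i
    rw [padded_append, padded_append, e]

theorem padded_inj {l l' : Bits} (h : l.length = l'.length) : padded l = padded l' ↔ l = l' := by
  simpa using padded_append_inj (r := []) (r' := []) h

theorem toBits_eq_of_padded_eq {l l' : Bits} (h : padded l = padded l') : toBits n l = toBits n l' :=
  funext fun i => congrFun h i.val

theorem bitAt_toBits {l : Bits} (h : l.length ≤ n) : bitAt (toBits n l) = padded l := by
  funext i
  by_cases hi : i < n
  · rw [bitAt_of_lt _ hi]; rfl
  · rw [bitAt, dif_neg hi, padded, List.getD_eq_default _ _ (h.trans (not_lt.1 hi))]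

theorem bitAt_injective : Function.Injective (bitAt (n := n)) := fun b c h =>
  funext fun i => by rw [← bitAt_val b, h, bitAt_val]

/-- The labels of a program on bit strings of bounded length may be continued by zeros. -/
theorem amp_relabel_toBits {p : TL Bits} (hp : ∀ x ∈ p, x.1.length ≤ n ∧ x.2.1.length ≤ n)
    {y x : Bits} (hy : y.length ≤ n) (hx : x.length ≤ n) :
    TL.amp val (p.relabel (toBits n)) (toBits n y) (toBits n x) =
      TL.amp val (p.relabel padded) (padded y) (padded x) := by
  rw [← bitAt_toBits hx, ← bitAt_toBits hy, ← TL.amp_relabel val bitAt_injective]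
  congr 1
  rw [TL.relabel, TL.relabel, TL.relabel, List.map_map]
  refine List.map_congr_left fun x hx => ?_
  simp only [Function.comp_apply, bitAt_toBits (hp x hx).1, bitAt_toBits (hp x hx).2]

theorem relabel_pipe {K L L' : Type} (f : L → L') (e : K → L) (tin : List (L × K)) (q : TL K)
    (tout : List (K × L)) : (TL.pipe e tin q tout).relabel f =
      TL.pipe (f ∘ e) (tin.map fun x => (f x.1, x.2)) q (tout.map fun x => (x.1, f x.2)) := by
  simp [TL.pipe, TL.relabel, TL.swaps, Function.comp_def]

theorem padded_hot (M x i : ℕ) : padded (hot M x) i = decide (i = M ∨ i = M + 1 + x) := by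
  rw [hot, padded_append, List.length_replicate, padded_cons, padded_append, List.length_replicate,
    padded_cons, padded_nil]
  have := congrFun (padded_zeros M) i
  have h' := congrFun (padded_zeros x) (i - M - 1)
  simp only [zeros] at this h'
  rw [this, h']
  split_ifs with h₁ h₂ h₃ h₄ <;> simp <;> omega

theorem padded_hot_injective (M : ℕ) : Function.Injective (padded ∘ hot M) := by
  intro x y h
  have := congrFun h (M + 1 + x)
  simp only [Function.comp_apply, padded_hot] at this
  simp at this
  omega

theorem notMem_range_hot {M : ℕ} {l : Bits} (h : padded l M = false) :
    padded l ∉ Set.range (padded ∘ hot M) := by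
  rintro ⟨x, hx⟩
  have := congrFun hx M
  rw [h, Function.comp_apply, padded_hot] at this
  simp at this

theorem length_hot (M x : ℕ) : (hot M x).length = M + 2 + x := by
  simp [hot]; omega

theorem length_le_of_mem_pipe {e : ℕ → Bits} {tin : List (Bits × ℕ)} {q : TL ℕ}
    {tout : List (ℕ × Bits)} (h₁ : ∀ x ∈ tin, x.1.length ≤ n ∧ (e x.2).length ≤ n)
    (h₂ : ∀ x ∈ q, (e x.1).length ≤ n ∧ (e x.2.1).length ≤ n)
    (h₃ : ∀ x ∈ tout, (e x.1).length ≤ n ∧ x.2.length ≤ n) :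
    ∀ x ∈ TL.pipe e tin q tout, x.1.length ≤ n ∧ x.2.1.length ≤ n := by
  intro x hx
  rw [TL.pipe, List.mem_append, List.mem_append] at hx
  rcases hx with (hx | hx) | hx
  · obtain ⟨y, hy, rfl⟩ := List.mem_map.1 hx
    obtain ⟨z, hz, rfl⟩ := List.mem_map.1 hy
    exact h₁ z hz
  · obtain ⟨y, hy, rfl⟩ := List.mem_map.1 hx
    exact h₂ y hy
  · obtain ⟨y, hy, rfl⟩ := List.mem_map.1 hx
    obtain ⟨z, hz, rfl⟩ := List.mem_map.1 hy
    exact h₃ z hz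

section
variable {Γ Δ : Ctx} {T : Ty} {p : TL ℕ} {G : List (ℕ × Bits)} {ng a b : ℕ}

/-- A circuit for a program `p`, given bit strings for the garbage labels: its matrix entries between
encodings of inputs and of outputs are those of `p`, and those for other strings on the garbage wires
vanish. -/
theorem exists_circuit (hp : p.Valid R) (hG : ∀ g ∈ G, g.2.length ≤ ng)
    (h₁ : (G.map Prod.fst).Nodup) (h₂ : (G.map fun g => padded g.2).Nodup)
    (ha : Γ.size + Δ.size = a) (hb : Γ.size + T.size = b) :
    ∃ c : LowCircuit R, c.code = circuitCode ((Env.all Γ).map Env.bits) ((Env.all Δ).map Env.bits)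
        ((Val.all T).map Val.enc) a b p G ng ∧
      c.ngarb = ng ∧ a + c.nprep = b + c.nflag + ng ∧
      (∀ g ∈ c.gates, g.Fits (a + c.nprep)) ∧
      circuitMat val (a + c.nprep) c.gates ∈ Matrix.unitaryGroup (Fin (a + c.nprep) → Bool) ℂ ∧
      (∀ (σ : Env Γ) (τ : Env Δ) (σ' : Env Γ) (v : Val T), ∀ g ∈ G,
        circuitMat val (a + c.nprep) c.gates
          (toBits (a + c.nprep) (σ'.enc ++ v.enc ++ zeros c.nflag ++ g.2))
          (toBits (a + c.nprep) (σ.enc ++ τ.enc ++ zeros c.nprep)) =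
        TL.amp val p (outL σ'.bits v.enc g.1) (inL σ.bits τ.bits)) ∧
      ∀ (σ : Env Γ) (τ : Env Δ) (σ' : Env Γ) (v : Val T) (s : Bits), s.length ≤ ng →
        (∀ g ∈ G, padded s ≠ padded g.2) →
        circuitMat val (a + c.nprep) c.gates
          (toBits (a + c.nprep) (σ'.enc ++ v.enc ++ zeros c.nflag ++ s))
          (toBits (a + c.nprep) (σ.enc ++ τ.enc ++ zeros c.nprep)) = 0 := by
  set K := labelBound ((Env.all Γ).map Env.bits) ((Env.all Δ).map Env.bits)
    ((Val.all T).map Val.enc) p G with hK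
  have hGn : G.Nodup := List.Nodup.of_map _ h₁
  set f := a + 1 + K with hf
  set n := a + (b + 1 + K + ng) with hn
  set P := bitProgram ((Env.all Γ).map Env.bits) ((Env.all Δ).map Env.bits)
    ((Val.all T).map Val.enc) (a + b) f p G with hP
  set tin : List (Bits × ℕ) := (Env.all Γ ×ˢ Env.all Δ).map fun i =>
    (i.1.enc ++ i.2.enc, inL i.1.bits i.2.bits) with htin
  set tout : List (ℕ × Bits) := (Env.all Γ ×ˢ Val.all T ×ˢ G).map fun i =>
    (outL i.1.bits i.2.1.enc i.2.2.1, i.1.enc ++ i.2.1.enc ++ zeros f ++ i.2.2.2) with htout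
  have hP' : P = TL.pipe (hot (a + b)) tin p tout := by
    rw [hP, bitProgram]
    simp only [List.product_map_left, List.product_map_right, List.map_map, Function.comp_def,
      Env.flatten_bits, htin, htout]
  have hPv : P.Valid R := hP' ▸ hp.pipe _ _ _
  have hlin {x : Bits × ℕ} (hx : x ∈ tin) : x.1.length = a ∧ x.2 < K := by
    obtain ⟨⟨σ, τ⟩, -, rfl⟩ := List.mem_map.1 hx
    refine ⟨by simp [Env.length_enc, ha], Rule.lt_bound_of_mem (List.mem_append_left _ ?_)⟩
    exact List.mem_map.2 ⟨(σ.bits, τ.bits), by simp [Env.mem_all], rfl⟩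
  have hlen (σ : Env Γ) (v : Val T) (s : Bits) (hs : s.length ≤ ng) :
      (σ.enc ++ v.enc ++ zeros f ++ s).length ≤ n := by
    simp only [List.length_append, Env.length_enc, Val.length_enc, List.length_replicate]
    omega
  have hlout {x : ℕ × Bits} (hx : x ∈ tout) : x.1 < K ∧ x.2.length ≤ n := by
    obtain ⟨⟨σ, v, g⟩, hi, rfl⟩ := List.mem_map.1 hx
    have hg : g ∈ G := (List.mem_product.1 (List.mem_product.1 hi).2).2
    refine ⟨Rule.lt_bound_of_mem (List.mem_append_right _ ?_), hlen σ v g.2 (hG g hg)⟩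
    exact List.mem_map.2 ⟨(σ.bits, v.enc, g), by simp [Env.mem_all, Val.mem_all, hg], rfl⟩
  have hhot {x : ℕ} (hx : x < K) : (hot (a + b) x).length ≤ n := by
    rw [length_hot]; omega
  have hPl : ∀ x ∈ P, x.1.length ≤ n ∧ x.2.1.length ≤ n := by
    rw [hP']
    refine length_le_of_mem_pipe (fun x hx => ⟨?_, hhot (hlin hx).2⟩)
      (fun x hx => ?_) fun x hx =>
        ⟨hhot (hlout hx).1, (hlout hx).2⟩
    · rw [(hlin hx).1]; omega
    · have := Rule.lt_bound_of_mem_program (((((Env.all Γ).map Env.bits) ×ˢ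
        ((Env.all Δ).map Env.bits)).map fun i => inL i.1 i.2) ++
        ((((Env.all Γ).map Env.bits) ×ˢ ((Val.all T).map Val.enc) ×ˢ G).map fun i =>
          outL i.1 i.2.1 i.2.2.1)) hx
      change x.1 < K ∧ x.2.1 < K at this
      exact ⟨hhot this.1, hhot this.2⟩
  obtain ⟨gs, e₁, e₂, e₃, e₄⟩ := exists_circuit_gates val (n := n) hPv
  have key (y x : Bits) (hy : y.length ≤ n) (hx : x.length ≤ n) :
      circuitMat val n gs (toBits n y) (toBits n x) =
        TL.amp val (TL.pipe (padded ∘ hot (a + b)) (tin.map fun x => (padded x.1, x.2)) p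
          (tout.map fun x => (x.1, padded x.2))) (padded y) (padded x) := by
    rw [e₄, amp_relabel_toBits val hPl hy hx, hP', relabel_pipe]
  have hout {σ σ' : Env Γ} {v v' : Val T} {s s' : Bits} :
      padded (σ.enc ++ v.enc ++ zeros f ++ s) = padded (σ'.enc ++ v'.enc ++ zeros f ++ s') ↔
        σ = σ' ∧ v = v' ∧ padded s = padded s' := by
    rw [padded_append_inj (by simp [Env.length_enc, Val.length_enc]), List.append_cancel_right_eq]
    constructor
    · rintro ⟨h, h'⟩
      obtain ⟨e, e'⟩ := List.append_inj h (by simp [Env.length_enc])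
      exact ⟨Env.enc_injective e, Val.enc_injective T e', h'⟩
    · rintro ⟨rfl, rfl, h⟩
      exact ⟨rfl, h⟩
  -- the wire that marks internal labels is `0` for encodings of inputs and of outputs
  have hwire (σ : Env Γ) (v : Val T) (s : Bits) :
      padded (σ.enc ++ v.enc ++ zeros f ++ s) (a + b) = false := by
    rw [padded_append, if_pos (by simp [Env.length_enc, Val.length_enc]; omega),
      padded_append_zeros, padded, List.getD_eq_default]
    simp [Env.length_enc, Val.length_enc]
    omega
  obtain ⟨H₁, H₂, -, -⟩ := TL.amp_pipe val (padded_hot_injective (a + b))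
    (tin := tin.map fun x => (padded x.1, x.2)) (q := p)
    (tout := tout.map fun x => (x.1, padded x.2))
    (by
      simp only [htin, List.map_map, Function.comp_def]
      refine ((Env.nodup_all Γ).product (Env.nodup_all Δ)).map fun i j h => ?_
      rw [padded_inj (by simp [Env.length_enc])] at h
      obtain ⟨h, h'⟩ := List.append_inj h (by simp [Env.length_enc])
      exact Prod.ext (Env.enc_injective h) (Env.enc_injective h'))
    (by
      simp only [htin, List.map_map, Function.comp_def]
      refine ((Env.nodup_all Γ).product (Env.nodup_all Δ)).map fun i j h => ?_
      simpa [Prod.ext_iff] using h)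
    (by
      simp only [htout, List.map_map, Function.comp_def]
      refine List.Nodup.map_on (fun i hi j hj h => ?_)
        ((Env.nodup_all Γ).product ((Val.nodup_all T).product hGn))
      simp only [outL_inj, Env.bits_inj, Val.enc_inj] at h
      exact Prod.ext h.1 (Prod.ext h.2.1 (List.inj_on_of_nodup_map h₁
        (List.mem_product.1 (List.mem_product.1 hi).2).2
        (List.mem_product.1 (List.mem_product.1 hj).2).2 h.2.2)))
    (by
      simp only [htout, List.map_map, Function.comp_def]
      refine List.Nodup.map_on (fun i hi j hj h => ?_)
        ((Env.nodup_all Γ).product ((Val.nodup_all T).product hGn))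
      obtain ⟨e, e', e''⟩ := hout.1 h
      exact Prod.ext e (Prod.ext e' (List.inj_on_of_nodup_map h₂
        (List.mem_product.1 (List.mem_product.1 hi).2).2
        (List.mem_product.1 (List.mem_product.1 hj).2).2 e'')))
    (by
      intro x hx
      obtain ⟨y, hy, rfl⟩ := List.mem_map.1 hx
      refine notMem_range_hot ?_
      rw [padded, List.getD_eq_default]
      rw [(hlin hy).1]; omega)
    (by
      intro x hx
      obtain ⟨y, hy, rfl⟩ := List.mem_map.1 hx
      obtain ⟨i, -, rfl⟩ := List.mem_map.1 hy
      exact notMem_range_hot (hwire _ _ _))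
  have hin (σ : Env Γ) (τ : Env Δ) :
      (padded (σ.enc ++ τ.enc), inL σ.bits τ.bits) ∈ tin.map fun x => (padded x.1, x.2) :=
    List.mem_map.2 ⟨_, List.mem_map.2 ⟨(σ, τ), by simp [Env.mem_all], rfl⟩, rfl⟩
  have hinl (σ : Env Γ) (τ : Env Δ) : (σ.enc ++ τ.enc).length ≤ n := by
    simp only [List.length_append, Env.length_enc]
    omega
  have hz (σ : Env Γ) (τ : Env Δ) (k : ℕ) :
      toBits n (σ.enc ++ τ.enc ++ zeros k) = toBits n (σ.enc ++ τ.enc) :=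
    toBits_eq_of_padded_eq (padded_append_zeros _ _)
  refine ⟨⟨b + 1 + K + ng, f, ng, gs⟩, ?_, rfl, by simp only; omega, e₂, e₃, ?_, ?_⟩
  · rw [LowCircuit.code, e₁]
    rfl
  · intro σ τ σ' v g hg
    change circuitMat val n gs (toBits n _) (toBits n _) = _
    rw [hz, key _ _ (hlen σ' v g.2 (hG g hg)) (hinl σ τ)]
    exact H₁ _ (hin σ τ) _ (List.mem_map.2 ⟨_, List.mem_map.2
      ⟨(σ', v, g), by simp [Env.mem_all, Val.mem_all, hg], rfl⟩, rfl⟩)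
  · intro σ τ σ' v s hs hs'
    change circuitMat val n gs (toBits n _) (toBits n _) = _
    rw [hz, key _ _ (hlen σ' v s hs) (hinl σ τ)]
    refine H₂ _ (hin σ τ) _ (fun h => ?_) (notMem_range_hot (hwire _ _ _))
    obtain ⟨y, hy, h⟩ := List.mem_map.1 h
    obtain ⟨z, hz, rfl⟩ := List.mem_map.1 hy
    obtain ⟨i, hi, rfl⟩ := List.mem_map.1 hz
    exact hs' i.2.2 (List.mem_product.1 (List.mem_product.1 hi).2).2 (hout.1 h).2.2.symm

end
end Synth
end

/-! ### The compiled circuits implement the semantics -/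

section
variable {R : Type} [Encodable R] (val : R → ℝ)

namespace Synth

theorem padded_ofFn {n : ℕ} (g : Fin n → Bool) : padded (List.ofFn g) = bitAt g := by
  funext i
  by_cases h : i < n
  · rw [bitAt_of_lt _ h, padded, List.getD_eq_getElem _ _ (by simpa using h), List.getElem_ofFn]
  · rw [bitAt, dif_neg h, padded, List.getD_eq_default _ _ (by simpa using h)]

theorem padded_oneHot (k i : ℕ) : padded (zeros k ++ [true]) i = decide (i = k) := by
  rw [padded_append, List.length_replicate, padded_cons, padded_nil, padded_zeros]
  split_ifs <;> simp <;> omega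

theorem garbageBits_fst (G : List ℕ) : (garbageBits G).map Prod.fst = G := by
  refine List.ext_getElem (by simp [garbageBits]) fun i h h' => ?_
  simp [garbageBits, h']

theorem nodup_garbageBits_snd (G : List ℕ) : ((garbageBits G).map fun g => padded g.2).Nodup := by
  rw [garbageBits, List.map_map]
  refine List.nodup_range.map fun i j h => ?_
  have := congrFun h i
  simp only [Function.comp_apply, padded_oneHot] at this
  simpa using this

section
variable {Γ Δ : Ctx} {T : Ty} {p : TL ℕ} {a b : ℕ}

/-- The circuit of a program whose amplitudes are the entries of an operator. -/
theorem exists_implementsKraus (hp : p.Valid R) (ha : Γ.size + Δ.size = a)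
    (hb : Γ.size + T.size = b) {ι κ : Type} {encIn : ι → List Bool} {encOut : κ → List Bool}
    {E : Matrix κ ι ℂ} (i : ι → Env Γ × Env Δ) (o : κ → Env Γ × Val T)
    (hi : ∀ x, encIn x = (i x).1.enc ++ (i x).2.enc)
    (ho : ∀ y, encOut y = (o y).1.enc ++ (o y).2.enc)
    (hE : ∀ x y, TL.amp val p (outL (o y).1.bits (o y).2.enc 0) (inL (i x).1.bits (i x).2.bits) =
      E y x) :
    ∃ c : LowCircuit R, c.code = circuitCode ((Env.all Γ).map Env.bits) ((Env.all Δ).map Env.bits)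
        ((Val.all T).map Val.enc) a b p [(0, [])] 0 ∧
      c.ImplementsKraus val a b encIn encOut E := by
  obtain ⟨c, h₁, h₂, h₃, h₄, h₅, h₆, -⟩ := exists_circuit val (G := [(0, [])]) (ng := 0) hp
    (by simp) (by simp) (by simp) ha hb
  refine ⟨c, h₁, h₂, h₃, h₄, h₅, fun x y => ?_⟩
  rw [hi, ho, ← hE]
  simpa using h₆ (i x).1 (i x).2 (o y).1 (o y).2 (0, []) (by simp)

/-- The circuit of a program that realizes a superoperator. Each garbage label is represented by a
string with a single `1` on the garbage wires; on the other strings no amplitude arrives, so that the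
trace over the garbage wires is the sum over the garbage labels. -/
theorem exists_implementsSuperop (hp : p.Valid R) {G : List ℕ} (hG : G.Nodup)
    {ι : Type} [Fintype ι] [DecidableEq ι] (i : ι → Env Δ) {encIn : ι → List Bool}
    (hi : ∀ x, encIn x = (i x).enc) (ha : Δ.size = a)
    {E : Matrix ι ι ℂ →ₗ[ℂ] Matrix (Val T) (Val T) ℂ}
    (hE : TL.Dilates val p G (fun x => (i x).bits) E) :
    ∃ c : LowCircuit R, c.code = circuitCode ((Env.all []).map Env.bits)
        ((Env.all Δ).map Env.bits) ((Val.all T).map Val.enc) a T.size p (garbageBits G) G.length ∧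
      c.ImplementsSuperop val a T.size encIn Val.enc E := by
  obtain ⟨⟨np, nf, ng, gs⟩, h₁, h₂, h₃, h₄, h₅, h₆, h₇⟩ := exists_circuit val (Γ := []) (Δ := Δ)
    (T := T) (G := garbageBits G) (ng := G.length) (a := a) (b := T.size) hp
    (fun g hg => by
      obtain ⟨k, hk, rfl⟩ := List.mem_map.1 hg
      simpa using hk)
    (by rwa [garbageBits_fst]) (nodup_garbageBits_snd G) (by simpa [Ctx.size] using ha)
    (by simp [Ctx.size])
  simp only at h₂ h₃ h₄ h₅ h₆ h₇
  subst h₂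
  refine ⟨_, h₁, h₃, h₄, h₅, fun ρ v₁ v₂ => ?_⟩
  simp only
  set n := a + np with hn
  set U := circuitMat val n gs with hU
  -- the entries between encodings, for a string `g` on the garbage wires
  set A : (Fin G.length → Bool) → Val T → ι → ℂ := fun g v x =>
    U (toBits n (v.enc ++ zeros nf ++ List.ofFn g)) (toBits n (encIn x ++ zeros np)) with hA
  have hA₀ (g : Fin G.length → Bool) (hg : g ∉ Set.range fun k => fun j => decide (j = k))
      (v : Val T) (x : ι) : A g v x = 0 := by
    have := h₇ Env.empty (i x) Env.empty v (List.ofFn g) (by simp) (fun y hy e => hg ?_)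
    · rw [hA]
      simp only [hi]
      exact this
    · obtain ⟨k, hk, rfl⟩ := List.mem_map.1 hy
      refine ⟨⟨k, List.mem_range.1 hk⟩, funext fun j => ?_⟩
      have := congrFun e j.val
      rw [padded_ofFn, bitAt_val, padded_oneHot] at this
      rw [this]
      simp [Fin.ext_iff]
  have hA₁ (k : Fin G.length) (v : Val T) (x : ι) : A (fun j => decide (j = k)) v x =
      TL.amp val p (outL [] v.enc G[k.val]) (inL [] (i x).bits) := by
    have := h₆ Env.empty (i x) Env.empty v (G.getD k 0, zeros k ++ [true])
      (List.mem_map.2 ⟨k, by simp, rfl⟩)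
    rw [List.getD_eq_getElem _ _ k.2] at this
    refine Eq.trans ?_ this
    rw [hA]
    simp only [hi]
    refine congrArg₂ U (toBits_eq_of_padded_eq ?_) rfl
    refine (padded_append_inj rfl).2 ⟨rfl, ?_⟩
    funext j
    rw [padded_ofFn, padded_oneHot]
    by_cases hj : j < G.length
    · rw [bitAt_of_lt _ hj]
      simp [Fin.ext_iff]
    · rw [bitAt, dif_neg hj, eq_comm, decide_eq_false_iff_not]
      rintro rfl
      exact hj k.2
  have hmat (g : Fin G.length → Bool) :
      (U * (∑ v, ∑ w, Matrix.single (toBits n (encIn v ++ zeros np))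
        (toBits n (encIn w ++ zeros np)) (ρ v w)) * U.conjTranspose)
        (toBits n (v₁.enc ++ zeros nf ++ List.ofFn g))
        (toBits n (v₂.enc ++ zeros nf ++ List.ofFn g)) =
      ∑ x, ∑ x', ρ x x' * (A g v₁ x * (starRingEnd ℂ) (A g v₂ x')) := by
    simp only [Finset.mul_sum, Finset.sum_mul, Matrix.sum_apply]
    refine Finset.sum_congr rfl fun x _ => Finset.sum_congr rfl fun x' _ => ?_
    rw [show ∀ y y' : Fin n → Bool, Matrix.single y y' (ρ x x') = ρ x x' • ketbra y y' by simp,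
      Matrix.mul_smul, Matrix.smul_mul, Matrix.smul_apply, mul_ketbra_mul, smul_eq_mul]
  simp only [hmat]
  rw [map_eq_sum_ketbra]
  refine Eq.trans ?_ (Fintype.sum_of_injective (fun (k : Fin G.length) => fun j => decide (j = k))
    (fun k k' h => by simpa using congrFun h k)
    (fun k => ∑ x, ∑ x', ρ x x' * (A (fun j => decide (j = k)) v₁ x *
      (starRingEnd ℂ) (A (fun j => decide (j = k)) v₂ x'))) _
    (fun g hg => by simp [hA₀ g hg]) fun _ => rfl)
  simp only [hA₁, hE _ _ _ _, ← Fin.sum_univ_fun_getElem, Finset.mul_sum]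
  symm
  rw [Finset.sum_comm]
  exact Finset.sum_congr rfl fun x _ => Finset.sum_comm

end
end Synth

/-! #### The conclusions of derivations -/

theorem PureE.concl {Γ Δ : Ctx} {e : Expr R} {T : Ty} (d : PureE R Γ Δ e T) :
    pureEConcl d.code = (Γ.map fun b => b.2.code, Δ.map fun b => b.2.code, T.code) := by
  cases d <;> simp [pureEConcl, PureE.code, ctxTys_code, Ty.code]

theorem MixedE.concl {Δ : Ctx} {e : Expr R} {T : Ty} (d : MixedE R Δ e T) :
    mixedEConcl d.code = ([], Δ.map fun b => b.2.code, T.code) := by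
  cases d <;> simp [mixedEConcl, MixedE.code, ctxTys_code, Ty.code]

theorem PureP.concl {f : Prog R} {T T' : Ty} (d : PureP R f T T') :
    purePConcl d.code = ([], [T.code], T'.code) := by
  cases d <;> simp [purePConcl, PureP.code, Ty.code]

theorem MixedP.concl {f : Prog R} {T T' : Ty} (d : MixedP R f T T') :
    mixedPConcl d.code = ([], [T.code], T'.code) := by
  cases d <;> simp [mixedPConcl, MixedP.code]

theorem exists_implements (d : Deriv R) :
    ∃ c : LowCircuit R, c.code = compileDeriv d.code ∧ c.Implements val d := by
  have hT (T : Ty) : [T.code] = ([(0, T)] : Ctx).map fun b => b.2.code := rfl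
  have h0 : ([] : List ℕ) = ([] : Ctx).map fun b => b.2.code := rfl
  have hs (T : Ty) : Ctx.size [(0, T)] = T.size := rfl
  have hs0 : Ctx.size [] = 0 := rfl
  cases d with
  | @pureE Γ Δ e T d =>
    have hd := d.correct val
    rw [Deriv.code, compileDeriv, tagOf_node, kids_node]
    simp only [List.getD_cons_zero, pureCircuit, d.concl, envs_map_code, tysSize_map_code,
      tyVals_code, tyData_code]
    exact Synth.exists_implementsKraus val hd.1 rfl rfl id id (fun _ => rfl) (fun _ => rfl)
      fun x y => hd.2 x.1 x.2 y.1 y.2 0 (by simp)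
  | @mixedE Δ e T d =>
    have hd := d.correct val
    rw [Deriv.code, compileDeriv, tagOf_node, kids_node]
    simp only [List.getD_cons_zero, List.getD_cons_succ, mixedCircuit, d.concl, h0, envs_map_code,
      tysSize_map_code, tyVals_code, tyData_code, hs0, zero_add]
    exact Synth.exists_implementsSuperop val hd.1 hd.2.1 id (fun _ => rfl) rfl hd.2.2
  | @pureP f T T' d =>
    have hd := d.correct val
    rw [Deriv.code, compileDeriv, tagOf_node, kids_node]
    simp only [List.getD_cons_zero, List.getD_cons_succ, pureCircuit, d.concl, hT]
    simp only [h0, envs_map_code,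
      tysSize_map_code, tyVals_code, tyData_code, hs, hs0, zero_add]
    exact Synth.exists_implementsKraus val hd.1 (by simp [hs, hs0]) (by simp [hs0])
      (fun v => (Env.empty, Env.cons v Env.empty)) (fun v => (Env.empty, v))
      (fun v => (List.append_nil _).symm) (fun _ => rfl) hd.2
  | @mixedP f T T' d =>
    have hd := d.correct val
    rw [Deriv.code, compileDeriv, tagOf_node, kids_node]
    simp only [List.getD_cons_zero, List.getD_cons_succ, mixedCircuit, d.concl, hT]
    simp only [h0, envs_map_code,
      tysSize_map_code, tyVals_code, tyData_code, hs, hs0, zero_add]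
    exact Synth.exists_implementsSuperop val hd.1 hd.2.1 (fun v => Env.cons v Env.empty)
      (fun v => (List.append_nil _).symm) rfl hd.2.2

end

theorem mainTheorem2 {R : Type} [Encodable R] (val : R → ℝ) :
    ∃ compile : Deriv R → LowCircuit R,
      IsRecursiveProcedure compile ∧ ∀ d : Deriv R, (compile d).Implements val d := by
  choose compile hcode himpl using exists_implements val
  exact ⟨compile, ⟨compileDeriv, primrec_compileDeriv.to_comp, fun d => (hcode d).symm⟩, himpl⟩
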